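/- Let $k$ be a field, $K\supseteq k$ an algebraically closed field, and let $C$ be a smooth projective curve of genus $1$ over $k$ with a $k$-rational point, given by a Weierstrass equation over $k$ with nonzero discriminant (an elliptic curve). Fix $P\in C(k)$ (not necessarily the point at infinity). Points of $C$ below are points of $C(K)$; we use the group law of $C\cong\operatorname{Pic}^0(C)$, so that $Q-P$ is an element of a group. Fix integers $m\ge 2$, $\ell\ge 1$, $c,d\ge 0$, and integers $a_i^j,b_i^j\ge 0$ ($1\le i\le m$, $0\le j\le \ell$) such that $a_i^j+b_i^j=d-1$ and $a_i^j-c\notin\{0,-1\}$ for all $i,j$, and such that $\sum_i a_i^j$ does not depend on $j$. Let $U$ be the set of $Q\in C(K)$ such that, for all $i,j$, $Q-P$ is neither $|a_i^j-c|$-torsion nor $|a_i^j+1-c|$-torsion (in particular $Q\ne P$). For $Q\in U$ let $s_i^j$ be a nonzero section of $\mathscr O_C(cP+(d-c)Q)$ vanishing to order at least $a_i^j$ at $P$ and at least $b_i^j$ at $Q$ (it exists and is unique up to scalar), and put $s^j=s_1^j\otimes\cdots\otimes s_m^j$. All $s^j$ vanish to the same order at $P$, and to the same order at $Q$, so their values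 at $P$ and at $Q$ can be compared through the rational functions $s^j/s^{j'}$. Normalize the $s^j$, uniquely up to a simultaneous scalar, so that $(s^j/s^{j'})(P)=1$ for all $j,j'$, and let $f_Q=(s^0(Q):\cdots:s^\ell(Q))\in\mathbb P^\ell(K)$ be the point with homogeneous coordinates $v_0,\dots,v_\ell\in K^\times$ satisfying $v_j/v_{j'}=(s^j/s^{j'})(Q)$. Then: 1. For every $Q\in U$ the point $f_Q$ exists and is well defined, and the map $U\to\mathbb P^\ell$, $Q\mapsto f_Q$, extends to a morphism $f:C\to\mathbb P^\ell$ defined over $k$. 2. For all $j,j'\in\{0,\dots,\ell\}$, the function $U\to K^\times$ sending $Q$ to the ratio of the $j$-th and the $j'$-th homogeneous coordinate of $f_Q$ is given by a rational function $f_{j,j'}$ on $C$, defined over $k$, with $$\operatorname{div} f_{j,j'}=\sum_{i=1}^m\Big((P+\operatorname{Pic}^0(C)[|a_i^j-c|])-(P+\operatorname{Pic}^0(C)[|a_i^{j'}-c|])-(P+\operatorname{Pic}^0(C)[|a_i^j+1-c|])+(P+\operatorname{Pic}^0(C)[|a_i^{j'}+1-c|])\Big),$$ where, for $n\ge 1$,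 $P+\operatorname{Pic}^0(C)[n]$ denotes the divisor consisting of all points $T\in C(K)$ with $n(T-P)=0$, each with multiplicity the inseparable degree of multiplication by $n$ on $C_K$. 3. Suppose further that $C$ is not supersingular (that is, it is not the case that $K$ has characteristic $p>0$ and $C(K)$ has no nonzero $p$-torsion), that $m=2$, that the $2(\ell+1)$ numbers $a_i^j$ are pairwise distinct, that $a_1^j+a_2^j\ne 2c-1$ for all $j$, and that for each $j$ exactly one of $a_1^j,a_2^j$ is less than $c$. Then $f$ is nondegenerate: its image is not contained in any hyperplane of $\mathbb P^\ell$ over $K$. -/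

import Mathlib

open WeierstrassCurve
open scoped WeierstrassCurve Polynomial

noncomputable section

namespace MarkedGenusOne

/-! ## Rational functions and divisors on an elliptic curve

`E` is an elliptic curve over a field `K` (algebraically closed in all uses below), `E.toAffine.Point`
its set of points (including the point at infinity) with Mathlib's group law, and
`E.toAffine.FunctionField` its field of rational functions. -/

section Curve

variable {K : Type*} [Field K] (E : WeierstrassCurve K)

/-- Homogeneous coordinates of a point in the projective plane: `[0 : 1 : 0]` for the point at
infinity and `[x : y : 1]` for an affine point. -/
def coords {E : WeierstrassCurve K} : E.toAffine.Point → Fin 3 → K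
  | .zero => ![0, 1, 0]
  | .some x y _ => ![x, y, 1]

/-- The coordinate function `X` in the function field. -/
def xFun : E.toAffine.FunctionField :=
  algebraMap E.toAffine.CoordinateRing _ (Affine.CoordinateRing.mk E.toAffine (Polynomial.C Polynomial.X))

/-- The coordinate function `Y` in the function field. -/
def yFun : E.toAffine.FunctionField :=
  algebraMap E.toAffine.CoordinateRing _ (Affine.CoordinateRing.mk E.toAffine Polynomial.X)

/-- The restriction to the curve of the dehomogenization `A(X, Y, 1)` of a polynomial in three
variables. -/
def dehom (A : MvPolynomial (Fin 3) K) : E.toAffine.FunctionField :=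
  MvPolynomial.aeval ![xFun E, yFun E, 1] A

variable {E}

/-- The rational function `g` is regular at `Q` and takes the value `v` there: `g` is a quotient
`A / B` of forms of the same degree with `B(Q) ≠ 0`, and `v = A(Q) / B(Q)`. -/
def HasValue (Q : E.toAffine.Point) (g : E.toAffine.FunctionField) (v : K) : Prop :=
  ∃ (n : ℕ) (A B : MvPolynomial (Fin 3) K), A.IsHomogeneous n ∧ B.IsHomogeneous n ∧
    MvPolynomial.eval (coords Q) B ≠ 0 ∧ g = dehom E A / dehom E B ∧
    v = MvPolynomial.eval (coords Q) A / MvPolynomial.eval (coords Q) B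

/-- `t` is a uniformizer at `Q`: it generates the maximal ideal of the local ring at `Q`. -/
def IsUniformizerAt (Q : E.toAffine.Point) (t : E.toAffine.FunctionField) : Prop :=
  HasValue Q t 0 ∧ ∀ h, HasValue Q h 0 → ∃ r w, HasValue Q r w ∧ h = r * t

/-- The rational function `g` is nonzero and has order of vanishing `n` at `Q`: `g = u * t ^ n` with
`t` a uniformizer at `Q` and `u` a unit of the local ring at `Q`. -/
def HasOrder (Q : E.toAffine.Point) (g : E.toAffine.FunctionField) (n : ℤ) : Prop :=
  ∃ t u v, IsUniformizerAt Q t ∧ HasValue Q u v ∧ v ≠ 0 ∧ g = u * t ^ n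

/-- `div g = D`, where a divisor is given by its coefficient function. -/
def HasDivisor (g : E.toAffine.FunctionField) (D : E.toAffine.Point → ℤ) : Prop :=
  ∀ T, HasOrder T g (D T)

/-- The divisor of a single point. -/
def ptDiv [DecidableEq K] (P : E.toAffine.Point) : E.toAffine.Point → ℤ := Pi.single P 1

/-- `s` is a nonzero global section of `𝒪(cP + (d - c)Q)` (that is, a nonzero rational function with
`div s + cP + (d - c)Q ≥ 0`), which, as a section of this line bundle, vanishes to order at least `a`
at `P` and at least `b` at `Q`. For `P ≠ Q` both together mean
`div s + cP + (d - c)Q ≥ aP + bQ`. -/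
def IsVanishingSection [DecidableEq K] (P Q : E.toAffine.Point) (c d a b : ℕ)
    (s : E.toAffine.FunctionField) : Prop :=
  ∃ D : E.toAffine.Point → ℤ, HasDivisor s D ∧
    ∀ T, ((a : ℤ) • ptDiv P + (b : ℤ) • ptDiv Q) T ≤
      (D + ((c : ℤ) • ptDiv P + ((d : ℤ) - c) • ptDiv Q)) T

/-- `v` is a vector of homogeneous coordinates of the point
`f_Q = (s^0(Q) : ⋯ : s^ℓ(Q))`. Here `s^j = s_1^j ⊗ ⋯ ⊗ s_m^j`, where `s_i^j` is a section of
`𝒪(cP + (d - c)Q)` vanishing to order at least `a_i^j` at `P` and `b_i^j` at `Q`, and the `s^j` are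
normalized to have the same value at `P`. As all `s^j` have the same order of vanishing at `P`, and
at `Q`, their values at these points are compared through the rational functions `s^j / s^{j'}`. -/
def IsSectionPoint [DecidableEq K] {m l : ℕ} (P Q : E.toAffine.Point) (c d : ℕ)
    (a b : Fin m → Fin (l + 1) → ℕ) (v : Fin (l + 1) → K) : Prop :=
  ∃ s : Fin m → Fin (l + 1) → E.toAffine.FunctionField,
    (∀ i j, IsVanishingSection P Q c d (a i j) (b i j) (s i j)) ∧
    (∀ j j', HasValue P ((∏ i, s i j) / ∏ i, s i j') 1) ∧
    (∀ j, v j ≠ 0) ∧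
    (∀ j j', HasValue Q ((∏ i, s i j) / ∏ i, s i j') (v j / v j'))

/-- The set `U` of the points `Q` such that `Q - P` is neither `|a_i^j - c|`-torsion nor
`|a_i^j + 1 - c|`-torsion for any `i`, `j`. -/
def goodLocus [DecidableEq K] {m l : ℕ} (P : E.toAffine.Point) (c : ℕ)
    (a : Fin m → Fin (l + 1) → ℕ) : Set E.toAffine.Point :=
  {Q | ∀ i j, ((a i j : ℤ) - c).natAbs • (Q - P) ≠ 0 ∧ ((a i j : ℤ) + 1 - c).natAbs • (Q - P) ≠ 0}

end Curve

/-! ## Multiplication by `n` and torsion divisors -/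

section Torsion

variable {K : Type*} [Field K] (E : WeierstrassCurve K)

theorem equation_generic :
    (E⁄(E.toAffine.FunctionField)).toAffine.Equation (xFun E) (yFun E) := by
  have h : algebraMap E.toAffine.CoordinateRing E.toAffine.FunctionField
      (Affine.CoordinateRing.mk E.toAffine E.toAffine.polynomial) = 0 := by
    rw [show Affine.CoordinateRing.mk E.toAffine E.toAffine.polynomial = 0 from AdjoinRoot.mk_self,
      map_zero]
  have hc : ∀ r : K, algebraMap K E.toAffine.FunctionField r =
      algebraMap E.toAffine.CoordinateRing E.toAffine.FunctionField
        (Affine.CoordinateRing.mk E.toAffine (Polynomial.C (Polynomial.C r))) := fun r => rfl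
  rw [Affine.equation_iff']
  simp only [baseChange, map_a₁, map_a₂, map_a₃, map_a₄, map_a₆, hc]
  simp only [Affine.polynomial, map_sub, map_add, map_mul, map_pow] at h
  simp only [xFun, yFun]
  linear_combination h

instance baseChange_isElliptic {k A : Type*} [CommRing k] [CommRing A] [Algebra k A]
    (W : WeierstrassCurve k) [W.IsElliptic] : (W⁄A).IsElliptic :=
  inferInstanceAs (W.map (algebraMap k A)).IsElliptic

/-- The generic point `(X, Y)` of an elliptic curve, a point over its function field. -/
def genericPoint [E.IsElliptic] : (E⁄(E.toAffine.FunctionField)).toAffine.Point :=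
  Affine.Point.mk (equation_generic E)

open Classical in
/-- The inseparable degree of multiplication by `n ≠ 0` on `E`. The corresponding map of function
fields sends `(X, Y)` to the coordinates `(x, y)` of `n` times the generic point, so this is the
inseparable degree of `K(E)` over `K(x, y)`. -/
def mulInsepDegree [E.IsElliptic] (n : ℕ) : ℕ :=
  match n • genericPoint E with
  | .zero => 0
  | .some x y _ =>
    Field.finInsepDegree (IntermediateField.adjoin K {x, y}) E.toAffine.FunctionField

variable {E}

/-- The divisor `P + Pic⁰(E)[n]`: the points `T` with `T - P` killed by `n`, each with multiplicity
the inseparable degree of multiplication by `n`. -/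
def torsionDiv [DecidableEq K] [E.IsElliptic] (P : E.toAffine.Point) (n : ℕ) :
    E.toAffine.Point → ℤ :=
  fun T => if n • (T - P) = 0 then (mulInsepDegree E n : ℤ) else 0

variable (E)

/-- An elliptic curve over an algebraically closed field is supersingular if the characteristic is a
prime `p` and there is no nonzero `p`-torsion point. -/
def IsSupersingular [DecidableEq K] : Prop :=
  ∃ p : ℕ, p.Prime ∧ CharP K p ∧ ∀ T : E.toAffine.Point, p • T = 0 → T = 0

end Torsion

/-! ## Morphisms to projective space

`K` is an algebraically closed extension of the base field `k`, and the curve is defined over `k`. -/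

section Morphism

variable (k : Type*) {K : Type*} [Field k] [Field K] [Algebra k K] {E : WeierstrassCurve K} {l : ℕ}

/-- `f` is a morphism to `ℙ^l` defined over `k`: around every point it is given by forms of the same
degree over `k` that do not vanish simultaneously at that point. -/
def IsMorphism (f : E.toAffine.Point → Projectivization K (Fin (l + 1) → K)) : Prop :=
  ∀ Q : E.toAffine.Point, ∃ (n : ℕ) (A : Fin (l + 1) → MvPolynomial (Fin 3) k), (∀ j, (A j).IsHomogeneous n) ∧
    (fun j => (MvPolynomial.aeval (coords (E := E) Q) (A j) : K)) ≠ 0 ∧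
    ∀ T : E.toAffine.Point, ∀ hT : (fun j => (MvPolynomial.aeval (coords (E := E) T) (A j) : K)) ≠ 0,
      f T = Projectivization.mk K (fun j => MvPolynomial.aeval (coords (E := E) T) (A j)) hT

/-- The rational function `g` is defined over `k`. -/
def IsDefinedOver (g : E.toAffine.FunctionField) : Prop :=
  ∃ (n : ℕ) (A B : MvPolynomial (Fin 3) k), A.IsHomogeneous n ∧ B.IsHomogeneous n ∧
    dehom E (B.map (algebraMap k K)) ≠ 0 ∧
    g = dehom E (A.map (algebraMap k K)) / dehom E (B.map (algebraMap k K))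

/-- `f` is nondegenerate: its image is not contained in a hyperplane. -/
def IsNondegenerate (f : E.toAffine.Point → Projectivization K (Fin (l + 1) → K)) : Prop :=
  ∀ φ : Module.Dual K (Fin (l + 1) → K), φ ≠ 0 → ∃ Q, φ (f Q).rep ≠ 0

end Morphism

end MarkedGenusOne

end

/-! Translate `P` to the origin `O` and put `u = Q - P`, `n = a - c` (indices suppressed). Since `a
+ b = d - 1`, the divisor of a section is at least `nO - (n+1)u`, which has degree `-1`. The one
remaining zero is therefore forced to be the point `(n+1)u`, and the section is unique up to a
scalar. If its leading coefficient at `O` with respect to `x/y` is `1`, then its leading coefficient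
at `u` with respect to `x - x(u)` is `ψ₂(u)^(n+1) ψₙ(u)/ψₙ₊₁(u)`, where `ψₙ` are the division
polynomials. This is `hasSection`; it is proved by induction on `n`, multiplying by functions cut
out by chords and tangents. In the product over `i` the power of `ψ₂` does not depend on `j`,
because the sum of the `a_i^j` does not. So the homogeneous coordinates of `f_Q` are the products
over `i` of `ψₙ/ψₙ₊₁` at `Q - P` (`isSectionPoint_iff`). They are values of rational functions over
`k` (`coordFun`), and any such family extends to a morphism over `k` (`exists_isMorphism`).

For the divisor, `ψₙ` vanishes exactly at the nonzero `n`-torsion points (`wv_nat_eq_zero_iff`) and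
has no other pole than `O`. Because `x ∘ [n]` is invariant under translation by `n`-torsion, the
multiplicity is the same at all these zeros, and a degree count shows that it is `n²` divided by the
number of `n`-torsion points. As `[n]` has degree `n²` and separable degree the number of
`n`-torsion points, this is the inseparable degree (`mulInsepDegree_eq_torsionMult`). The extra
contributions at `P` cancel in a quotient of two coordinates, again because the sums of the `a_i^j`
agree.

For nondegeneracy, write the two numbers `a_i^j - c` as `p > 0` and `-q < 0`. At a point of exact
order `max (p + 1) (q - 1)` the `j`-th coordinate function has a pole, and the coordinate functions
with a smaller such maximum have none. Points of every exact order exist because the curve is not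
supersingular, and the maxima are distinct, so the functions are linearly independent
(`linearIndependent_coordFun`).

Two tools run through the proof. Identities between division polynomials are first proved at the
generic point, which has infinite order, and then specialised. Points over the function field reduce
at each point of the curve, which makes translations act on the function field compatibly with
values and orders. -/

set_option linter.unusedSectionVars false

noncomputable section

namespace MarkedGenusOne

/-! ## Division polynomials and multiplication by `n` -/

section Algebra

variable {F : Type*} [Field F] {W : WeierstrassCurve F}

/-- The `x`-coordinate of a point (`0` at infinity). -/
def xc : W.toAffine.Point → F
  | .zero => 0
  | .some x _ _ => x

/-- The `y`-coordinate of a point (`0` at infinity). -/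
def yc : W.toAffine.Point → F
  | .zero => 0
  | .some _ y _ => y

/-- The value of `2Y + a₁X + a₃` at a point. -/
def psi2 (P : W.toAffine.Point) : F := 2 * yc P + W.a₁ * xc P + W.a₃

@[simp] theorem xc_some {x y : F} (h : W.toAffine.Nonsingular x y) : xc (.some x y h) = x := rfl

@[simp] theorem yc_some {x y : F} (h : W.toAffine.Nonsingular x y) : yc (.some x y h) = y := rfl

theorem exists_some_of_ne_zero {P : W.toAffine.Point} (hP : P ≠ 0) :
    ∃ x y, ∃ h : W.toAffine.Nonsingular x y, P = .some x y h := by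
  rcases P with _ | ⟨x, y, h⟩
  · exact absurd rfl hP
  · exact ⟨x, y, h, rfl⟩

theorem equation_coords {P : W.toAffine.Point} (hP : P ≠ 0) :
    W.toAffine.Equation (xc P) (yc P) := by
  obtain ⟨x, y, h, rfl⟩ := exists_some_of_ne_zero hP
  exact h.1

theorem point_ext {P Q : W.toAffine.Point} (hP : P ≠ 0) (hQ : Q ≠ 0) (hx : xc P = xc Q)
    (hy : yc P = yc Q) : P = Q := by
  obtain ⟨x, y, h, rfl⟩ := exists_some_of_ne_zero hP
  obtain ⟨x', y', h', rfl⟩ := exists_some_of_ne_zero hQ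
  simp only [xc_some, yc_some] at hx hy
  subst hx hy
  rfl

@[simp] theorem xc_neg (P : W.toAffine.Point) : xc (-P) = xc P := by
  rcases P with _ | ⟨x, y, h⟩ <;> rfl

theorem yc_neg {P : W.toAffine.Point} (hP : P ≠ 0) :
    yc (-P) = -yc P - W.a₁ * xc P - W.a₃ := by
  obtain ⟨x, y, h, rfl⟩ := exists_some_of_ne_zero hP
  rfl

theorem equation_xy {P : W.toAffine.Point} (hP : P ≠ 0) :
    yc P ^ 2 + W.a₁ * xc P * yc P + W.a₃ * yc P
      = xc P ^ 3 + W.a₂ * xc P ^ 2 + W.a₄ * xc P + W.a₆ :=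
  (Affine.equation_iff ..).mp (equation_coords hP)

theorem psi2_sq {P : W.toAffine.Point} (hP : P ≠ 0) :
    psi2 P ^ 2 = 4 * xc P ^ 3 + W.b₂ * xc P ^ 2 + 2 * W.b₄ * xc P + W.b₆ := by
  have h := equation_xy hP
  simp only [psi2, b₂, b₄, b₆]
  linear_combination 4 * h

theorem xc_eq_iff {P Q : W.toAffine.Point} (hP : P ≠ 0) (hQ : Q ≠ 0) :
    xc P = xc Q ↔ P = Q ∨ P = -Q := by
  obtain ⟨x, y, h, rfl⟩ := exists_some_of_ne_zero hP
  obtain ⟨x', y', h', rfl⟩ := exists_some_of_ne_zero hQ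
  exact Affine.Point.X_eq_iff

/-- The symmetric biquadratic form relating the `x`-coordinates of `P + Q` and `P - Q`. -/
def kummer (W : WeierstrassCurve F) (a b c : F) : F :=
  a ^ 2 * b ^ 2 + b ^ 2 * c ^ 2 + a ^ 2 * c ^ 2 - 2 * a * b * c * (a + b + c) - W.b₂ * a * b * c
    - W.b₄ * (a * b + b * c + c * a) - W.b₆ * (a + b + c) - W.b₈

/-- The value of the division polynomial `ψₙ` at a point. -/
def wv (P : W.toAffine.Point) (n : ℤ) : F := (W.ψ n).evalEval (xc P) (yc P)

theorem wv_odd (P : W.toAffine.Point) (m : ℤ) :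
    wv P (2 * m + 1) = wv P (m + 2) * wv P m ^ 3 - wv P (m - 1) * wv P (m + 1) ^ 3 := by
  simp only [wv, ψ_odd, Polynomial.evalEval_sub, Polynomial.evalEval_mul, Polynomial.evalEval_pow]

@[simp] theorem wv_zero (P : W.toAffine.Point) : wv P 0 = 0 := by simp [wv]

@[simp] theorem wv_one (P : W.toAffine.Point) : wv P 1 = 1 := by simp [wv]

theorem evalEval_psi2 (P : W.toAffine.Point) : W.ψ₂.evalEval (xc P) (yc P) = psi2 P := by
  rw [ψ₂, Affine.evalEval_polynomialY, psi2]

@[simp] theorem wv_two (P : W.toAffine.Point) : wv P 2 = psi2 P := by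
  rw [wv, ψ_two, evalEval_psi2]

theorem wv_three (P : W.toAffine.Point) : wv P 3 = W.Ψ₃.eval (xc P) := by
  simp [wv, Polynomial.evalEval_C]

theorem wv_four (P : W.toAffine.Point) : wv P 4 = W.preΨ₄.eval (xc P) * psi2 P := by
  rw [wv, ψ_four, Polynomial.evalEval_mul, evalEval_psi2, Polynomial.evalEval_C]

@[simp] theorem wv_neg (P : W.toAffine.Point) (n : ℤ) : wv P (-n) = -wv P n := by
  simp [wv]

theorem wv_even (P : W.toAffine.Point) (m : ℤ) :
    wv P (2 * m) * psi2 P = wv P (m - 1) ^ 2 * wv P m * wv P (m + 2)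
      - wv P (m - 2) * wv P m * wv P (m + 1) ^ 2 := by
  rw [← evalEval_psi2]
  simp only [wv, ← Polynomial.evalEval_sub, ← Polynomial.evalEval_mul, ← Polynomial.evalEval_pow,
    ψ_even]

/-- Evaluation of regular functions at an affine point. -/
def evalAt {x y : F} (h : W.toAffine.Equation x y) : W.toAffine.CoordinateRing →+* F :=
  AdjoinRoot.lift (Polynomial.evalRingHom x) y
    (by rw [Affine.Equation, Polynomial.evalEval] at h; rw [Polynomial.eval₂_evalRingHom]; exact h)

theorem evalAt_mk {x y : F} (h : W.toAffine.Equation x y) (p : Polynomial F[X]) :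
    evalAt h (Affine.CoordinateRing.mk W.toAffine p) = p.evalEval x y := by
  rw [evalAt, Affine.CoordinateRing.mk]
  exact (AdjoinRoot.lift_mk _ _).trans (by rw [Polynomial.eval₂_evalRingHom])

/-- The two sides agree only modulo the equation of the curve, so the identity is evaluated through
the coordinate ring. -/
theorem wv_sq {P : W.toAffine.Point} (hP : P ≠ 0) (n : ℤ) :
    wv P n ^ 2 = (W.ΨSq n).eval (xc P) := by
  have h := congrArg (evalAt (equation_coords hP)) (Affine.CoordinateRing.mk_Ψ_sq W n)
  rw [← Affine.CoordinateRing.mk_ψ, map_pow, evalAt_mk, evalAt_mk, Polynomial.evalEval_C] at h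
  exact h

theorem phi_eval {P : W.toAffine.Point} (hP : P ≠ 0) (n : ℤ) :
    xc P * wv P n ^ 2 - wv P (n + 1) * wv P (n - 1) = (W.Φ n).eval (xc P) := by
  have h := congrArg (evalAt (equation_coords hP)) (Affine.CoordinateRing.mk_φ W n)
  rw [evalAt_mk, evalAt_mk, Polynomial.evalEval_C] at h
  rw [← h, WeierstrassCurve.φ]
  simp [wv, Polynomial.evalEval_C]

variable [DecidableEq F]

theorem two_nsmul_eq_zero_iff {P : W.toAffine.Point} (hP : P ≠ 0) :
    2 • P = 0 ↔ psi2 P = 0 := by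
  rw [two_nsmul, add_eq_zero_iff_eq_neg]
  have hn : -P ≠ 0 := neg_ne_zero.mpr hP
  constructor
  · intro h
    have := congrArg yc h
    rw [yc_neg hP] at this
    rw [psi2]; linear_combination this
  · intro h
    refine point_ext hP hn (xc_neg P).symm ?_
    rw [yc_neg hP]; rw [psi2] at h; linear_combination h

theorem slope_add {P Q : W.toAffine.Point} (hP : P ≠ 0) (hQ : Q ≠ 0) (h : xc P ≠ xc Q) :
    xc (P + Q) = ((yc P - yc Q) / (xc P - xc Q)) ^ 2 + W.a₁ * ((yc P - yc Q) / (xc P - xc Q))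
      - W.a₂ - xc P - xc Q := by
  obtain ⟨x, y, h1, rfl⟩ := exists_some_of_ne_zero hP
  obtain ⟨x', y', h2, rfl⟩ := exists_some_of_ne_zero hQ
  simp only [xc_some] at h
  rw [Affine.Point.add_of_X_ne h]
  simp only [xc_some, yc_some, Affine.slope_of_X_ne h, Affine.addX]

theorem slope_add_y {P Q : W.toAffine.Point} (hP : P ≠ 0) (hQ : Q ≠ 0) (h : xc P ≠ xc Q) :
    yc (P + Q) = -((yc P - yc Q) / (xc P - xc Q) * (xc (P + Q) - xc P) + yc P)
      - W.a₁ * xc (P + Q) - W.a₃ := by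
  obtain ⟨x, y, h1, rfl⟩ := exists_some_of_ne_zero hP
  obtain ⟨x', y', h2, rfl⟩ := exists_some_of_ne_zero hQ
  simp only [xc_some] at h
  rw [Affine.Point.add_of_X_ne h]
  simp only [xc_some, yc_some, Affine.slope_of_X_ne h, Affine.addY, Affine.negAddY, Affine.negY]

theorem add_ne_zero_of_xc_ne {P Q : W.toAffine.Point} (h : xc P ≠ xc Q) : P + Q ≠ 0 := by
  intro h0
  rw [add_eq_zero_iff_eq_neg] at h0
  exact h (by rw [h0, xc_neg])

theorem xc_add_sum {P Q : W.toAffine.Point} (hP : P ≠ 0) (hQ : Q ≠ 0) (h : xc P ≠ xc Q) :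
    (xc P - xc Q) ^ 2 * (xc (P + Q) + xc (P - Q)) =
      2 * xc P * xc Q * (xc P + xc Q) + W.b₂ * xc P * xc Q + W.b₄ * (xc P + xc Q) + W.b₆ := by
  have hd : xc P - xc Q ≠ 0 := sub_ne_zero.mpr h
  have h1 := equation_xy hP
  have h2 := equation_xy hQ
  rw [sub_eq_add_neg P Q, slope_add hP hQ h, slope_add hP (neg_ne_zero.mpr hQ) (by rwa [xc_neg]),
    xc_neg, yc_neg hQ]
  simp only [b₂, b₄, b₆]
  field_simp
  linear_combination 2 * h1 + 2 * h2

theorem xc_add_sub {P Q : W.toAffine.Point} (hP : P ≠ 0) (hQ : Q ≠ 0) (h : xc P ≠ xc Q) :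
    (xc P - xc Q) ^ 2 * (xc (P + Q) - xc (P - Q)) = - (psi2 P * psi2 Q) := by
  have hd : xc P - xc Q ≠ 0 := sub_ne_zero.mpr h
  rw [sub_eq_add_neg P Q, slope_add hP hQ h, slope_add hP (neg_ne_zero.mpr hQ) (by rwa [xc_neg]),
    xc_neg, yc_neg hQ]
  simp only [psi2]
  field_simp
  ring

theorem xc_add_mul {P Q : W.toAffine.Point} (hP : P ≠ 0) (hQ : Q ≠ 0) (h : xc P ≠ xc Q) :
    (xc P - xc Q) ^ 2 * (xc (P + Q) * xc (P - Q)) =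
      xc P ^ 2 * xc Q ^ 2 - W.b₄ * xc P * xc Q - W.b₆ * (xc P + xc Q) - W.b₈ := by
  have hd : xc P - xc Q ≠ 0 := sub_ne_zero.mpr h
  have h1 := equation_xy hP
  have h2 := equation_xy hQ
  rw [sub_eq_add_neg P Q, slope_add hP hQ h, slope_add hP (neg_ne_zero.mpr hQ) (by rwa [xc_neg]),
    xc_neg, yc_neg hQ]
  simp only [b₄, b₆, b₈]
  generalize xc P = x at *
  generalize xc Q = u at *
  generalize yc P = y at *
  generalize yc Q = v at *
  obtain ⟨a1, a2, a3, a4, a6⟩ := W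
  simp only at *
  -- Solving the equation at `P` for `a₆` and then the difference of the two equations for `a₄`
  -- leaves an identity of rational functions in independent variables.
  have h6 : a6 = y ^ 2 + a1 * x * y + a3 * y - x ^ 3 - a2 * x ^ 2 - a4 * x := by
    linear_combination -h1
  subst h6
  have h4 : a4 = (v ^ 2 + a1 * u * v + a3 * v - u ^ 3 - a2 * u ^ 2
      - (y ^ 2 + a1 * x * y + a3 * y - x ^ 3 - a2 * x ^ 2)) / (u - x) := by
    rw [eq_div_iff (by intro hh; apply hd; linear_combination -hh)]
    linear_combination -h2
  have hd' : u - x ≠ 0 := by intro hh; apply hd; linear_combination -hh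
  subst h4
  field_simp
  ring

/-- As a quadratic in `b` the form has the roots `x(P + Q)` and `x(P - Q)`, whose sum and product
are known. The form is symmetric in all three arguments, so two such factorisations can be compared;
the recursions below rest on this. -/
theorem kummer_add {P Q : W.toAffine.Point} (hP : P ≠ 0) (hQ : Q ≠ 0) (h : xc P ≠ xc Q) (b : F) :
    (xc P - xc Q) ^ 2 * ((b - xc (P + Q)) * (b - xc (P - Q))) = kummer W (xc P) (xc Q) b := by
  have h1 := xc_add_sum hP hQ h
  have h2 := xc_add_mul hP hQ h
  rw [kummer]
  linear_combination -b * h1 + h2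

theorem double_xy {P : W.toAffine.Point} (hP : P ≠ 0) (h : psi2 P ≠ 0) :
    xc (2 • P) = ((3 * xc P ^ 2 + 2 * W.a₂ * xc P + W.a₄ - W.a₁ * yc P) / psi2 P) ^ 2
      + W.a₁ * ((3 * xc P ^ 2 + 2 * W.a₂ * xc P + W.a₄ - W.a₁ * yc P) / psi2 P)
      - W.a₂ - xc P - xc P ∧
    yc (2 • P) = -((3 * xc P ^ 2 + 2 * W.a₂ * xc P + W.a₄ - W.a₁ * yc P) / psi2 P
      * (xc (2 • P) - xc P) + yc P) - W.a₁ * xc (2 • P) - W.a₃ := by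
  obtain ⟨x, y, h1, rfl⟩ := exists_some_of_ne_zero hP
  have hy : y ≠ W.toAffine.negY x y := by
    intro hy
    apply h
    simp only [psi2, xc_some, yc_some]
    simp only [Affine.negY] at hy
    linear_combination hy
  have e : y - W.toAffine.negY x y = 2 * y + W.a₁ * x + W.a₃ := by simp only [Affine.negY]; ring
  rw [two_nsmul, Affine.Point.add_self_of_Y_ne hy]
  simp only [xc_some, yc_some, Affine.slope_of_Y_ne rfl hy, Affine.addX, Affine.addY,
    Affine.negAddY, psi2, e]
  simp only [Affine.negY]
  simp

/-- The tangent case: when the first two arguments coincide the form becomes linear in the third,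
and its root is `x(2P)`. -/
theorem kummer_double {P : W.toAffine.Point} (hP : P ≠ 0) (h : psi2 P ≠ 0) (c : F) :
    psi2 P ^ 2 * (xc (2 • P) - c) = kummer W (xc P) (xc P) c := by
  have hs := psi2_sq hP
  have h1 := equation_xy hP
  have key : psi2 P ^ 2 * xc (2 • P) =
      (3 * xc P ^ 2 + 2 * W.a₂ * xc P + W.a₄ - W.a₁ * yc P) ^ 2
      + W.a₁ * (3 * xc P ^ 2 + 2 * W.a₂ * xc P + W.a₄ - W.a₁ * yc P) * psi2 P
      + (- W.a₂ - 2 * xc P) * psi2 P ^ 2 := by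
    rw [(double_xy hP h).1]
    field_simp
    ring
  rw [mul_sub, key, hs, kummer]
  simp only [psi2, b₂, b₄, b₆, b₈]
  linear_combination (- W.a₁ ^ 2) * h1 

theorem psi2_double {P : W.toAffine.Point} (hP : P ≠ 0) (h : psi2 P ≠ 0) :
    psi2 (2 • P) * psi2 P ^ 3 = W.preΨ₄.eval (xc P) := by
  have h1 := equation_xy hP
  have hx : psi2 P ^ 2 * xc (2 • P) = xc P ^ 4 - W.b₄ * xc P ^ 2 - 2 * W.b₆ * xc P - W.b₈ := by
    have := kummer_double hP h 0
    rw [kummer] at this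
    linear_combination this
  have hy := (double_xy hP h).2
  have hy' : psi2 P * psi2 (2 • P) = -(2 * (3 * xc P ^ 2 + 2 * W.a₂ * xc P + W.a₄ - W.a₁ * yc P)
      * (xc (2 • P) - xc P) + (2 * yc P + W.a₁ * xc (2 • P) + W.a₃) * psi2 P) := by
    rw [show psi2 (2 • P) = 2 * yc (2 • P) + W.a₁ * xc (2 • P) + W.a₃ from rfl, hy]
    field_simp
    ring
  have : psi2 (2 • P) * psi2 P ^ 3 = -(2 * (3 * xc P ^ 2 + 2 * W.a₂ * xc P + W.a₄ - W.a₁ * yc P)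
      * (psi2 P ^ 2 * xc (2 • P) - psi2 P ^ 2 * xc P)
      + (2 * yc P * psi2 P ^ 2 + W.a₁ * (psi2 P ^ 2 * xc (2 • P)) + W.a₃ * psi2 P ^ 2) * psi2 P) := by
    linear_combination psi2 P ^ 2 * hy'
  rw [this, hx, psi2_sq hP]
  have h6 : W.a₆ = yc P ^ 2 + W.a₁ * xc P * yc P + W.a₃ * yc P - xc P ^ 3 - W.a₂ * xc P ^ 2
      - W.a₄ * xc P := by linear_combination -h1
  simp only [preΨ₄, psi2, b₂, b₄, b₆, b₈, h6, Polynomial.eval_add, Polynomial.eval_mul,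
    Polynomial.eval_pow, Polynomial.eval_X, Polynomial.eval_C,
    Polynomial.eval_ofNat]
  ring

end Algebra

/-! ### The abscissa of a multiple of a point in terms of division polynomials -/

section Algebra

variable {F : Type*} [Field F] {W : WeierstrassCurve F} [DecidableEq F]

theorem xc_nsmul_ne {P : W.toAffine.Point} {n m : ℕ} (hn : (n + m) • P ≠ 0) (hm : m • P ≠ 0)
    (hs : n • P ≠ 0) (hd : (n + m + m) • P ≠ 0) : xc ((n + m) • P) ≠ xc (m • P) := by
  rw [Ne, xc_eq_iff hn hm, not_or]
  constructor
  · intro h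
    apply hs
    rw [add_nsmul] at h
    simpa using h
  · intro h
    apply hd
    rw [add_nsmul, h]
    simp

/-- For `n ≥ 3`, `xc_add_sub` for `nP` and `P` expresses `psi2 (nP)` through the abscissae of `(n ±
1)P`, and `H` turns these into division polynomials. The guard `3 ≤ n` is needed because
`nsmul_formula` at index `3` uses the case `n = 2`, when `H` at index `3` is not yet available. -/
theorem psi2_nsmul_aux {P : W.toAffine.Point} {n : ℕ} (hn : 1 ≤ n)
    (h0 : ∀ j, 1 ≤ j → j ≤ n → j • P ≠ 0)
    (H : 3 ≤ n → ∀ j : ℕ, 1 ≤ j → j ≤ n + 1 → j • P ≠ 0 ∧ wv P j ≠ 0 ∧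
      (xc P - xc (j • P)) * wv P j ^ 2 = wv P (j + 1) * wv P (j - 1)) :
    psi2 (n • P) * wv P n ^ 4 = wv P (2 * n) := by
  have hP : P ≠ 0 := by simpa using h0 1 le_rfl hn
  obtain rfl | rfl | h3 : n = 1 ∨ n = 2 ∨ 3 ≤ n := by omega
  · simp
  · have h2 : psi2 P ≠ 0 := fun h => h0 2 (by omega) le_rfl ((two_nsmul_eq_zero_iff hP).mpr h)
    have := psi2_double hP h2
    norm_num
    rw [wv_four, ← this]
    ring
  · have h2 : psi2 P ≠ 0 := fun h => h0 2 (by omega) (by omega) ((two_nsmul_eq_zero_iff hP).mpr h)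
    specialize H h3
    obtain ⟨m, rfl⟩ : ∃ m, n = m + 1 := ⟨n - 1, by omega⟩
    obtain ⟨hm0, hm1, hm2⟩ := H m (by omega) (by omega)
    obtain ⟨hn0, hn1, hn2⟩ := H (m + 1) (by omega) (by omega)
    obtain ⟨hk0, hk1, hk2⟩ := H (m + 1 + 1) (by omega) (by omega)
    have hx : xc ((m + 1) • P) ≠ xc P := by
      simpa using xc_nsmul_ne hn0 (by simpa using hP) hm0 hk0
    have hd := xc_add_sub hn0 hP hx
    rw [← succ_nsmul, show (m + 1) • P - P = m • P by rw [succ_nsmul]; simp] at hd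
    have he := wv_even P (m + 1)
    push_cast at *
    rw [show (m : ℤ) + 1 - 1 = m by ring, show (m : ℤ) + 1 + 2 = m + 3 by ring,
      show (m : ℤ) + 1 - 2 = m - 1 by ring, show (m : ℤ) + 1 + 1 = m + 2 by ring] at he
    rw [show (m : ℤ) + 1 - 1 = m by ring, show (m : ℤ) + 1 + 1 = m + 2 by ring] at hn2
    rw [show (m : ℤ) + 1 + 1 = m + 2 by ring] at hk1
    rw [show (m : ℤ) + 1 + 1 = m + 2 by ring, show (m : ℤ) + 2 + 1 = m + 3 by ring,
      show (m : ℤ) + 2 - 1 = m + 1 by ring] at hk2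
    apply mul_right_cancel₀ h2
    rw [he]
    apply mul_right_cancel₀ (pow_ne_zero 2 hm1)
    apply mul_right_cancel₀ (pow_ne_zero 2 hk1)
    generalize xc P = x at *
    generalize xc (m • P) = x1 at *
    generalize xc ((m + 1) • P) = x2 at *
    generalize xc ((m + 1 + 1) • P) = x3 at *
    generalize wv P m = w1 at *
    generalize wv P ((m : ℤ) + 1) = w2 at *
    generalize wv P ((m : ℤ) + 2) = w3 at *
    generalize wv P ((m : ℤ) + 3) = w4 at *
    generalize wv P ((m : ℤ) - 1) = w0 at *
    have hd' : psi2 ((m + 1) • P) * psi2 P * w2 ^ 4 =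
        ((x - x2) * w2 ^ 2) ^ 2 * ((x - x3) - (x - x1)) := by
      linear_combination w2 ^ 4 * hd
    rw [hn2] at hd'
    linear_combination w1 ^ 2 * w3 ^ 2 * hd' + w3 ^ 2 * w1 ^ 4 * hk2 - w1 ^ 2 * w3 ^ 4 * hm2

/-- The difference of the formulas at `n` and `n + 1` has on its right the recursion for `ψ` at `2n
+ 1`. -/
theorem xc_nsmul_sub_succ {P : W.toAffine.Point} {n : ℕ}
    (h : (xc P - xc (n • P)) * wv P n ^ 2 = wv P (n + 1) * wv P (n - 1))
    (h' : (xc P - xc ((n + 1) • P)) * wv P ((n : ℤ) + 1) ^ 2 = wv P (n + 2) * wv P n) :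
    (xc (n • P) - xc ((n + 1) • P)) * (wv P n ^ 2 * wv P (n + 1) ^ 2) = wv P (2 * n + 1) := by
  rw [wv_odd]
  linear_combination wv P n ^ 2 * h' - wv P (n + 1) ^ 2 * h

/-- Strong induction: `kP` is the double of `(k/2)P` or the sum of two consecutive multiples. As no
smaller multiple vanishes, the chords that occur join points with distinct abscissae. -/
theorem nsmul_formula (P : W.toAffine.Point) : ∀ k : ℕ, 1 ≤ k → (∀ j, 1 ≤ j → j ≤ k → j • P ≠ 0) →
    wv P k ≠ 0 ∧ (xc P - xc (k • P)) * wv P k ^ 2 = wv P (k + 1) * wv P (k - 1) := by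
  intro k
  induction k using Nat.strong_induction_on with
  | _ k IH =>
  intro hk h0
  have hP : P ≠ 0 := by simpa using h0 1 le_rfl hk
  have IH' : ∀ j : ℕ, 1 ≤ j → j < k → wv P j ≠ 0 ∧
      (xc P - xc (j • P)) * wv P j ^ 2 = wv P (j + 1) * wv P (j - 1) :=
    fun j h1 h2 => IH j h2 h1 fun i hi hij => h0 i hi (by omega)
  have hsub : ∀ n : ℕ, 1 ≤ n → n + 1 < k →
      (xc (n • P) - xc ((n + 1) • P)) * (wv P n ^ 2 * wv P (n + 1) ^ 2) = wv P (2 * n + 1) := by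
    intro n h1 h2
    refine xc_nsmul_sub_succ (IH' n h1 (by omega)).2 ?_
    have := (IH' (n + 1) (by omega) h2).2
    push_cast at this
    rwa [show (n : ℤ) + 1 + 1 = n + 2 by ring, add_sub_cancel_right] at this
  have hps : ∀ n : ℕ, 1 ≤ n → n < k → (3 ≤ n → n + 1 < k) →
      psi2 (n • P) * wv P n ^ 4 = wv P (2 * n) := by
    intro n h1 h2 h3
    refine psi2_nsmul_aux h1 (fun j hj hj' => h0 j hj (by omega)) fun hn j hj hj' => ?_
    have := h3 hn
    exact ⟨h0 j hj (by omega), IH' j hj (by omega)⟩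
  obtain rfl | rfl | ⟨n, hn, rfl⟩ | ⟨n, hn, rfl⟩ :
      k = 1 ∨ k = 2 ∨ (∃ n, 1 ≤ n ∧ k = 2 * (n + 1)) ∨ (∃ n, 1 ≤ n ∧ k = 2 * n + 1) := by
    rcases Nat.even_or_odd' k with ⟨m, rfl | rfl⟩
    · by_cases h : m = 1
      · subst h; simp
      · right; right; left
        exact ⟨m - 1, by omega, by omega⟩
    · by_cases h : m = 0
      · subst h; simp
      · right; right; right
        exact ⟨m, by omega, rfl⟩
  · simp
  · have h2 : psi2 P ≠ 0 := fun h => h0 2 (by omega) le_rfl ((two_nsmul_eq_zero_iff hP).mpr h)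
    refine ⟨by simpa using h2, ?_⟩
    have := kummer_double hP h2 (xc P)
    norm_num
    rw [wv_three]
    simp only [kummer] at this
    simp only [Ψ₃, Polynomial.eval_add, Polynomial.eval_mul, Polynomial.eval_pow,
      Polynomial.eval_X, Polynomial.eval_C, Polynomial.eval_ofNat]
    linear_combination -this
  · have e1 := hsub n hn (by omega)
    have e2 := hsub (n + 1) (by omega) (by omega)
    have e3 := hps (n + 1) (by omega) (by omega) (by omega)
    have e4 := IH' (n + 1) (by omega) (by omega)
    have hn0 := h0 n hn (by omega)
    have hn1 := h0 (n + 1) (by omega) (by omega)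
    have hn2 := h0 (n + 1 + 1) (by omega) (by omega)
    have hps0 : psi2 ((n + 1) • P) ≠ 0 := by
      intro h
      rw [← two_nsmul_eq_zero_iff hn1, ← mul_nsmul'] at h
      exact h0 _ (by omega) le_rfl h
    push_cast at *
    constructor
    · rw [← e3]
      exact mul_ne_zero hps0 (pow_ne_zero 4 e4.1)
    · have hx : xc ((n + 1) • P) ≠ xc P := by
        simpa using xc_nsmul_ne hn1 (by simpa using hP) hn0 hn2
      have ek := kummer_add hn1 hP hx (xc ((n + 1) • P))
      rw [← succ_nsmul, show (n + 1) • P - P = n • P by rw [succ_nsmul]; simp] at ek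
      -- By symmetry the doubling of `(n+1)P`, compared with `x(P)`, is the form of the chord
      -- through `(n+1)P` and `P`, whose roots are the abscissae of `(n+2)P` and `nP`.
      have ed := kummer_double hn1 hps0 (xc P)
      rw [← mul_nsmul', show kummer W (xc ((n + 1) • P)) (xc ((n + 1) • P)) (xc P) =
        kummer W (xc ((n + 1) • P)) (xc P) (xc ((n + 1) • P)) by simp only [kummer]; ring,
        ← ek] at ed
      rw [show 2 * ((n : ℤ) + 1) + 1 = 2 * (n + 1) + 1 by ring,
        show 2 * ((n : ℤ) + 1) - 1 = 2 * n + 1 by ring, ← e1, ← e2, ← e3]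
      obtain ⟨e4, e5⟩ := e4
      rw [add_sub_cancel_right] at e5
      generalize wv P ((n : ℤ) + 1 + 1) = w2 at *
      generalize wv P ((n : ℤ) + 1) = w1 at *
      generalize wv P (n : ℤ) = w0 at *
      have e6 : (xc P - xc ((n + 1) • P)) ^ 2 * w1 ^ 4 = w2 ^ 2 * w0 ^ 2 := by
        linear_combination ((xc P - xc ((n + 1) • P)) * w1 ^ 2 + w2 * w0) * e5
      linear_combination -w1 ^ 8 * ed - w1 ^ 4 * (xc ((n + 1) • P) - xc ((n + 1 + 1) • P)) *
        (xc ((n + 1) • P) - xc (n • P)) * e6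
  · have e1 : (xc (n • P) - xc ((n + 1) • P)) * (wv P n ^ 2 * wv P (n + 1) ^ 2)
        = wv P (2 * n + 1) := hsub n hn (by omega)
    have e2 := hps n (by omega) (by omega) (by omega)
    have e3 := hps (n + 1) (by omega) (by omega) (by omega)
    have hn0 := h0 n hn (by omega)
    have hn1 := h0 (n + 1) (by omega) (by omega)
    have hw0 := (IH' n (by omega) (by omega)).1
    have hw1 := (IH' (n + 1) (by omega) (by omega)).1
    push_cast at *
    have hx : xc ((n + 1) • P) ≠ xc (n • P) := by
      have := h0 (2 * n + 1) (by omega) le_rfl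
      have := xc_nsmul_ne (P := P) (n := 1) (m := n) (by rwa [add_comm]) hn0 (by simpa using hP)
        (by rwa [show 1 + n + n = 2 * n + 1 by ring])
      rwa [add_comm 1 n] at this
    constructor
    · rw [← e1]
      exact mul_ne_zero (sub_ne_zero.mpr hx.symm)
        (mul_ne_zero (pow_ne_zero 2 hw0) (pow_ne_zero 2 hw1))
    -- The sum of the two multiples is `(2n+1)P` and their difference is `P`, so this is the wanted
    -- difference of abscissae.
    · have ed := xc_add_sub hn1 hn0 hx
      rw [show (n + 1) • P + n • P = (2 * n + 1) • P by rw [← add_nsmul]; congr 1; ring,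
        show (n + 1) • P - n • P = P by rw [succ_nsmul]; simp] at ed
      rw [show 2 * (n : ℤ) + 1 + 1 = 2 * (n + 1) by ring, add_sub_cancel_right, ← e1, ← e2, ← e3]
      linear_combination -wv P n ^ 4 * wv P (n + 1) ^ 4 * ed

theorem psi2_nsmul {P : W.toAffine.Point} {n : ℕ} (hn : 1 ≤ n)
    (h0 : ∀ j, 1 ≤ j → j ≤ n + 1 → j • P ≠ 0) :
    psi2 (n • P) * wv P n ^ 4 = wv P (2 * n) :=
  psi2_nsmul_aux hn (fun j h1 h2 => h0 j h1 (by omega)) fun _ j h1 h2 =>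
    ⟨h0 j h1 h2, nsmul_formula P j h1 fun i hi hij => h0 i hi (by omega)⟩

/-- If `N = 2n`, then `nP` has order two and `ψ` at `2n` contains the factor `psi2 (nP) = 0` (for `n
= 1` it is `psi2 P` itself). If `N = 2n + 1`, then `(n+1)P = -nP` and the difference of abscissae in
`xc_nsmul_sub_succ` is zero. -/
theorem wv_eq_zero_of_order {P : W.toAffine.Point} {N : ℕ} (hN : 2 ≤ N)
    (h0 : ∀ j, 1 ≤ j → j < N → j • P ≠ 0) (hNP : N • P = 0) : wv P N = 0 := by
  have hP : P ≠ 0 := by simpa using h0 1 le_rfl (by omega)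
  rcases Nat.even_or_odd' N with ⟨n, rfl | rfl⟩
  · by_cases hn : n = 1
    · subst hn
      rw [Nat.mul_one] at hNP
      simpa using (two_nsmul_eq_zero_iff hP).mp hNP
    · have hn0 := h0 n (by omega) (by omega)
      have := psi2_nsmul (P := P) (n := n) (by omega) (fun j h1 h2 => h0 j h1 (by omega))
      rw [(two_nsmul_eq_zero_iff hn0).mp (by rwa [← mul_nsmul'])] at this
      push_cast
      rw [← this, zero_mul]
  · have e : ∀ m : ℕ, 1 ≤ m → m < 2 * n + 1 →
        (xc P - xc (m • P)) * wv P m ^ 2 = wv P (m + 1) * wv P (m - 1) :=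
      fun m h1 h2 => (nsmul_formula P m h1 fun j hj hj' => h0 j hj (by omega)).2
    have e2 := e (n + 1) (by omega) (by omega)
    push_cast at e2 ⊢
    rw [show (n : ℤ) + 1 + 1 = n + 2 by ring, add_sub_cancel_right] at e2
    have := xc_nsmul_sub_succ (e n (by omega) (by omega)) e2
    rw [← this, show (n + 1) • P = -(n • P) by
      rw [eq_neg_iff_add_eq_zero, ← add_nsmul, ← hNP]; congr 1; ring, xc_neg, sub_self, zero_mul]

end Algebra

/-! ### The generic point and its infinite order -/

section Generic

open scoped Classical

variable {K : Type*} [Field K] (E : WeierstrassCurve K)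

/-- The function field of an elliptic curve. -/
abbrev FF := E.toAffine.FunctionField

theorem evalEval_generic (p : Polynomial K[X]) :
    (p.map (Polynomial.mapRingHom (algebraMap K (FF E)))).evalEval (xFun E) (yFun E) =
      algebraMap E.toAffine.CoordinateRing (FF E) (Affine.CoordinateRing.mk E.toAffine p) := by
  have : (Polynomial.evalEvalRingHom (xFun E) (yFun E)).comp
      (Polynomial.mapRingHom (Polynomial.mapRingHom (algebraMap K (FF E)))) =
      (algebraMap E.toAffine.CoordinateRing (FF E)).comp
        (Affine.CoordinateRing.mk E.toAffine : Polynomial K[X] →+* _) := by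
    refine Polynomial.ringHom_ext' (Polynomial.ringHom_ext' ?_ ?_) ?_
    · ext c
      simp
      rfl
    · simp
      rfl
    · simp
      rfl
  exact congrArg (fun f : Polynomial K[X] →+* FF E => f p) this

theorem algebraMap_FF_injective :
    Function.Injective (algebraMap E.toAffine.CoordinateRing (FF E)) :=
  IsFractionRing.injective _ _

theorem aeval_xFun (p : K[X]) : Polynomial.aeval (xFun E) p =
    algebraMap E.toAffine.CoordinateRing (FF E)
      (Affine.CoordinateRing.mk E.toAffine (Polynomial.C p)) := by
  rw [← evalEval_generic, Polynomial.map_C, Polynomial.evalEval_C, Polynomial.coe_mapRingHom,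
    Polynomial.eval_map_algebraMap]

theorem aeval_xFun_eq_zero {p : K[X]} (h : Polynomial.aeval (xFun E) p = 0) : p = 0 := by
  rw [aeval_xFun, map_eq_zero_iff _ (algebraMap_FF_injective E)] at h
  have : p • (1 : E.toAffine.CoordinateRing) + (0 : K[X]) • Affine.CoordinateRing.mk _ Polynomial.X
      = 0 := by
    rw [zero_smul, add_zero, Affine.CoordinateRing.smul, mul_one]; exact h
  exact (Affine.CoordinateRing.smul_basis_eq_zero this).1

theorem xFun_ne_algebraMap (c : K) : xFun E ≠ algebraMap K (FF E) c := by
  intro h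
  have := aeval_xFun_eq_zero E (p := Polynomial.X - Polynomial.C c) (by simp [h])
  exact Polynomial.X_sub_C_ne_zero c this

theorem mem_range_of_isAlgebraic {K L : Type*} [Field K] [Field L] [Algebra K L] [IsAlgClosed K]
    {x : L} (hx : IsAlgebraic K x) : ∃ c, algebraMap K L c = x :=
  minpoly.mem_range_of_degree_eq_one K x
    (IsAlgClosed.degree_eq_one_of_irreducible K (minpoly.irreducible hx.isIntegral))

theorem evalAt_psi {E : WeierstrassCurve K} {T : E.toAffine.Point} (hT : T ≠ 0) (n : ℤ) :
    evalAt (equation_coords hT) (Affine.CoordinateRing.mk E.toAffine (E.ψ n)) = wv T n :=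
  evalAt_mk _ _

variable [E.IsElliptic]

theorem genericPoint_eq : genericPoint E = .some (xFun E) (yFun E)
    ((Affine.equation_iff_nonsingular).mp (equation_generic E)) := rfl

@[simp] theorem xc_genericPoint : xc (genericPoint E) = xFun E := rfl

@[simp] theorem yc_genericPoint : yc (genericPoint E) = yFun E := rfl

theorem genericPoint_ne_zero : genericPoint E ≠ 0 := by
  rw [genericPoint_eq]; exact Affine.Point.some_ne_zero _

theorem wv_genericPoint (n : ℤ) : wv (genericPoint E) n =
    algebraMap E.toAffine.CoordinateRing (FF E) (Affine.CoordinateRing.mk E.toAffine (E.ψ n)) := by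
  rw [wv, xc_genericPoint, yc_genericPoint, ← evalEval_generic]
  congr 1
  exact map_ψ ..

theorem wv_sq_generic (n : ℤ) :
    wv (genericPoint E) n ^ 2 = Polynomial.aeval (xFun E) (E.ΨSq n) := by
  rw [wv_sq (genericPoint_ne_zero E), xc_genericPoint, ← Polynomial.eval_map_algebraMap]
  congr 1
  exact map_ΨSq ..

theorem phi_generic (n : ℤ) : xFun E * wv (genericPoint E) n ^ 2
    - wv (genericPoint E) (n + 1) * wv (genericPoint E) (n - 1)
    = Polynomial.aeval (xFun E) (E.Φ n) := by
  have := phi_eval (genericPoint_ne_zero E) n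
  rw [xc_genericPoint] at this
  rw [this, ← Polynomial.eval_map_algebraMap]
  congr 1
  exact map_Φ ..

/-- A constant abscissa `c` would give `Φₙ = c ΨSqₙ` as polynomials, but `Φₙ` has degree `n²` and
`ΨSqₙ` has smaller degree. -/
theorem xc_nsmul_generic_ne {n : ℕ} (hn : 1 ≤ n)
    (h0 : ∀ j, 1 ≤ j → j ≤ n → j • genericPoint E ≠ 0) (c : K) :
    xc (n • genericPoint E) ≠ algebraMap K (FF E) c := by
  intro h
  have h1 := (nsmul_formula (genericPoint E) n hn h0).2
  have h2 := phi_generic E n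
  rw [h, xc_genericPoint] at h1
  have h3 : Polynomial.aeval (xFun E) (E.Φ n) = algebraMap K (FF E) c *
      Polynomial.aeval (xFun E) (E.ΨSq n) := by
    rw [← wv_sq_generic]; linear_combination h1 - h2
  have h4 := aeval_xFun_eq_zero E (p := E.Φ n - Polynomial.C c * E.ΨSq n)
    (by rw [map_sub, map_mul, Polynomial.aeval_C, h3, sub_self])
  have h5 := E.natDegree_Φ n
  rw [sub_eq_zero.mp h4] at h5
  have h6 := (Polynomial.natDegree_C_mul_le c (E.ΨSq n)).trans (E.natDegree_ΨSq_le n)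
  rw [h5] at h6
  simp at h6
  have : 0 < n ^ 2 := by positivity
  omega

theorem Psi2Sq_ne_zero : E.Ψ₂Sq ≠ 0 := by
  intro h
  have h3 : E.Ψ₂Sq.coeff 3 = 0 := by rw [h]; simp
  have h2 : E.Ψ₂Sq.coeff 2 = 0 := by rw [h]; simp
  have h1 : E.Ψ₂Sq.coeff 1 = 0 := by rw [h]; simp
  have h0 : E.Ψ₂Sq.coeff 0 = 0 := by rw [h]; simp
  rw [Ψ₂Sq] at h3 h2 h1 h0
  simp [Polynomial.coeff_X, Polynomial.coeff_C] at h3 h2 h1 h0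
  -- The discriminant lies in the ideal generated by `b₂`, `2b₄` and `b₆`, so characteristic two
  -- needs no separate treatment.
  have hΔ : E.Δ = 0 := by
    rw [Δ]
    rcases h1 with h1 | h1
    · linear_combination (-E.b₂ * E.b₈ + 9 * E.b₄ * E.b₆) * h2 - 4 * E.b₄ ^ 3 * h1 - 27 * E.b₆ * h0
    · linear_combination (-E.b₂ * E.b₈ + 9 * E.b₄ * E.b₆) * h2 - 8 * E.b₄ ^ 2 * h1 - 27 * E.b₆ * h0
  exact E.isUnit_Δ.ne_zero hΔ

/-- At a point of order two, `ψ₃` is minus the square of a partial derivative of the equation. The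
other partial derivative is zero there, so this one is not. -/
theorem wv_three_ne_zero {F : Type*} [Field F] {W : WeierstrassCurve F} {T : W.toAffine.Point}
    (hT : T ≠ 0) (h : psi2 T = 0) : wv T 3 ≠ 0 := by
  obtain ⟨x, y, hn, rfl⟩ := exists_some_of_ne_zero hT
  have hxy := equation_xy hT
  simp only [psi2, xc_some, yc_some] at h hxy
  have hA : 3 * x ^ 2 + 2 * W.a₂ * x + W.a₄ - W.a₁ * y ≠ 0 := by
    intro hA
    rcases ((Affine.nonsingular_iff' ..).mp hn).2 with h' | h'
    · apply h'; linear_combination -hA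
    · apply h'; linear_combination h
  have key : wv (.some x y hn) 3 = -(3 * x ^ 2 + 2 * W.a₂ * x + W.a₄ - W.a₁ * y) ^ 2 := by
    rw [wv_three]
    simp only [Ψ₃, xc_some, Polynomial.eval_add, Polynomial.eval_mul, Polynomial.eval_pow,
      Polynomial.eval_X, Polynomial.eval_C, Polynomial.eval_ofNat, b₂, b₄, b₆, b₈]
    linear_combination (-W.a₁ ^ 2 - 4 * W.a₂ - 12 * x) * hxy + ((2 * y + W.a₁ * x + W.a₃) *
      (3 * x + W.a₂) - W.a₁ * (3 * x ^ 2 + 2 * W.a₂ * x + W.a₄ - W.a₁ * y)) * h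
  rw [key]
  exact neg_ne_zero.mpr (pow_ne_zero 2 hA)

theorem wv_even_eq_zero {F : Type*} [Field F] {W : WeierstrassCurve F} {T : W.toAffine.Point}
    (hT : T ≠ 0) (h : psi2 T = 0) {n : ℤ} (hn : Even n) : wv T n = 0 := by
  have := congrArg (evalAt (equation_coords hT)) (Affine.CoordinateRing.mk_ψ W n)
  rw [evalAt_mk, evalAt_mk] at this
  rw [wv, this, WeierstrassCurve.Ψ, if_pos hn, Polynomial.evalEval_mul, evalEval_psi2, h, mul_zero]

/-- At a point of order two the even-indexed values vanish, so only one of the two terms of the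
recursion survives, and it is a product of earlier odd-indexed values. -/
theorem wv_odd_ne_zero {F : Type*} [Field F] {W : WeierstrassCurve F} {T : W.toAffine.Point}
    (hT : T ≠ 0) (h : psi2 T = 0) (m : ℕ) : wv T (2 * m + 1) ≠ 0 := by
  induction m using Nat.strong_induction_on with
  | _ m IH =>
    obtain rfl | rfl | h2 : m = 0 ∨ m = 1 ∨ 2 ≤ m := by omega
    · simp
    · exact wv_three_ne_zero hT h
    · rw [wv_odd]
      rcases Nat.even_or_odd' m with ⟨k, rfl | rfl⟩
      · obtain ⟨j, rfl⟩ : ∃ j, k = j + 1 := ⟨k - 1, by omega⟩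
        rw [wv_even_eq_zero hT h (n := ((2 * (j + 1) : ℕ) : ℤ)) (by simp)]
        have e1 := IH j (by omega)
        have e2 := IH (j + 1) (by omega)
        push_cast at *
        rw [show 2 * ((j : ℤ) + 1) - 1 = 2 * j + 1 by ring]
        simpa using ⟨e1, e2⟩
      · have e1 := IH k (by omega)
        have e2 := IH (k + 1) (by omega)
        rw [wv_even_eq_zero hT h (n := ((2 * k + 1 : ℕ) : ℤ) + 1) (by simp)]
        push_cast at *
        rw [show 2 * (k : ℤ) + 1 + 2 = 2 * (k + 1) + 1 by ring]
        simpa using ⟨e2, e1⟩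

theorem exists_psi2_eq_zero [IsAlgClosed K] (h2 : (2 : K) ≠ 0) :
    ∃ T : E.toAffine.Point, T ≠ 0 ∧ psi2 T = 0 := by
  have h4 : (4 : K) ≠ 0 := by
    rw [show (4 : K) = 2 * 2 by norm_num]; exact mul_ne_zero h2 h2
  obtain ⟨x, hx⟩ := IsAlgClosed.exists_root E.Ψ₂Sq (by
    rw [Polynomial.degree_eq_natDegree (Psi2Sq_ne_zero E), E.natDegree_Ψ₂Sq h4]; norm_num)
  have he : E.toAffine.Equation x (-(E.a₁ * x + E.a₃) / 2) := by
    rw [Affine.equation_iff']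
    rw [Polynomial.IsRoot.def, Ψ₂Sq] at hx
    simp [b₂, b₄, b₆] at hx
    field_simp
    linear_combination -hx
  refine ⟨.some _ _ (Affine.equation_iff_nonsingular.mp he), Affine.Point.some_ne_zero _, ?_⟩
  simp only [psi2, xc_some, yc_some]
  field_simp
  ring

/-- Take the least bad `N`. If `N = 2n`, the abscissa of `n` times the generic point is a root of
`Ψ₂Sq`, hence constant, which is impossible. If `N` is odd, `ΨSq` at `N` is the zero polynomial, so
the characteristic divides `N` and is not two; then there is a point of order two over `K`, where
odd-indexed division polynomials do not vanish. -/
theorem nsmul_genericPoint_ne_zero [IsAlgClosed K] {n : ℕ} (hn : 1 ≤ n) :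
    n • genericPoint E ≠ 0 := by
  by_contra hc
  have hex : ∃ n, 1 ≤ n ∧ n • genericPoint E = 0 := ⟨n, hn, hc⟩
  obtain ⟨h1, h2⟩ := Nat.find_spec hex
  have hmin : ∀ j, 1 ≤ j → j < Nat.find hex → j • genericPoint E ≠ 0 := fun j hj hj' h =>
    Nat.find_min hex hj' ⟨hj, h⟩
  generalize Nat.find hex = N at *
  have hN : 2 ≤ N := by
    by_contra hN
    obtain rfl : N = 1 := by omega
    rw [one_nsmul] at h2
    exact genericPoint_ne_zero E h2
  have hw := wv_eq_zero_of_order hN hmin h2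
  rcases Nat.even_or_odd' N with ⟨n, rfl | rfl⟩
  · have hn0 := hmin n (by omega) (by omega)
    have hx := xc_nsmul_generic_ne E (n := n) (by omega) fun j h1 h2 => hmin j h1 (by omega)
    have hp : psi2 (n • genericPoint E) = 0 :=
      (two_nsmul_eq_zero_iff hn0).mp (by rwa [← mul_nsmul'])
    have hs := psi2_sq hn0
    rw [hp] at hs
    have halg : IsAlgebraic K (xc (n • genericPoint E)) := by
      refine ⟨E.Ψ₂Sq, Psi2Sq_ne_zero E, ?_⟩
      rw [Ψ₂Sq]
      simp only [map_add, map_mul, map_pow, Polynomial.aeval_X, Polynomial.aeval_C, map_ofNat]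
      simp only [baseChange, map_b₂, map_b₄, map_b₆] at hs
      exact hs.symm.trans (by simp)
    obtain ⟨c, hc⟩ := mem_range_of_isAlgebraic halg
    exact hx c hc.symm
  · have hS : E.ΨSq ((2 * n + 1 : ℕ) : ℤ) = 0 := by
      apply aeval_xFun_eq_zero E
      rw [← wv_sq_generic, hw]; ring
    have hch : (((2 * n + 1 : ℕ) : ℤ) : K) = 0 := by
      by_contra h
      exact E.ΨSq_ne_zero h hS
    have h2 : (2 : K) ≠ 0 := by
      intro h2
      push_cast at hch
      rw [h2] at hch
      simp at hch
    obtain ⟨T, hT, hT2⟩ := exists_psi2_eq_zero E h2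
    apply wv_odd_ne_zero hT hT2 n
    have := wv_sq hT ((2 * n + 1 : ℕ) : ℤ)
    rw [hS] at this
    simpa using this

end Generic

/-! ### The elliptic relation and the zeros of division polynomials -/

section Ward

theorem kummer_swap {F : Type*} [Field F] (W : WeierstrassCurve F) (a b c : F) :
    kummer W a b c = kummer W a c b := by
  simp only [kummer]; ring

/-- The elliptic sequence relation at a point of infinite order. -/
theorem ward_nontorsion {F : Type*} [Field F] [DecidableEq F] {W : WeierstrassCurve F}
    {P : W.toAffine.Point} (h0 : ∀ n : ℕ, 1 ≤ n → n • P ≠ 0) {n : ℕ} (hn : 1 ≤ n) (k : ℕ) :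
    wv P (n + k + n) * wv P k =
      (xc (n • P) - xc ((n + k) • P)) * wv P (n + k) ^ 2 * wv P n ^ 2 := by
  have hP : P ≠ 0 := by simpa using h0 1 le_rfl
  have hw : ∀ j : ℕ, 1 ≤ j → wv P j ≠ 0 := fun j hj =>
    (nsmul_formula P j hj fun i hi _ => h0 i hi).1
  have hX : ∀ j : ℕ, 1 ≤ j → (xc P - xc (j • P)) * wv P j ^ 2 = wv P (j + 1) * wv P (j - 1) :=
    fun j hj => (nsmul_formula P j hj fun i hi _ => h0 i hi).2
  have hne : ∀ i j : ℕ, 1 ≤ i → 1 ≤ j → xc ((i + j) • P) ≠ xc (j • P) := fun i j hi hj =>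
    xc_nsmul_ne (h0 _ (by omega)) (h0 _ hj) (h0 _ hi) (h0 _ (by omega))
  have h1 : ∀ j : ℕ, 1 ≤ j → (xc (j • P) - xc ((j + 1) • P)) * (wv P j ^ 2 * wv P (j + 1) ^ 2)
      = wv P (2 * j + 1) := by
    intro j hj
    refine xc_nsmul_sub_succ (hX j hj) ?_
    have := hX (j + 1) (by omega)
    push_cast at this
    rwa [show (j : ℤ) + 1 + 1 = j + 2 by ring, add_sub_cancel_right] at this
  induction k using Nat.strong_induction_on with
  | _ k IH =>
  obtain rfl | rfl | rfl | ⟨k, rfl⟩ : k = 0 ∨ k = 1 ∨ k = 2 ∨ ∃ j, k = j + 3 := by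
    rcases k with _ | _ | _ | k
    · simp
    · simp
    · simp
    · simp
  · simp
  · have := h1 n hn
    push_cast
    rw [wv_one, show (n : ℤ) + 1 + n = 2 * n + 1 by ring, ← this]
    ring
  · have hn1 := h0 (n + 1) (by omega)
    have hx : xc ((n + 1) • P) ≠ xc P := by
      have := hne n 1 hn le_rfl
      rwa [one_nsmul] at this
    have hd := xc_add_sub hn1 hP hx
    rw [← succ_nsmul, show (n + 1) • P - P = n • P by rw [succ_nsmul]; simp] at hd
    have e1 := hX (n + 1) (by omega)
    have e2 := psi2_nsmul (P := P) (n := n + 1) (by omega) fun j hj _ => h0 j hj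
    have hw1 := hw (n + 1) (by omega)
    push_cast at *
    rw [wv_two, show (n : ℤ) + 2 + n = 2 * (n + 1) by ring, ← e2]
    rw [add_sub_cancel_right, show (n : ℤ) + 1 + 1 = n + 2 by ring] at e1
    have e3 : (xc P - xc ((n + 1) • P)) ^ 2 * wv P ((n : ℤ) + 1) ^ 4 =
        wv P ((n : ℤ) + 2) ^ 2 * wv P n ^ 2 := by
      linear_combination ((xc P - xc ((n + 1) • P)) * wv P ((n : ℤ) + 1) ^ 2 +
        wv P ((n : ℤ) + 2) * wv P n) * e1
    linear_combination (xc (n • P) - xc ((n + 2) • P)) * e3 + wv P ((n : ℤ) + 1) ^ 4 * hd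
  · have g1 := IH (k + 1) (by omega)
    have g2 := IH (k + 2) (by omega)
    have a1 := hX (n + (k + 2) + n) (by omega)
    have a2 := hX (k + 2) (by omega)
    have a3 := hX (n + (k + 2)) (by omega)
    have b1 := hw (n + (k + 1)) (by omega)
    have b2 := hw n hn
    have b3 := hw (k + 1) (by omega)
    have b4 := hw (n + (k + 1) + n) (by omega)
    have hm := h0 (n + (k + 2)) (by omega)
    have hx1 : xc ((n + (k + 2)) • P) ≠ xc P := by
      have := hne (n + (k + 1)) 1 (by omega) le_rfl
      rwa [one_nsmul] at this
    have hx2 : xc ((n + (k + 2)) • P) ≠ xc (n • P) := by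
      have := hne (k + 2) n (by omega) hn
      rwa [add_comm (k + 2)] at this
    -- With `M = n + k + 2`, the symmetry of `kummer` compares `(M ± 1)P` against `nP` with `(M ±
    -- n)P` against `P`. This yields index `k + 3` from `k + 2` and `k + 1`, after cancelling the
    -- nonzero values at `k + 1`.
    have k1 := kummer_add hm hP hx1 (xc (n • P))
    have k2 := kummer_add hm (h0 n hn) hx2 (xc P)
    rw [kummer_swap, ← k1, ← succ_nsmul,
      show (n + (k + 2)) • P - P = (n + (k + 1)) • P by
        rw [show n + (k + 2) = n + (k + 1) + 1 by ring, succ_nsmul]; simp,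
      show (n + (k + 2)) • P - n • P = (k + 2) • P by rw [add_nsmul]; simp,
      show (n + (k + 2)) • P + n • P = (n + (k + 2) + n) • P from (add_nsmul ..).symm] at k2
    push_cast at *
    rw [show (n : ℤ) + (k + 2) + n + 1 = n + (k + 3) + n by ring,
      show (n : ℤ) + (k + 2) + n - 1 = n + (k + 1) + n by ring] at a1
    rw [show (k : ℤ) + 2 + 1 = k + 3 by ring, show (k : ℤ) + 2 - 1 = k + 1 by ring] at a2
    rw [show (n : ℤ) + (k + 2) + 1 = n + (k + 3) by ring,
      show (n : ℤ) + (k + 2) - 1 = n + (k + 1) by ring] at a3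
    apply mul_right_cancel₀ (mul_ne_zero b4 b3)
    rw [show n + (k + 2) + 1 = n + (k + 3) by ring] at k2
    generalize wv P ((n : ℤ) + (k + 3) + n) = u3 at *
    generalize wv P ((n : ℤ) + (k + 2) + n) = u2 at *
    generalize wv P ((n : ℤ) + (k + 1) + n) = u1 at *
    generalize wv P ((k : ℤ) + 3) = v3 at *
    generalize wv P ((k : ℤ) + 2) = v2 at *
    generalize wv P ((k : ℤ) + 1) = v1 at *
    generalize wv P ((n : ℤ) + (k + 3)) = m3 at *
    generalize wv P ((n : ℤ) + (k + 2)) = m2 at *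
    generalize wv P ((n : ℤ) + (k + 1)) = m1 at *
    generalize wv P (n : ℤ) = w at *
    generalize xc P = x at *
    generalize xc (n • P) = xn at *
    generalize xc ((n + (k + 3)) • P) = y3 at *
    generalize xc ((n + (k + 2)) • P) = y2 at *
    generalize xc ((n + (k + 1)) • P) = y1 at *
    generalize xc ((k + 2) • P) = z2 at *
    generalize xc ((n + (k + 2) + n) • P) = t2 at *
    calc u3 * v3 * (u1 * v1) = (u3 * u1) * (v3 * v1) := by ring
      _ = (x - t2) * (x - z2) * (u2 * v2) ^ 2 := by rw [← a1, ← a2]; ring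
      _ = (y2 - xn) ^ 2 * ((x - t2) * (x - z2)) * m2 ^ 4 * w ^ 4 := by rw [g2]; ring
      _ = (xn - y3) * (xn - y1) * ((x - y2) * m2 ^ 2) ^ 2 * w ^ 4 := by rw [k2]; ring
      _ = (xn - y3) * m3 ^ 2 * w ^ 2 * ((xn - y1) * m1 ^ 2 * w ^ 2) := by rw [a3]; ring
      _ = _ := by rw [← g1]

variable {K : Type*} [Field K] [IsAlgClosed K] (E : WeierstrassCurve K) [E.IsElliptic]

open scoped Classical in
theorem ward_generic_nat {m n : ℕ} (hn : 1 ≤ n) (hm : n ≤ m) :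
    wv (genericPoint E) (m + n) * wv (genericPoint E) (m - n) =
      wv (genericPoint E) (m + 1) * wv (genericPoint E) (m - 1) * wv (genericPoint E) n ^ 2 -
      wv (genericPoint E) (n + 1) * wv (genericPoint E) (n - 1) * wv (genericPoint E) m ^ 2 := by
  obtain ⟨k, rfl⟩ := Nat.exists_eq_add_of_le hm
  have h0 : ∀ n : ℕ, 1 ≤ n → n • genericPoint E ≠ 0 := fun n hn => nsmul_genericPoint_ne_zero E hn
  have h := ward_nontorsion h0 hn k
  have h1 := (nsmul_formula _ n hn fun i hi _ => h0 i hi).2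
  have h2 := (nsmul_formula _ (n + k) (by omega) fun i hi _ => h0 i hi).2
  push_cast at *
  rw [add_sub_cancel_left, h, ← h1, ← h2]
  ring

theorem ward_generic (m n : ℤ) :
    wv (genericPoint E) (m + n) * wv (genericPoint E) (m - n) =
      wv (genericPoint E) (m + 1) * wv (genericPoint E) (m - 1) * wv (genericPoint E) n ^ 2 -
      wv (genericPoint E) (n + 1) * wv (genericPoint E) (n - 1) * wv (genericPoint E) m ^ 2 := by
  set w := wv (genericPoint E) with hw
  have hneg : ∀ j, w (-j) = -w j := wv_neg _
  have key : ∀ m n : ℤ, 0 ≤ n → n ≤ m → w (m + n) * w (m - n) =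
      w (m + 1) * w (m - 1) * w n ^ 2 - w (n + 1) * w (n - 1) * w m ^ 2 := by
    intro m n h0 h1
    lift n to ℕ using h0
    lift m to ℕ using by omega
    rcases Nat.eq_zero_or_pos n with rfl | hn
    · have := hneg 1
      simp [hw]
      ring
    · exact ward_generic_nat E hn (by omega)
  have key2 : ∀ m n : ℤ, 0 ≤ n → 0 ≤ m → w (m + n) * w (m - n) =
      w (m + 1) * w (m - 1) * w n ^ 2 - w (n + 1) * w (n - 1) * w m ^ 2 := by
    intro m n hn hm
    rcases le_total n m with h | h
    · exact key m n hn h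
    · have := key n m hm h
      have e := hneg (n - m)
      rw [neg_sub] at e
      rw [e, add_comm m n]
      linear_combination -this
  have key3 : ∀ m n : ℤ, 0 ≤ m → w (m + n) * w (m - n) =
      w (m + 1) * w (m - 1) * w n ^ 2 - w (n + 1) * w (n - 1) * w m ^ 2 := by
    intro m n hm
    rcases le_total 0 n with h | h
    · exact key2 m n h hm
    · have := key2 m (-n) (by omega) hm
      have e1 := hneg n
      have e2 := hneg (n + 1)
      have e3 := hneg (n - 1)
      rw [neg_add'] at e2
      rw [neg_sub'] at e3
      rw [sub_neg_eq_add] at e3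
      rw [e1, e2, e3, sub_neg_eq_add, ← sub_eq_add_neg] at this
      linear_combination this
  rcases le_total 0 m with h | h
  · exact key3 m n h
  · have := key3 (-m) n (by omega)
    have e1 := hneg m
    have e2 := hneg (m + 1)
    have e3 := hneg (m - 1)
    have e4 := hneg (m + n)
    have e5 := hneg (m - n)
    rw [neg_add'] at e2 e4
    rw [neg_sub', sub_neg_eq_add] at e3 e5
    rw [e1, e2, e3, e4, e5] at this
    linear_combination this

variable {E}

/-- The relation at the generic point is an identity in the coordinate ring, hence holds at every
affine point, torsion or not. -/
theorem wv_relation {T : E.toAffine.Point} (hT : T ≠ 0) (m n : ℤ) :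
    wv T (m + n) * wv T (m - n) =
      wv T (m + 1) * wv T (m - 1) * wv T n ^ 2 - wv T (n + 1) * wv T (n - 1) * wv T m ^ 2 := by
  have h := ward_generic E m n
  simp only [wv_genericPoint, ← map_mul, ← map_pow, ← map_sub] at h
  have h2 := congrArg (evalAt (equation_coords hT)) (algebraMap_FF_injective E h)
  simpa only [map_mul, map_pow, map_sub, evalAt_psi hT] using h2

variable [DecidableEq K]

/-- The division polynomial `ψₙ` vanishes exactly at the nonzero `n`-torsion points. -/
theorem wv_nat_eq_zero_iff {T : E.toAffine.Point} (hT : T ≠ 0) (n : ℕ) :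
    wv T n = 0 ↔ n • T = 0 := by
  rcases Nat.eq_zero_or_pos n with rfl | hn
  · simp
  by_cases hex : ∃ r, 1 ≤ r ∧ r • T = 0
  swap
  · push Not at hex
    exact iff_of_false (nsmul_formula T n hn fun j hj _ => hex j hj).1 (hex n hn)
  obtain ⟨h1, h2⟩ := Nat.find_spec hex
  have hmin : ∀ j, 1 ≤ j → j < Nat.find hex → j • T ≠ 0 := fun j hj hj' h =>
    Nat.find_min hex hj' ⟨hj, h⟩
  generalize Nat.find hex = r at *
  have hr : 2 ≤ r := by
    by_contra hr
    obtain rfl : r = 1 := by omega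
    exact hT (by simpa using h2)
  have hwr : wv T r = 0 := wv_eq_zero_of_order hr hmin h2
  have hlt : ∀ j : ℕ, 1 ≤ j → j < r → wv T j ≠ 0 := fun j hj hj' =>
    (nsmul_formula T j hj fun i hi hij => hmin i hi (by omega)).1
  have hsucc : wv T (r + 1) ≠ 0 := by
    obtain rfl | rfl | h4 : r = 2 ∨ r = 3 ∨ 4 ≤ r := by omega
    · exact wv_three_ne_zero hT (by simpa using hwr)
    · have hp : psi2 T ≠ 0 := fun h => hmin 2 (by omega) (by omega) ((two_nsmul_eq_zero_iff hT).mpr h)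
      have h2T := hmin 2 (by omega) (by omega)
      have := psi2_double hT hp
      norm_num
      rw [wv_four, ← this]
      refine mul_ne_zero (mul_ne_zero ?_ (pow_ne_zero 3 hp)) hp
      intro h
      rw [← two_nsmul_eq_zero_iff h2T, ← mul_nsmul', show 2 * 2 = 3 + 1 by rfl, add_nsmul, h2,
        zero_add, one_nsmul] at h
      exact hT h
    -- In the relation for `r - 1` and `2` the term with `ψᵣ` drops out, and the other term is a
    -- product of values of index below `r`, which are nonzero.
    · obtain ⟨s, rfl⟩ : ∃ s, r = s + 4 := ⟨r - 4, by omega⟩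
      have h := wv_relation hT (s + 3) 2
      have e1 := hlt 3 (by omega) (by omega)
      have e2 := hlt (s + 3) (by omega) (by omega)
      push_cast at *
      rw [show (s : ℤ) + 3 + 1 = s + 4 by ring, hwr] at h
      intro h0
      rw [show (s : ℤ) + 3 + 2 = s + 4 + 1 by ring, h0] at h
      norm_num at h
      exact h.elim e1 e2
  have hpred : wv T (r - 1) ≠ 0 := by
    have := hlt (r - 1) (by omega) (by omega)
    rwa [Nat.cast_sub (by omega)] at this
  -- In the relation for `r` and `i`, vanishing at `r` and at `r + i` forces vanishing at `i`, since
  -- the neighbours of `r` do not vanish.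
  have hnd : ∀ j : ℕ, ¬ r ∣ j → wv T j ≠ 0 := by
    intro j
    induction j using Nat.strong_induction_on with
    | _ j IH =>
    intro hj h
    rcases lt_or_ge j r with hjr | hjr
    · exact hlt j (Nat.pos_of_ne_zero fun h0 => hj (h0 ▸ dvd_zero r)) hjr h
    · obtain ⟨i, rfl⟩ := Nat.exists_eq_add_of_le hjr
      have hi := IH i (by omega) fun hd => hj (dvd_add dvd_rfl hd)
      have hw := wv_relation hT r i
      push_cast at h
      rw [h, hwr] at hw
      have : wv T (r + 1) * wv T (r - 1) * wv T i ^ 2 = 0 := by linear_combination -hw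
      simp [hsucc, hpred, hi] at this
  have hdz : ∀ q : ℕ, wv T (q * r : ℕ) = 0 := by
    intro q
    induction q using Nat.strong_induction_on with
    | _ q IH =>
    obtain rfl | rfl | ⟨q, rfl⟩ : q = 0 ∨ q = 1 ∨ ∃ j, q = j + 2 := by
      rcases q with _ | _ | q
      · simp
      · simp
      · simp
    · simp
    · simpa using hwr
    by_cases hr2 : r = 2
    · subst hr2
      exact wv_even_eq_zero hT (by simpa using hwr) (by simp)
    -- The indices are chosen so that their sum is `(q + 2) r`, while both terms on the right
    -- contain the value at `(q + 1) r` or at `r`. Their difference `q r + 2` is not a multiple of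
    -- `r`, as `r ≠ 2`.
    · have hw := wv_relation hT ((q + 1) * r + 1) (r - 1)
      have e1 := IH (q + 1) (by omega)
      push_cast at e1 ⊢
      rw [add_sub_cancel_right, e1, show (r : ℤ) - 1 + 1 = r by ring, hwr,
        show ((q : ℤ) + 1) * r + 1 + (r - 1) = (q + 2) * r by ring,
        show ((q : ℤ) + 1) * r + 1 - (r - 1) = ((q * r + 2 : ℕ) : ℤ) by push_cast; ring] at hw
      have e2 := hnd (q * r + 2) fun hd => by
        have := Nat.le_of_dvd (by omega) ((Nat.dvd_add_right (Dvd.intro_left q rfl)).mp hd)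
        omega
      push_cast at hw e2
      simpa [e2] using hw
  constructor
  · intro h
    by_contra hc
    exact hnd n (fun ⟨q, hq⟩ => hc (by rw [hq, mul_comm, mul_nsmul', h2, nsmul_zero])) h
  · intro h
    have hd : r ∣ n := by
      by_contra hd
      have hlt' := Nat.mod_lt n (show 0 < r by omega)
      refine hmin (n % r) (Nat.pos_of_ne_zero fun h0 => hd (Nat.dvd_of_mod_eq_zero h0)) hlt' ?_
      have := Nat.div_add_mod n r
      rw [← this, add_nsmul, mul_comm, mul_nsmul', h2, nsmul_zero, zero_add] at h
      exact h
    obtain ⟨q, rfl⟩ := hd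
    rw [mul_comm]
    exact hdz q

theorem wv_eq_zero_iff {T : E.toAffine.Point} (hT : T ≠ 0) (n : ℤ) :
    wv T n = 0 ↔ n • T = 0 := by
  obtain ⟨k, rfl | rfl⟩ := n.eq_nat_or_neg
  · rw [wv_nat_eq_zero_iff hT, natCast_zsmul]
  · rw [wv_neg, neg_eq_zero, wv_nat_eq_zero_iff hT, neg_zsmul, neg_eq_zero, natCast_zsmul]

end Ward

/-! ## Local rings -/

section Local

variable {K : Type*} [Field K] {E : WeierstrassCurve K}

/-- The dehomogenization of a polynomial in three variables as a polynomial in `X` and `Y`. -/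
def dehPoly : MvPolynomial (Fin 3) K →ₐ[K] Polynomial K[X] :=
  MvPolynomial.aeval ![Polynomial.C Polynomial.X, Polynomial.X, 1]

variable (E) in
/-- The inclusion of polynomials in `X` and `Y` into the function field. -/
def polyFun : Polynomial K[X] →ₐ[K] FF E where
  toRingHom := (algebraMap E.toAffine.CoordinateRing (FF E)).comp
    (Affine.CoordinateRing.mk E.toAffine : Polynomial K[X] →+* _)
  commutes' _ := rfl

theorem polyFun_apply (p : Polynomial K[X]) : polyFun E p =
    algebraMap E.toAffine.CoordinateRing (FF E) (Affine.CoordinateRing.mk E.toAffine p) := rfl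

theorem dehom_eq (A : MvPolynomial (Fin 3) K) : dehom E A = polyFun E (dehPoly A) := by
  have : (MvPolynomial.aeval ![xFun E, yFun E, 1] : MvPolynomial (Fin 3) K →ₐ[K] FF E) =
      (polyFun E).comp dehPoly := by
    refine MvPolynomial.algHom_ext fun i => ?_
    fin_cases i
    · simp [dehPoly]; rfl
    · simp [dehPoly]; rfl
    · simp [dehPoly]
  exact congrArg (fun f : MvPolynomial (Fin 3) K →ₐ[K] FF E => f A) this

theorem evalEval_dehPoly (x y : K) (A : MvPolynomial (Fin 3) K) :
    (dehPoly A).evalEval x y = MvPolynomial.eval ![x, y, 1] A := by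
  have : (Polynomial.evalEvalRingHom x y).comp (dehPoly (K := K)).toRingHom =
      MvPolynomial.eval ![x, y, 1] := by
    refine MvPolynomial.ringHom_ext (fun r => ?_) fun i => ?_
    · simp
    · fin_cases i <;> simp [dehPoly]
  exact congrArg (fun f : MvPolynomial (Fin 3) K →+* K => f A) this

theorem coords_zero : coords (0 : E.toAffine.Point) = ![0, 1, 0] := rfl

theorem coords_of_ne_zero {T : E.toAffine.Point} (hT : T ≠ 0) : coords T = ![xc T, yc T, 1] := by
  obtain ⟨x, y, h, rfl⟩ := exists_some_of_ne_zero hT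
  rfl

/-- The degree of the norm of a regular function, that is, its pole order at infinity. -/
def normDeg (a : E.toAffine.CoordinateRing) : WithBot ℕ := (Algebra.norm K[X] a).degree

theorem normDeg_mul (a b : E.toAffine.CoordinateRing) :
    normDeg (a * b) = normDeg a + normDeg b := by
  rw [normDeg, map_mul, Polynomial.degree_mul]; rfl

theorem normDeg_basis (p q : K[X]) :
    normDeg (p • (1 : E.toAffine.CoordinateRing) + q • Affine.CoordinateRing.mk E.toAffine
      Polynomial.X) = max (2 • p.degree) (2 • q.degree + 3) :=
  Affine.CoordinateRing.degree_norm_smul_basis p q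

theorem normDeg_zero : normDeg (0 : E.toAffine.CoordinateRing) = ⊥ := by
  have := normDeg_basis (E := E) 0 0
  rw [zero_smul, zero_smul, add_zero] at this
  rw [this]; simp

theorem nsmul_degree_le_of_le {p q : K[X]} {a : WithBot ℕ} (hp : 2 • p.degree < a)
    (hq : 2 • q.degree < a) : 2 • (p + q).degree < a := by
  rcases max_choice p.degree q.degree with h | h
  · exact (nsmul_le_nsmul_right (h ▸ Polynomial.degree_add_le p q) 2).trans_lt hp
  · exact (nsmul_le_nsmul_right (h ▸ Polynomial.degree_add_le p q) 2).trans_lt hq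

theorem nsmul_degree_le_of_le' {p q : K[X]} {a : WithBot ℕ} (hp : 2 • p.degree + 3 < a)
    (hq : 2 • q.degree + 3 < a) : 2 • (p + q).degree + 3 < a := by
  rcases max_choice p.degree q.degree with h | h
  · exact (add_le_add_left (nsmul_le_nsmul_right (h ▸ Polynomial.degree_add_le p q) 2) 3).trans_lt hp
  · exact (add_le_add_left (nsmul_le_nsmul_right (h ▸ Polynomial.degree_add_le p q) 2) 3).trans_lt hq

theorem normDeg_add_lt {a b : E.toAffine.CoordinateRing} {k : WithBot ℕ} (ha : normDeg a < k)
    (hb : normDeg b < k) : normDeg (a + b) < k := by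
  obtain ⟨p, q, rfl⟩ := Affine.CoordinateRing.exists_smul_basis_eq a
  obtain ⟨r, s, rfl⟩ := Affine.CoordinateRing.exists_smul_basis_eq b
  rw [normDeg_basis, max_lt_iff] at ha hb
  rw [add_add_add_comm, ← add_smul, ← add_smul, normDeg_basis, max_lt_iff]
  exact ⟨nsmul_degree_le_of_le ha.1 hb.1, nsmul_degree_le_of_le' ha.2 hb.2⟩

theorem normDeg_X : normDeg (Affine.CoordinateRing.mk E.toAffine (Polynomial.C Polynomial.X)) = 2 := by
  have := normDeg_basis (E := E) Polynomial.X 0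
  rw [zero_smul, add_zero, Affine.CoordinateRing.smul, mul_one] at this
  rw [this]; simp

theorem normDeg_Y : normDeg (Affine.CoordinateRing.mk E.toAffine Polynomial.X) = 3 := by
  have := normDeg_basis (E := E) 0 1
  rw [zero_smul, zero_add, one_smul] at this
  rw [this]; simp

theorem normDeg_C {c : K} (hc : c ≠ 0) :
    normDeg (Affine.CoordinateRing.mk E.toAffine (Polynomial.C (Polynomial.C c))) = 0 := by
  have := normDeg_basis (E := E) (Polynomial.C c) 0
  rw [zero_smul, add_zero, Affine.CoordinateRing.smul, mul_one] at this
  rw [this]; simp [Polynomial.degree_C hc]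

theorem normDeg_pow (a : E.toAffine.CoordinateRing) (n : ℕ) : normDeg (a ^ n) = n • normDeg a := by
  rw [normDeg, map_pow, Polynomial.degree_pow]; rfl

theorem normDeg_monomial {c : K} (hc : c ≠ 0) (m : Fin 3 →₀ ℕ) :
    normDeg (Affine.CoordinateRing.mk E.toAffine (dehPoly (MvPolynomial.monomial m c))) =
      ((2 * m 0 + 3 * m 1 : ℕ) : WithBot ℕ) := by
  have : dehPoly (MvPolynomial.monomial m c) = Polynomial.C (Polynomial.C c) *
      (Polynomial.C Polynomial.X ^ m 0 * Polynomial.X ^ m 1) := by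
    rw [dehPoly, MvPolynomial.aeval_monomial, Finsupp.prod_fintype _ _ (by simp)]
    simp [Fin.prod_univ_three]
  rw [this, map_mul, map_mul, map_pow, map_pow, normDeg_mul, normDeg_mul, normDeg_pow, normDeg_pow,
    normDeg_C hc, normDeg_X, normDeg_Y, zero_add]
  push_cast
  rw [nsmul_eq_mul, nsmul_eq_mul, mul_comm, mul_comm (m 1 : WithBot ℕ)]

theorem eval_zero_coords {n : ℕ} {A : MvPolynomial (Fin 3) K} (hA : A.IsHomogeneous n) :
    MvPolynomial.eval ![0, 1, 0] A = A.coeff (Finsupp.single 1 n) := by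
  rw [MvPolynomial.eval_eq', Finset.sum_eq_single (Finsupp.single 1 n)]
  · simp [Finsupp.single_apply]
  · intro m hm hne
    rw [Fin.prod_univ_three]
    have hdeg := hA (MvPolynomial.mem_support_iff.mp hm)
    by_cases h0 : m 0 = 0
    · by_cases h2 : m 2 = 0
      · exfalso
        apply hne
        rw [Finsupp.weight_apply, Finsupp.sum_fintype _ _ (by simp)] at hdeg
        simp [Fin.sum_univ_three, h0, h2] at hdeg
        ext i
        fin_cases i <;> simp [h0, h2, hdeg]
      · simp [h2]
    · simp [h0]
  · intro h
    rw [MvPolynomial.notMem_support_iff.mp h, zero_mul]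

/-- This makes values of rational functions well defined. At infinity the value of a form is its
coefficient of `Y ^ n`; among monomials of degree `n` this one alone has pole order `3n`, so it
cannot cancel. -/
theorem eval_coords_eq_zero {n : ℕ} {A : MvPolynomial (Fin 3) K} (hA : A.IsHomogeneous n)
    (h : dehom E A = 0) (T : E.toAffine.Point) : MvPolynomial.eval (coords T) A = 0 := by
  rw [dehom_eq, polyFun_apply, map_eq_zero_iff _ (algebraMap_FF_injective E)] at h
  by_cases hT : T = 0
  swap
  · rw [coords_of_ne_zero hT, ← evalEval_dehPoly, ← evalAt_mk (equation_coords hT), h, map_zero]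
  subst hT
  rw [coords_zero, eval_zero_coords hA]
  by_contra hc
  set m₀ : Fin 3 →₀ ℕ := Finsupp.single 1 n with hm₀
  have hmem : m₀ ∈ A.support := MvPolynomial.mem_support_iff.mpr hc
  have hs := MvPolynomial.as_sum A
  rw [← Finset.add_sum_erase _ _ hmem] at hs
  rw [hs, map_add, map_add] at h
  have hrest : normDeg (Affine.CoordinateRing.mk E.toAffine (dehPoly
      (∑ m ∈ A.support.erase m₀, MvPolynomial.monomial m (A.coeff m)))) < ((3 * n : ℕ) : WithBot ℕ) := by
    rw [map_sum, map_sum]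
    refine Finset.sum_induction _ (fun a => normDeg a < ((3 * n : ℕ) : WithBot ℕ))
      (fun a b ha hb => normDeg_add_lt ha hb) ?_ ?_
    · rw [normDeg_zero]
      exact WithBot.bot_lt_coe _
    · intro m hm
      obtain ⟨hne, hm⟩ := Finset.mem_erase.mp hm
      rw [normDeg_monomial (MvPolynomial.mem_support_iff.mp hm), Nat.cast_lt]
      have hdeg := hA (MvPolynomial.mem_support_iff.mp hm)
      rw [Finsupp.weight_apply, Finsupp.sum_fintype _ _ (by simp)] at hdeg
      simp [Fin.sum_univ_three] at hdeg
      by_contra hlt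
      apply hne
      ext i
      fin_cases i <;> simp [hm₀] <;> omega
  rw [← neg_eq_iff_add_eq_zero] at h
  rw [← h, show ∀ a : E.toAffine.CoordinateRing, -a = Affine.CoordinateRing.mk E.toAffine
    (Polynomial.C (Polynomial.C (-1))) * a by simp, normDeg_mul, normDeg_C (by simp),
    normDeg_monomial hc, zero_add, Nat.cast_lt] at hrest
  simp [hm₀] at hrest

theorem dehom_ne_zero {n : ℕ} {A : MvPolynomial (Fin 3) K} (hA : A.IsHomogeneous n)
    {T : E.toAffine.Point} (h : MvPolynomial.eval (coords T) A ≠ 0) : dehom E A ≠ 0 :=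
  fun h0 => h (eval_coords_eq_zero hA h0 T)

variable {T : E.toAffine.Point} {f g : FF E} {v w : K}

theorem dehom_mul (A B : MvPolynomial (Fin 3) K) : dehom E (A * B) = dehom E A * dehom E B :=
  map_mul _ _ _

theorem dehom_add (A B : MvPolynomial (Fin 3) K) : dehom E (A + B) = dehom E A + dehom E B :=
  map_add _ _ _

theorem dehom_sub (A B : MvPolynomial (Fin 3) K) : dehom E (A - B) = dehom E A - dehom E B :=
  map_sub _ _ _

theorem HasValue.unique (hv : HasValue T g v) (hw : HasValue T g w) : v = w := by
  obtain ⟨n, A, B, hA, hB, hB0, rfl, rfl⟩ := hv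
  obtain ⟨m, A', B', hA', hB', hB0', he, rfl⟩ := hw
  rw [div_eq_div_iff (dehom_ne_zero hB hB0) (dehom_ne_zero hB' hB0'), ← dehom_mul, ← dehom_mul,
    ← sub_eq_zero, ← dehom_sub] at he
  have := eval_coords_eq_zero ((hA.mul hB').sub ((add_comm m n) ▸ hA'.mul hB)) he T
  rw [div_eq_div_iff hB0 hB0']
  simp only [map_sub, map_mul] at this
  linear_combination this

theorem HasValue.add (hf : HasValue T f v) (hg : HasValue T g w) : HasValue T (f + g) (v + w) := by
  obtain ⟨n, A, B, hA, hB, hB0, rfl, rfl⟩ := hf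
  obtain ⟨m, A', B', hA', hB', hB0', rfl, rfl⟩ := hg
  refine ⟨n + m, A * B' + B * A', B * B', (hA.mul hB').add (hB.mul hA'), hB.mul hB', ?_, ?_, ?_⟩
  · rw [map_mul]; exact mul_ne_zero hB0 hB0'
  · rw [dehom_add, dehom_mul, dehom_mul, dehom_mul,
      div_add_div _ _ (dehom_ne_zero hB hB0) (dehom_ne_zero hB' hB0')]
  · rw [map_add, map_mul, map_mul, map_mul, div_add_div _ _ hB0 hB0']

theorem HasValue.mul (hf : HasValue T f v) (hg : HasValue T g w) : HasValue T (f * g) (v * w) := by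
  obtain ⟨n, A, B, hA, hB, hB0, rfl, rfl⟩ := hf
  obtain ⟨m, A', B', hA', hB', hB0', rfl, rfl⟩ := hg
  refine ⟨n + m, A * A', B * B', hA.mul hA', hB.mul hB', ?_, ?_, ?_⟩
  · rw [map_mul]; exact mul_ne_zero hB0 hB0'
  · rw [dehom_mul, dehom_mul, div_mul_div_comm]
  · rw [map_mul, map_mul, div_mul_div_comm]

theorem HasValue.inv (hf : HasValue T f v) (hv : v ≠ 0) : HasValue T f⁻¹ v⁻¹ := by
  obtain ⟨n, A, B, hA, hB, hB0, rfl, rfl⟩ := hf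
  exact ⟨n, B, A, hB, hA, fun h => hv (by rw [h, zero_div]), inv_div _ _, inv_div _ _⟩

theorem hasValue_algebraMap (T : E.toAffine.Point) (c : K) :
    HasValue T (algebraMap K (FF E) c) c := by
  refine ⟨0, MvPolynomial.C c, 1, MvPolynomial.isHomogeneous_C _ _,
    MvPolynomial.isHomogeneous_one _ _, by simp, ?_, by simp⟩
  simp [dehom]

theorem hasValue_zero (T : E.toAffine.Point) : HasValue T (0 : FF E) 0 := by
  simpa using hasValue_algebraMap T (0 : K)

theorem hasValue_one (T : E.toAffine.Point) : HasValue T (1 : FF E) 1 := by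
  simpa using hasValue_algebraMap T (1 : K)

theorem HasValue.neg (hf : HasValue T f v) : HasValue T (-f) (-v) := by
  have := (hasValue_algebraMap T (-1 : K)).mul hf
  simpa using this

theorem HasValue.sub (hf : HasValue T f v) (hg : HasValue T g w) : HasValue T (f - g) (v - w) := by
  rw [sub_eq_add_neg, sub_eq_add_neg]; exact hf.add hg.neg

theorem HasValue.div (hf : HasValue T f v) (hg : HasValue T g w) (hw : w ≠ 0) :
    HasValue T (f / g) (v / w) := by
  rw [div_eq_mul_inv, div_eq_mul_inv]; exact hf.mul (hg.inv hw)

theorem HasValue.pow (hf : HasValue T f v) (n : ℕ) : HasValue T (f ^ n) (v ^ n) := by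
  induction n with
  | zero => simpa using hasValue_one T
  | succ n ih => rw [pow_succ, pow_succ]; exact ih.mul hf

theorem HasValue.zpow (hf : HasValue T f v) (hv : v ≠ 0) (n : ℤ) : HasValue T (f ^ n) (v ^ n) := by
  obtain ⟨k, rfl | rfl⟩ := n.eq_nat_or_neg
  · simpa using hf.pow k
  · simpa using (hf.pow k).inv (pow_ne_zero k hv)

theorem HasValue.prod {ι : Type*} (s : Finset ι) {f : ι → FF E} {v : ι → K}
    (h : ∀ i ∈ s, HasValue T (f i) (v i)) : HasValue T (∏ i ∈ s, f i) (∏ i ∈ s, v i) := by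
  classical
  induction s using Finset.induction_on with
  | empty => simpa using hasValue_one T
  | insert a s ha ih =>
    rw [Finset.prod_insert ha, Finset.prod_insert ha]
    exact (h a (by simp)).mul (ih fun i hi => h i (by simp [hi]))

theorem HasValue.sum {ι : Type*} (s : Finset ι) {f : ι → FF E} {v : ι → K}
    (h : ∀ i ∈ s, HasValue T (f i) (v i)) : HasValue T (∑ i ∈ s, f i) (∑ i ∈ s, v i) := by
  classical
  induction s using Finset.induction_on with
  | empty => simpa using hasValue_zero T
  | insert a s ha ih =>
    rw [Finset.sum_insert ha, Finset.sum_insert ha]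
    exact (h a (by simp)).add (ih fun i hi => h i (by simp [hi]))

theorem HasValue.aeval (hf : HasValue T f v) (p : K[X]) :
    HasValue T (Polynomial.aeval f p) (p.eval v) := by
  induction p using Polynomial.induction_on' with
  | add p q hp hq => rw [map_add, Polynomial.eval_add]; exact hp.add hq
  | monomial n a =>
    rw [Polynomial.aeval_monomial, Polynomial.eval_monomial]
    exact (hasValue_algebraMap T a).mul (hf.pow n)

theorem HasValue.ne_zero (hf : HasValue T f v) (hv : v ≠ 0) : f ≠ 0 := by
  rintro rfl
  exact hv (hf.unique (hasValue_zero T))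

theorem hasValue_xFun (hT : T ≠ 0) : HasValue T (xFun E) (xc T) := by
  refine ⟨1, MvPolynomial.X 0, MvPolynomial.X 2, MvPolynomial.isHomogeneous_X _ _,
    MvPolynomial.isHomogeneous_X _ _, ?_, ?_, ?_⟩
  · simp [coords_of_ne_zero hT]
  · simp [dehom]
  · simp [coords_of_ne_zero hT]

theorem hasValue_yFun (hT : T ≠ 0) : HasValue T (yFun E) (yc T) := by
  refine ⟨1, MvPolynomial.X 1, MvPolynomial.X 2, MvPolynomial.isHomogeneous_X _ _,
    MvPolynomial.isHomogeneous_X _ _, ?_, ?_, ?_⟩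
  · simp [coords_of_ne_zero hT]
  · simp [dehom]
  · simp [coords_of_ne_zero hT]

theorem hasValue_polyFun (hT : T ≠ 0) (p : Polynomial K[X]) :
    HasValue T (polyFun E p) (p.evalEval (xc T) (yc T)) := by
  induction p using Polynomial.induction_on' with
  | add p q hp hq => rw [map_add, Polynomial.evalEval_add]; exact hp.add hq
  | monomial n a =>
    rw [← Polynomial.C_mul_X_pow_eq_monomial, map_mul, map_pow, Polynomial.evalEval_mul,
      Polynomial.evalEval_pow, Polynomial.evalEval_C, Polynomial.evalEval_X,
      polyFun_apply (Polynomial.C a), ← aeval_xFun]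
    exact ((hasValue_xFun hT).aeval a).mul ((hasValue_yFun hT).pow n)

theorem hasValue_inv_yFun_zero : HasValue (0 : E.toAffine.Point) (yFun E)⁻¹ 0 := by
  refine ⟨1, MvPolynomial.X 2, MvPolynomial.X 1, MvPolynomial.isHomogeneous_X _ _,
    MvPolynomial.isHomogeneous_X _ _, ?_, ?_, ?_⟩
  · simp [coords_zero]
  · simp [dehom]
  · simp [coords_zero]

theorem hasValue_x_div_y_zero : HasValue (0 : E.toAffine.Point) (xFun E / yFun E) 0 := by
  refine ⟨1, MvPolynomial.X 0, MvPolynomial.X 1, MvPolynomial.isHomogeneous_X _ _,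
    MvPolynomial.isHomogeneous_X _ _, ?_, ?_, ?_⟩
  · simp [coords_zero]
  · simp [dehom]
  · simp [coords_zero]

end Local

/-! ## Orders of vanishing -/

section Order

variable {K : Type*} [Field K] {E : WeierstrassCurve K} {T : E.toAffine.Point} {f g t : FF E}
  {v w : K}

/-- `g` is regular at `T`. -/
def IsRegularAt (T : E.toAffine.Point) (g : FF E) : Prop := ∃ v, HasValue T g v

/-- `g` is a unit of the local ring at `T`. -/
def IsUnitAt (T : E.toAffine.Point) (g : FF E) : Prop := ∃ v, HasValue T g v ∧ v ≠ 0

theorem HasValue.isRegularAt (h : HasValue T g v) : IsRegularAt T g := ⟨v, h⟩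

theorem HasValue.isUnitAt (h : HasValue T g v) (hv : v ≠ 0) : IsUnitAt T g := ⟨v, h, hv⟩

theorem IsUnitAt.isRegularAt : IsUnitAt T g → IsRegularAt T g := fun ⟨v, h, _⟩ => ⟨v, h⟩

theorem IsRegularAt.mul : IsRegularAt T f → IsRegularAt T g → IsRegularAt T (f * g) :=
  fun ⟨_, h⟩ ⟨_, h'⟩ => ⟨_, h.mul h'⟩

theorem IsRegularAt.add : IsRegularAt T f → IsRegularAt T g → IsRegularAt T (f + g) :=
  fun ⟨_, h⟩ ⟨_, h'⟩ => ⟨_, h.add h'⟩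

theorem IsRegularAt.pow (n : ℕ) : IsRegularAt T f → IsRegularAt T (f ^ n) :=
  fun ⟨_, h⟩ => ⟨_, h.pow n⟩

theorem IsUnitAt.mul : IsUnitAt T f → IsUnitAt T g → IsUnitAt T (f * g) :=
  fun ⟨_, h, h0⟩ ⟨_, h', h0'⟩ => ⟨_, h.mul h', mul_ne_zero h0 h0'⟩

theorem IsUnitAt.inv : IsUnitAt T f → IsUnitAt T f⁻¹ := fun ⟨_, h, h0⟩ => ⟨_, h.inv h0, inv_ne_zero h0⟩

theorem IsUnitAt.zpow (n : ℤ) : IsUnitAt T f → IsUnitAt T (f ^ n) :=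
  fun ⟨_, h, h0⟩ => ⟨_, h.zpow h0 n, zpow_ne_zero n h0⟩

theorem IsUnitAt.ne_zero : IsUnitAt T f → f ≠ 0 := fun ⟨_, h, h0⟩ => h.ne_zero h0

theorem isUnitAt_one : IsUnitAt T (1 : FF E) := ⟨1, hasValue_one T, one_ne_zero⟩

theorem isUnitAt_algebraMap {c : K} (hc : c ≠ 0) : IsUnitAt T (algebraMap K (FF E) c) :=
  ⟨c, hasValue_algebraMap T c, hc⟩

theorem isRegularAt_algebraMap (c : K) : IsRegularAt T (algebraMap K (FF E) c) :=
  ⟨c, hasValue_algebraMap T c⟩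

theorem generic_equation : yFun E ^ 2 + algebraMap K (FF E) E.a₁ * xFun E * yFun E +
    algebraMap K (FF E) E.a₃ * yFun E = xFun E ^ 3 + algebraMap K (FF E) E.a₂ * xFun E ^ 2 +
    algebraMap K (FF E) E.a₄ * xFun E + algebraMap K (FF E) E.a₆ :=
  Affine.equation_iff .. |>.mp (equation_generic E)

/-- Either `g` is a unit or `t` divides `g`; in the second case one power of `t` is cancelled on
both sides. The product with `h` bounds how often this can happen. -/
theorem exists_unit_mul_pow (ht : IsUniformizerAt T t) (ht0 : t ≠ 0) (k : ℕ) :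
    ∀ {g h u : FF E}, IsRegularAt T g → IsRegularAt T h → IsUnitAt T u → g * h = u * t ^ k →
      ∃ (m : ℕ) (u' : FF E), IsUnitAt T u' ∧ g = u' * t ^ m := by
  induction k with
  | zero =>
    rintro g h u ⟨v, hg⟩ ⟨w, hh⟩ ⟨z, hu, hz⟩ he
    rw [pow_zero, mul_one] at he
    refine ⟨0, g, ⟨v, hg, ?_⟩, by simp⟩
    rintro rfl
    have := (hg.mul hh).unique (he ▸ hu)
    exact hz (by rw [← this, zero_mul])
  | succ k ih =>
    rintro g h u ⟨v, hg⟩ hh hu he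
    by_cases hv : v = 0
    · obtain ⟨r, w, hr, rfl⟩ := ht.2 g (hv ▸ hg)
      obtain ⟨m, u', hu', hm⟩ := ih ⟨w, hr⟩ hh hu (by
        apply mul_right_cancel₀ ht0
        linear_combination he)
      exact ⟨m + 1, u', hu', by rw [hm]; ring⟩
    · exact ⟨0, g, ⟨v, hg, hv⟩, by simp⟩

theorem exists_unit_mul_zpow (ht : IsUniformizerAt T t) (ht0 : t ≠ 0) (k : ℤ) {g h u : FF E}
    (hg : IsRegularAt T g) (hh : IsRegularAt T h) (hu : IsUnitAt T u) (he : g * h = u * t ^ k) :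
    ∃ (m : ℕ) (u' : FF E), IsUnitAt T u' ∧ g = u' * t ^ m := by
  obtain ⟨n, rfl | rfl⟩ := k.eq_nat_or_neg
  · exact exists_unit_mul_pow ht ht0 n hg hh hu (by simpa using he)
  · refine exists_unit_mul_pow (h := h * t ^ n) ht ht0 0 hg (hh.mul (IsRegularAt.pow n ⟨0, ht.1⟩)) hu ?_
    rw [← mul_assoc, he, mul_assoc, zpow_neg, zpow_natCast, inv_mul_cancel₀ (pow_ne_zero n ht0),
      pow_zero]

/-- The factor `q` is the conjugate of `p` under `T ↦ -T`, and `N` is the norm down to `K[x]`.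
Questions about zeros and orders thus reduce to polynomials in `x`. -/
theorem exists_polyFun_mul {p : Polynomial K[X]} (hp : polyFun E p ≠ 0) :
    ∃ (q : Polynomial K[X]) (N : K[X]), N ≠ 0 ∧
      polyFun E p * polyFun E q = Polynomial.aeval (xFun E) N := by
  obtain ⟨a, b, hab⟩ := Affine.CoordinateRing.exists_smul_basis_eq (Affine.CoordinateRing.mk E.toAffine p)
  have h := Affine.CoordinateRing.coe_norm_smul_basis (W' := E.toAffine) a b
  rw [hab] at h
  have hp' : polyFun E p = polyFun E (Polynomial.C a + Polynomial.C b * Polynomial.X) := by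
    rw [polyFun_apply, polyFun_apply, ← hab, map_add (Affine.CoordinateRing.mk _),
      map_mul (Affine.CoordinateRing.mk _), Affine.CoordinateRing.smul, Affine.CoordinateRing.smul, mul_one]
  refine ⟨Polynomial.C a + Polynomial.C b * (-Polynomial.X - Polynomial.C (Polynomial.C E.a₁ *
    Polynomial.X + Polynomial.C E.a₃)), Algebra.norm K[X] (Affine.CoordinateRing.mk E.toAffine p),
    ?_, ?_⟩
  rotate_left
  · rw [aeval_xFun]
    refine Eq.trans ?_ (congrArg (algebraMap E.toAffine.CoordinateRing (FF E)) h).symm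
    rw [← polyFun_apply, map_mul, ← hp']
  · intro h0
    have h1 : normDeg (Affine.CoordinateRing.mk E.toAffine p) = ⊥ := by
      rw [normDeg, h0, Polynomial.degree_zero]
    rw [← hab, normDeg_basis, max_eq_bot, WithBot.add_eq_bot] at h1
    have ha : a = 0 := by
      rw [← Polynomial.degree_eq_bot]
      have := h1.1
      rw [two_nsmul, WithBot.add_eq_bot, or_self] at this
      exact this
    have hb : b = 0 := by
      rw [← Polynomial.degree_eq_bot]
      have := h1.2.resolve_right (by decide)
      rw [two_nsmul, WithBot.add_eq_bot, or_self] at this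
      exact this
    rw [ha, hb] at hp'
    simp [hp'] at hp

theorem exists_eq_of_evalEval_eq_zero {x y : K} {p : Polynomial K[X]} (h : p.evalEval x y = 0) :
    ∃ a b, p = Polynomial.C (Polynomial.X - Polynomial.C x) * a +
      (Polynomial.X - Polynomial.C (Polynomial.C y)) * b := by
  obtain ⟨b, hb⟩ := Polynomial.X_sub_C_dvd_sub_C_eval (p := p) (a := Polynomial.C y)
  obtain ⟨a, ha⟩ := Polynomial.dvd_iff_isRoot.mpr (show (p.eval (Polynomial.C y)).IsRoot x from h)
  refine ⟨Polynomial.C a, b, ?_⟩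
  rw [← Polynomial.C_mul, ← ha, ← hb]
  ring

theorem polyFun_CX : polyFun E (Polynomial.C Polynomial.X) = xFun E := rfl

theorem polyFun_X : polyFun E Polynomial.X = yFun E := rfl

theorem polyFun_CC (c : K) : polyFun E (Polynomial.C (Polynomial.C c)) = algebraMap K (FF E) c := rfl

/-- The maximal ideal at `T` is generated by `x - x(T)` and `y - y(T)`, so a function vanishing at
`T` is a uniformizer once it divides both. -/
theorem isUniformizerAt_of_coords (hT : T ≠ 0) (ht : HasValue T t 0)
    (hx : ∃ r, IsRegularAt T r ∧ xFun E - algebraMap K _ (xc T) = r * t)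
    (hy : ∃ r, IsRegularAt T r ∧ yFun E - algebraMap K _ (yc T) = r * t) : IsUniformizerAt T t := by
  refine ⟨ht, ?_⟩
  rintro h ⟨n, A, B, hA, hB, hB0, rfl, hv⟩
  obtain ⟨r, hr, hx⟩ := hx
  obtain ⟨s, hs, hy⟩ := hy
  have hA0 : MvPolynomial.eval (coords T) A = 0 := by
    rcases div_eq_zero_iff.mp hv.symm with h | h
    · exact h
    · exact absurd h hB0
  rw [coords_of_ne_zero hT, ← evalEval_dehPoly] at hA0
  obtain ⟨a, b, hab⟩ := exists_eq_of_evalEval_eq_zero hA0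
  have hB' : IsUnitAt T (dehom E B) := by
    rw [dehom_eq]
    refine ⟨_, hasValue_polyFun hT _, ?_⟩
    rwa [coords_of_ne_zero hT, ← evalEval_dehPoly] at hB0
  obtain ⟨w, hw⟩ := ((hr.mul (hasValue_polyFun hT a).isRegularAt).add
    (hs.mul (hasValue_polyFun hT b).isRegularAt)).mul hB'.inv.isRegularAt
  refine ⟨_, w, hw, ?_⟩
  rw [dehom_eq, hab, map_add, map_mul, map_mul, map_sub, map_sub, map_sub, polyFun_CX, polyFun_X,
    polyFun_CC, polyFun_CC, hx, hy, div_eq_mul_inv]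
  ring

/-- The equation of the curve minus its value at `T`. The cofactors take at `T` the values of the
two partial derivatives up to sign, so the one that is a unit decides which coordinate is a
uniformizer. -/
theorem yFun_sub_mul (hT : T ≠ 0) : (yFun E - algebraMap K _ (yc T)) *
    (yFun E + algebraMap K _ (yc T) + algebraMap K _ E.a₁ * xFun E + algebraMap K _ E.a₃) =
    (xFun E - algebraMap K _ (xc T)) * (xFun E ^ 2 + algebraMap K _ (xc T) * xFun E +
      algebraMap K _ (xc T) ^ 2 + algebraMap K _ E.a₂ * (xFun E + algebraMap K _ (xc T)) +
      algebraMap K _ E.a₄ - algebraMap K _ E.a₁ * algebraMap K _ (yc T)) := by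
  have h := congrArg (algebraMap K (FF E)) (equation_xy hT)
  simp only [map_add, map_mul, map_pow] at h
  linear_combination generic_equation (E := E) - h

theorem hasValue_xFun_sub (hT : T ≠ 0) : HasValue T (xFun E - algebraMap K _ (xc T)) 0 := by
  simpa using (hasValue_xFun hT).sub (hasValue_algebraMap T (xc T))

theorem hasValue_yFun_sub (hT : T ≠ 0) : HasValue T (yFun E - algebraMap K _ (yc T)) 0 := by
  simpa using (hasValue_yFun hT).sub (hasValue_algebraMap T (yc T))

theorem xFun_sub_ne_zero (c : K) : xFun E - algebraMap K _ c ≠ 0 :=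
  sub_ne_zero.mpr (xFun_ne_algebraMap E c)

theorem isUniformizerAt_xFun_sub (hT : T ≠ 0) (h2 : psi2 T ≠ 0) :
    IsUniformizerAt T (xFun E - algebraMap K _ (xc T)) := by
  refine isUniformizerAt_of_coords hT (hasValue_xFun_sub hT)
    ⟨1, isUnitAt_one.isRegularAt, by simp⟩ ?_
  have hd : HasValue T (yFun E + algebraMap K _ (yc T) + algebraMap K _ E.a₁ * xFun E +
      algebraMap K _ E.a₃) (psi2 T) := by
    have := (((hasValue_yFun hT).add (hasValue_algebraMap T (yc T))).add
      ((hasValue_algebraMap T E.a₁).mul (hasValue_xFun hT))).add (hasValue_algebraMap T E.a₃)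
    convert this using 1
    rw [psi2]; ring
  have hc := (((((hasValue_xFun hT).pow 2).add ((hasValue_algebraMap T (xc T)).mul (hasValue_xFun hT))).add
    ((hasValue_algebraMap T (xc T)).pow 2)).add ((hasValue_algebraMap T E.a₂).mul
      ((hasValue_xFun hT).add (hasValue_algebraMap T (xc T))))).add (hasValue_algebraMap T E.a₄) |>.sub
      ((hasValue_algebraMap T E.a₁).mul (hasValue_algebraMap T (yc T)))
  refine ⟨_, hc.isRegularAt.mul (hd.isUnitAt h2).inv.isRegularAt, ?_⟩
  have := yFun_sub_mul hT
  rw [mul_right_comm, ← div_eq_mul_inv, eq_div_iff (hd.ne_zero h2), this]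
  ring

/-- At a point of order two, `x - x_T` is a unit times the square of `y - y_T`. -/
theorem xFun_sub_eq_of_psi2_eq_zero (hT : T ≠ 0) (h2 : psi2 T = 0) :
    ∃ u, IsUnitAt T u ∧ xFun E - algebraMap K _ (xc T) = u * (yFun E - algebraMap K _ (yc T)) ^ 2 := by
  have hc := (((((hasValue_xFun hT).pow 2).add ((hasValue_algebraMap T (xc T)).mul (hasValue_xFun hT))).add
    ((hasValue_algebraMap T (xc T)).pow 2)).add ((hasValue_algebraMap T E.a₂).mul
      ((hasValue_xFun hT).add (hasValue_algebraMap T (xc T))))).add (hasValue_algebraMap T E.a₄) |>.sub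
      ((hasValue_algebraMap T E.a₁).mul (hasValue_algebraMap T (yc T)))
  have hc' := hc.sub ((hasValue_algebraMap T E.a₁).mul (hasValue_yFun_sub hT))
  have hu := hc'.isUnitAt (by
    obtain ⟨x, y, h, rfl⟩ := exists_some_of_ne_zero hT
    have := (Affine.nonsingular_iff .. |>.mp h).2
    simp only [psi2, xc_some, yc_some] at h2 ⊢
    rcases this with h | h
    · intro h'; apply h; linear_combination -h'
    · exact absurd (by linear_combination h2) h)
  refine ⟨_, hu.inv, ?_⟩
  rw [eq_comm, inv_mul_eq_iff_eq_mul₀ hu.ne_zero]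
  have := congrArg (algebraMap K (FF E)) h2
  rw [psi2] at this
  simp only [map_add, map_mul, map_zero, map_ofNat] at this
  linear_combination yFun_sub_mul hT - (yFun E - algebraMap K _ (yc T)) * this

theorem isUniformizerAt_yFun_sub (hT : T ≠ 0) (h2 : psi2 T = 0) :
    IsUniformizerAt T (yFun E - algebraMap K _ (yc T)) := by
  obtain ⟨u, hu, h⟩ := xFun_sub_eq_of_psi2_eq_zero hT h2
  exact isUniformizerAt_of_coords hT (hasValue_yFun_sub hT)
    ⟨_, hu.isRegularAt.mul (hasValue_yFun_sub hT).isRegularAt, by rw [h]; ring⟩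
    ⟨1, isUnitAt_one.isRegularAt, by simp⟩

theorem yFun_sub_ne_zero (c : K) : yFun E - algebraMap K _ c ≠ 0 := by
  intro h
  have h1 := normDeg_basis (E := E) (Polynomial.C (-c)) 1
  have h2 : Affine.CoordinateRing.mk E.toAffine (Polynomial.X - Polynomial.C (Polynomial.C c)) = 0 := by
    apply algebraMap_FF_injective E
    rw [← polyFun_apply, map_sub, polyFun_X, polyFun_CC, h, map_zero]
  rw [show Polynomial.C (-c) • (1 : E.toAffine.CoordinateRing) + (1 : K[X]) •
    Affine.CoordinateRing.mk E.toAffine Polynomial.X = 0 by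
      rw [← h2, map_sub, one_smul, Affine.CoordinateRing.smul, mul_one]; simp [sub_eq_neg_add],
    normDeg_zero, eq_comm, max_eq_bot] at h1
  simpa using h1.2

theorem yFun_ne_zero : yFun E ≠ 0 := by simpa using yFun_sub_ne_zero (E := E) 0

theorem xFun_ne_zero : xFun E ≠ 0 := by simpa using xFun_sub_ne_zero (E := E) 0

/-- The equation of the curve at infinity, in the coordinates `x / y` and `1 / y`. -/
theorem exists_inv_yFun_eq : ∃ u : FF E, HasValue 0 u 1 ∧ (yFun E)⁻¹ = u * (xFun E / yFun E) ^ 3 := by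
  set z := xFun E / yFun E with hz
  set w := (yFun E)⁻¹ with hw
  have hz0 : HasValue (0 : E.toAffine.Point) z 0 := hasValue_x_div_y_zero
  have hw0 : HasValue (0 : E.toAffine.Point) w 0 := hasValue_inv_yFun_zero
  have h := fun c => hasValue_algebraMap (0 : E.toAffine.Point) c
  have hd := (((((hasValue_one (0 : E.toAffine.Point)).add ((h E.a₁).mul hz0)).add ((h E.a₃).mul hw0)).sub
    ((h E.a₂).mul (hz0.pow 2))).sub ((h E.a₄).mul (hz0.mul hw0))).sub ((h E.a₆).mul (hw0.pow 2))
  simp only [mul_zero, add_zero, sub_zero, ne_eq, OfNat.ofNat_ne_zero, not_false_eq_true, zero_pow] at hd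
  refine ⟨_, by simpa using hd.inv one_ne_zero, ?_⟩
  rw [eq_comm, inv_mul_eq_iff_eq_mul₀ (hd.ne_zero one_ne_zero)]
  have hy := yFun_ne_zero (E := E)
  rw [hz, hw]
  field_simp
  linear_combination -generic_equation (E := E)

theorem xFun_div_ne_zero : xFun E / yFun E ≠ 0 := div_ne_zero xFun_ne_zero yFun_ne_zero

/-- `x` is a unit times the inverse square of the parameter at infinity. -/
theorem exists_xFun_eq : ∃ u : FF E, HasValue 0 u 1 ∧ xFun E = u * (xFun E / yFun E) ^ (-2 : ℤ) := by
  obtain ⟨u, hu, h⟩ := exists_inv_yFun_eq (E := E)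
  refine ⟨u⁻¹, by simpa using hu.inv one_ne_zero, ?_⟩
  have hx := xFun_ne_zero (E := E)
  have hy := yFun_ne_zero (E := E)
  have hu0 := hu.ne_zero one_ne_zero
  rw [zpow_neg, show (2 : ℤ) = (2 : ℕ) from rfl, zpow_natCast]
  field_simp at h ⊢
  linear_combination -h

theorem hasValue_inv_xFun : HasValue (0 : E.toAffine.Point) (xFun E)⁻¹ 0 := by
  obtain ⟨u, hu, h⟩ := exists_xFun_eq (E := E)
  rw [h, mul_inv, zpow_neg, inv_inv]
  have h2 := hasValue_x_div_y_zero (E := E).pow 2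
  have := (hu.inv one_ne_zero).mul h2
  simpa using this

/-- The quotient is the reversed polynomial at `1/x`, and the constant term of that polynomial is
the leading coefficient of `p`. -/
theorem hasValue_aeval_div_pow (p : K[X]) : HasValue (0 : E.toAffine.Point)
    (Polynomial.aeval (xFun E) p / xFun E ^ p.natDegree) p.leadingCoeff := by
  have hx := xFun_ne_zero (E := E)
  let _ := invertibleOfNonzero hx
  have h := Polynomial.eval₂_reverse_mul_pow (algebraMap K (FF E)) (xFun E) p
  have h2 := hasValue_inv_xFun (E := E).aeval p.reverse
  rw [← Polynomial.coeff_zero_eq_eval_zero, Polynomial.coeff_zero_reverse] at h2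
  convert h2 using 1
  rw [div_eq_iff (pow_ne_zero _ hx), Polynomial.aeval_def, Polynomial.aeval_def, ← h, invOf_eq_inv]

theorem _root_.MvPolynomial.IsHomogeneous.aeval_smul {σ R S : Type*} [Fintype σ] [CommSemiring R]
    [CommSemiring S] [Algebra R S] {n : ℕ} {A : MvPolynomial σ R} (hA : A.IsHomogeneous n) (c : S)
    (x : σ → S) : MvPolynomial.aeval (c • x) A = c ^ n * MvPolynomial.aeval x A := by
  rw [MvPolynomial.aeval_def, MvPolynomial.aeval_def, MvPolynomial.eval₂_eq', MvPolynomial.eval₂_eq',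
    Finset.mul_sum]
  refine Finset.sum_congr rfl fun d hd => ?_
  have hdeg := hA (MvPolynomial.mem_support_iff.mp hd)
  rw [Finsupp.weight_apply, Finsupp.sum_fintype _ _ (by simp)] at hdeg
  simp only [Pi.smul_apply, smul_eq_mul, mul_pow, Finset.prod_mul_distrib, Finset.prod_pow_eq_pow_sum,
    Pi.one_apply, mul_one] at hdeg ⊢
  rw [hdeg]
  ring

/-- Forms of degree `n` divided by `y ^ n` are polynomials in `x / y` and `1 / y`. -/
theorem dehom_eq_pow_mul {n : ℕ} {A : MvPolynomial (Fin 3) K} (hA : A.IsHomogeneous n) :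
    dehom E A = yFun E ^ n * MvPolynomial.aeval ![xFun E / yFun E, 1, (yFun E)⁻¹] A := by
  rw [dehom, ← hA.aeval_smul]
  congr 2
  have hy := yFun_ne_zero (E := E)
  ext i
  fin_cases i <;> simp <;> field_simp

theorem exists_aeval_infinity (A : MvPolynomial (Fin 3) K) : ∃ r : FF E, IsRegularAt 0 r ∧
    MvPolynomial.aeval ![xFun E / yFun E, 1, (yFun E)⁻¹] A =
      algebraMap K _ (MvPolynomial.eval ![0, 1, 0] A) + r * (xFun E / yFun E) := by
  set z := xFun E / yFun E with hz
  obtain ⟨u, hu, hw⟩ := exists_inv_yFun_eq (E := E)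
  rw [← hz] at hw
  have hz0 : IsRegularAt (0 : E.toAffine.Point) z := hasValue_x_div_y_zero.isRegularAt
  induction A using MvPolynomial.induction_on with
  | C a => exact ⟨0, (hasValue_zero _).isRegularAt, by simp⟩
  | add p q hp hq =>
    obtain ⟨r, hr, hp⟩ := hp
    obtain ⟨s, hs, hq⟩ := hq
    exact ⟨r + s, hr.add hs, by rw [map_add, hp, hq, map_add, map_add]; ring⟩
  | mul_X p i hp =>
    obtain ⟨r, hr, hp⟩ := hp
    have hreg := (isRegularAt_algebraMap (E := E) (T := 0) (MvPolynomial.eval ![0, 1, 0] p)).add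
      (hr.mul hz0)
    rw [map_mul, hp, MvPolynomial.aeval_X, map_mul, MvPolynomial.eval_X]
    fin_cases i
    · exact ⟨_, hreg, by simp⟩
    · exact ⟨_, hr, by simp⟩
    · exact ⟨_, hreg.mul (hu.isRegularAt.mul (hz0.pow 2)), by simp [hw]; ring⟩

theorem isUniformizerAt_zero : IsUniformizerAt (0 : E.toAffine.Point) (xFun E / yFun E) := by
  refine ⟨hasValue_x_div_y_zero, ?_⟩
  rintro h ⟨n, A, B, hA, hB, hB0, rfl, hv⟩
  have hA0 : MvPolynomial.eval ![0, 1, 0] A = 0 := by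
    rcases div_eq_zero_iff.mp hv.symm with h | h
    · exact h
    · exact absurd h hB0
  obtain ⟨r, hr, hrA⟩ := exists_aeval_infinity (E := E) A
  obtain ⟨s, ⟨w, hs⟩, hsB⟩ := exists_aeval_infinity (E := E) B
  have hu := (hasValue_algebraMap (0 : E.toAffine.Point) (MvPolynomial.eval ![0, 1, 0] B)).add
    (hs.mul hasValue_x_div_y_zero)
  rw [mul_zero, add_zero, ← hsB] at hu
  obtain ⟨w, hw⟩ := hr.mul (hu.isUnitAt hB0).inv.isRegularAt
  refine ⟨_, w, hw, ?_⟩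
  rw [dehom_eq_pow_mul hA, dehom_eq_pow_mul hB, mul_div_mul_left _ _ (pow_ne_zero _ yFun_ne_zero),
    hrA, hA0, map_zero, div_eq_mul_inv]
  ring

theorem exists_polyFun_mul_pow_regular (p : Polynomial K[X]) :
    ∃ m : ℕ, IsRegularAt (0 : E.toAffine.Point) (polyFun E p * (yFun E)⁻¹ ^ m) := by
  have hw : IsRegularAt (0 : E.toAffine.Point) (yFun E)⁻¹ := hasValue_inv_yFun_zero.isRegularAt
  have key : ∀ {f g : FF E}, (∃ m : ℕ, IsRegularAt (0 : E.toAffine.Point) (f * (yFun E)⁻¹ ^ m)) →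
      (∃ m : ℕ, IsRegularAt (0 : E.toAffine.Point) (g * (yFun E)⁻¹ ^ m)) →
      ∃ m : ℕ, IsRegularAt (0 : E.toAffine.Point) ((f + g) * (yFun E)⁻¹ ^ m) := by
    rintro f g ⟨m, hm⟩ ⟨n, hn⟩
    refine ⟨m + n, ?_⟩
    have := (hm.mul (hw.pow n)).add (hn.mul (hw.pow m))
    convert this using 1
    ring
  have key2 : ∀ (a n : ℕ) (c : K), ∃ m : ℕ, IsRegularAt (0 : E.toAffine.Point)
      (algebraMap K _ c * xFun E ^ a * yFun E ^ n * (yFun E)⁻¹ ^ m) := by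
    intro a n c
    refine ⟨a + n, ?_⟩
    have := (isRegularAt_algebraMap (T := (0 : E.toAffine.Point)) c).mul
      (hasValue_x_div_y_zero.isRegularAt.pow a)
    convert this using 1
    have hy := yFun_ne_zero (E := E)
    rw [div_eq_mul_inv, mul_pow, pow_add]
    have : yFun E ^ n * (yFun E)⁻¹ ^ n = 1 := by rw [← mul_pow, mul_inv_cancel₀ hy, one_pow]
    linear_combination algebraMap K _ c * xFun E ^ a * (yFun E)⁻¹ ^ a * this
  induction p using Polynomial.induction_on' with
  | add p q hp hq => rw [map_add]; exact key hp hq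
  | monomial n a =>
    induction a using Polynomial.induction_on' with
    | add p q hp hq => rw [map_add, map_add]; exact key hp hq
    | monomial k c =>
      rw [← Polynomial.C_mul_X_pow_eq_monomial, ← Polynomial.C_mul_X_pow_eq_monomial, Polynomial.C_mul,
        Polynomial.C_pow, map_mul, map_mul, map_pow, map_pow, polyFun_CC, polyFun_CX, polyFun_X]
      exact key2 k n c

/-- A parameter at `T`: a uniformizer that gives every function an order. -/
theorem exists_parameter (T : E.toAffine.Point) : ∃ t : FF E, IsUniformizerAt T t ∧ t ≠ 0 ∧
    ∀ g : FF E, g ≠ 0 → ∃ (n : ℤ) (u : FF E), IsUnitAt T u ∧ g = u * t ^ n := by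
  have quot : ∀ t : FF E, t ≠ 0 → (∀ p : Polynomial K[X], polyFun E p ≠ 0 → ∃ (n : ℤ) (u : FF E), IsUnitAt T u ∧
      polyFun E p = u * t ^ n) →
      ∀ g : FF E, g ≠ 0 → ∃ (n : ℤ) (u : FF E), IsUnitAt T u ∧ g = u * t ^ n := by
    intro t ht H g hg
    obtain ⟨a, b, hb, rfl⟩ := IsFractionRing.div_surjective (A := E.toAffine.CoordinateRing) g
    obtain ⟨p, rfl⟩ := Ideal.Quotient.mk_surjective a
    obtain ⟨q, rfl⟩ := Ideal.Quotient.mk_surjective b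
    change polyFun E p / polyFun E q ≠ 0 at hg
    change ∃ (n : ℤ) (u : FF E), IsUnitAt T u ∧ polyFun E p / polyFun E q = u * t ^ n
    obtain ⟨hp, hq⟩ := div_ne_zero_iff.mp hg
    obtain ⟨n, u, hu, hn⟩ := H p hp
    obtain ⟨n', u', hu', hn'⟩ := H q hq
    refine ⟨n - n', _, hu.mul hu'.inv, ?_⟩
    have := hu'.ne_zero
    have h2 := zpow_ne_zero n' ht
    rw [hn, hn', zpow_sub₀ ht]
    field_simp
  by_cases hT : T = 0
  · subst hT
    have hz := isUniformizerAt_zero (E := E)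
    have hz0 := xFun_div_ne_zero (E := E)
    refine ⟨_, hz, hz0, quot _ hz0 fun p hp => ?_⟩
    -- The product with the conjugate is a polynomial in `x`, whose order at infinity is known.
    -- Powers of `1/y` make both factors regular there, so that `exists_unit_mul_zpow` applies.
    obtain ⟨q, N, hN, hpq⟩ := exists_polyFun_mul hp
    obtain ⟨a, ha⟩ := exists_polyFun_mul_pow_regular (E := E) p
    obtain ⟨b, hb⟩ := exists_polyFun_mul_pow_regular (E := E) q
    have hNu := (hasValue_aeval_div_pow (E := E) N).isUnitAt (Polynomial.leadingCoeff_ne_zero.mpr hN)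
    obtain ⟨u, hu, hux⟩ := exists_xFun_eq (E := E)
    obtain ⟨w, hw, hwy⟩ := exists_inv_yFun_eq (E := E)
    have hu := hu.isUnitAt one_ne_zero
    have hw := hw.isUnitAt one_ne_zero
    set z := xFun E / yFun E with hzdef
    have e1 : polyFun E p * (yFun E)⁻¹ ^ a * (polyFun E q * (yFun E)⁻¹ ^ b) =
        (Polynomial.aeval (xFun E) N / xFun E ^ N.natDegree * u ^ (N.natDegree : ℤ) *
          w ^ ((a + b : ℕ) : ℤ)) * z ^ (3 * ((a + b : ℕ) : ℤ) - 2 * N.natDegree) := by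
      have hx := xFun_ne_zero (E := E)
      calc _ = polyFun E p * polyFun E q * (yFun E)⁻¹ ^ (a + b) := by ring
        _ = Polynomial.aeval (xFun E) N / xFun E ^ N.natDegree * xFun E ^ N.natDegree *
              (yFun E)⁻¹ ^ (a + b) := by rw [hpq, div_mul_cancel₀ _ (pow_ne_zero _ hx)]
        _ = Polynomial.aeval (xFun E) N / xFun E ^ N.natDegree * (u * z ^ (-2 : ℤ)) ^ N.natDegree *
              (w * z ^ 3) ^ (a + b) := by rw [← hwy, ← hux]
        _ = _ := by
          rw [mul_pow, mul_pow, ← zpow_natCast (z ^ (-2 : ℤ)), ← zpow_mul, ← pow_mul,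
            ← zpow_natCast z (3 * (a + b)), zpow_natCast u, zpow_natCast w, zpow_sub₀ hz0, neg_mul,
            zpow_neg]
          push_cast
          ring
    obtain ⟨m, u', hu', he⟩ := exists_unit_mul_zpow hz hz0 _ ha hb
      ((hNu.mul (hu.zpow _)).mul (hw.zpow _)) e1
    refine ⟨m - 3 * a, _, hu'.mul (hw.zpow (-(a : ℤ))), ?_⟩
    have hw0 := hw.ne_zero
    rw [hwy, mul_pow, ← pow_mul] at he
    rw [zpow_sub₀ hz0, zpow_neg, zpow_natCast, zpow_natCast,
      show (3 * (a : ℤ)) = ((3 * a : ℕ) : ℤ) by push_cast; rfl, zpow_natCast]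
    field_simp
    linear_combination he
  · have main : ∀ t : FF E, IsUniformizerAt T t → t ≠ 0 → (∃ (j : ℕ) (u : FF E), IsUnitAt T u ∧
        xFun E - algebraMap K _ (xc T) = u * t ^ j) → ∃ t : FF E, IsUniformizerAt T t ∧ t ≠ 0 ∧
        ∀ g : FF E, g ≠ 0 → ∃ (n : ℤ) (u : FF E), IsUnitAt T u ∧ g = u * t ^ n := by
      rintro t ht ht0 ⟨j, u, hu, hj⟩
      refine ⟨t, ht, ht0, quot t ht0 fun p hp => ?_⟩
      obtain ⟨q, N, hN, hpq⟩ := exists_polyFun_mul hp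
      obtain ⟨M, hM, hnd⟩ := Polynomial.exists_eq_pow_rootMultiplicity_mul_and_not_dvd N hN (xc T)
      have hMu := ((hasValue_xFun hT).aeval M).isUnitAt
        (fun h => hnd (Polynomial.dvd_iff_isRoot.mpr h))
      obtain ⟨m, u', hu', he⟩ := exists_unit_mul_zpow ht ht0 ((j * N.rootMultiplicity (xc T) : ℕ) : ℤ)
        (hasValue_polyFun hT p).isRegularAt (hasValue_polyFun hT q).isRegularAt
        ((hu.zpow (N.rootMultiplicity (xc T) : ℕ)).mul hMu) (by
          rw [hpq]
          conv_lhs => rw [hM]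
          rw [map_mul, map_pow, map_sub, Polynomial.aeval_X, Polynomial.aeval_C, hj, zpow_natCast,
            zpow_natCast, mul_pow, pow_mul]
          ring)
      exact ⟨m, u', hu', by simpa using he⟩
    by_cases h2 : psi2 T = 0
    · obtain ⟨u, hu, h⟩ := xFun_sub_eq_of_psi2_eq_zero hT h2
      exact main _ (isUniformizerAt_yFun_sub hT h2) (yFun_sub_ne_zero _) ⟨2, u, hu, h⟩
    · exact main _ (isUniformizerAt_xFun_sub hT h2) (xFun_sub_ne_zero _) ⟨1, 1, isUnitAt_one, by simp⟩

end Order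

/-! ### The order of vanishing as a valuation, and functions regular on the affine curve -/

section Ord

variable {K : Type*} [Field K] {E : WeierstrassCurve K} {T : E.toAffine.Point} {f g t : FF E}
  {v w : K} {m n : ℤ}

theorem HasValue.eq_zero_of_mul_eq_one {r : FF E} (hr : IsRegularAt T r) (ht : HasValue T t 0) :
    r * t ≠ 1 := by
  obtain ⟨w, hw⟩ := hr
  intro h
  have h1 := hw.mul ht
  rw [h, mul_zero] at h1
  exact one_ne_zero ((hasValue_one T).unique h1)

theorem IsUniformizerAt.ne_zero (ht : IsUniformizerAt T t) : t ≠ 0 := by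
  rintro rfl
  obtain ⟨s, hs, hs0, -⟩ := exists_parameter T
  obtain ⟨r, w, -, h⟩ := ht.2 s hs.1
  exact hs0 (by simpa using h)

theorem IsUniformizerAt.exists_unit_mul (ht : IsUniformizerAt T t) {s : FF E}
    (hs : IsUniformizerAt T s) : ∃ u, IsUnitAt T u ∧ s = u * t := by
  obtain ⟨r, w, hr, h⟩ := ht.2 s hs.1
  refine ⟨r, ⟨w, hr, ?_⟩, h⟩
  rintro rfl
  obtain ⟨r', w', hr', h'⟩ := hs.2 t ht.1
  refine HasValue.eq_zero_of_mul_eq_one ⟨w', hr'⟩ hr (mul_right_cancel₀ ht.ne_zero ?_)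
  rw [mul_assoc, ← h, ← h', one_mul]

theorem hasOrder_iff (ht : IsUniformizerAt T t) :
    HasOrder T g n ↔ ∃ u, IsUnitAt T u ∧ g = u * t ^ n := by
  constructor
  · rintro ⟨s, u, v, hs, hu, hv, rfl⟩
    obtain ⟨r, hr, rfl⟩ := ht.exists_unit_mul hs
    exact ⟨_, (hu.isUnitAt hv).mul (hr.zpow n), by rw [mul_zpow, mul_assoc]⟩
  · rintro ⟨u, ⟨v, hu, hv⟩, h⟩
    exact ⟨t, u, v, ht, hu, hv, h⟩

theorem exists_uniformizer (T : E.toAffine.Point) : ∃ t : FF E, IsUniformizerAt T t :=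
  let ⟨t, ht, _⟩ := exists_parameter T
  ⟨t, ht⟩

theorem exists_hasOrder (T : E.toAffine.Point) (hg : g ≠ 0) : ∃ n, HasOrder T g n := by
  obtain ⟨t, ht, -, h⟩ := exists_parameter T
  obtain ⟨n, h⟩ := h g hg
  exact ⟨n, (hasOrder_iff ht).mpr h⟩

theorem HasOrder.ne_zero (h : HasOrder T g n) : g ≠ 0 := by
  obtain ⟨t, u, v, ht, hu, hv, rfl⟩ := h
  exact mul_ne_zero (hu.ne_zero hv) (zpow_ne_zero n ht.ne_zero)

theorem HasOrder.mul (hf : HasOrder T f m) (hg : HasOrder T g n) : HasOrder T (f * g) (m + n) := by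
  obtain ⟨t, ht⟩ := exists_uniformizer T
  rw [hasOrder_iff ht] at *
  obtain ⟨u, hu, rfl⟩ := hf
  obtain ⟨u', hu', rfl⟩ := hg
  exact ⟨_, hu.mul hu', by rw [zpow_add₀ ht.ne_zero]; ring⟩

theorem HasOrder.inv (hf : HasOrder T f m) : HasOrder T f⁻¹ (-m) := by
  obtain ⟨t, ht⟩ := exists_uniformizer T
  rw [hasOrder_iff ht] at *
  obtain ⟨u, hu, rfl⟩ := hf
  exact ⟨_, hu.inv, by rw [mul_inv, zpow_neg]⟩

theorem HasOrder.div (hf : HasOrder T f m) (hg : HasOrder T g n) : HasOrder T (f / g) (m - n) := by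
  rw [div_eq_mul_inv, sub_eq_add_neg]; exact hf.mul hg.inv

theorem HasOrder.isUnitAt (h : HasOrder T g 0) : IsUnitAt T g := by
  obtain ⟨t, u, v, ht, hu, hv, rfl⟩ := h
  exact ⟨v, by simpa using hu, hv⟩

theorem IsUnitAt.hasOrder (h : IsUnitAt T g) : HasOrder T g 0 := by
  obtain ⟨t, ht⟩ := exists_uniformizer T
  exact (hasOrder_iff ht).mpr ⟨g, h, by simp⟩

theorem HasOrder.isRegularAt (h : HasOrder T g n) (hn : 0 ≤ n) : IsRegularAt T g := by
  obtain ⟨t, u, v, ht, hu, hv, rfl⟩ := h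
  lift n to ℕ using hn
  rw [zpow_natCast]
  exact hu.isRegularAt.mul (ht.1.isRegularAt.pow n)

theorem HasOrder.hasValue_zero (h : HasOrder T g n) (hn : 0 < n) : HasValue T g 0 := by
  obtain ⟨t, u, v, ht, hu, hv, rfl⟩ := h
  lift n to ℕ using hn.le
  rw [zpow_natCast]
  have := hu.mul (ht.1.pow n)
  rwa [zero_pow (by omega), mul_zero] at this

theorem HasOrder.nonneg (h : HasOrder T g n) (hg : IsRegularAt T g) : 0 ≤ n := by
  by_contra! hn
  refine HasValue.eq_zero_of_mul_eq_one hg (h.inv.hasValue_zero (by omega)) ?_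
  exact mul_inv_cancel₀ h.ne_zero

theorem HasOrder.unique (h : HasOrder T g m) (h' : HasOrder T g n) : m = n := by
  have key : ∀ {m n : ℤ}, HasOrder T g m → HasOrder T g n → 0 ≤ m - n := by
    intro m n h h'
    have := h.div h'
    rw [div_self h.ne_zero] at this
    exact this.nonneg isUnitAt_one.isRegularAt
  have := key h h'
  have := key h' h
  omega

theorem IsUniformizerAt.hasOrder (ht : IsUniformizerAt T t) : HasOrder T t 1 :=
  (hasOrder_iff ht).mpr ⟨1, isUnitAt_one, by simp⟩

open Classical in
/-- The order of vanishing of a function at a point (`0` for the zero function). -/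
def ord (T : E.toAffine.Point) (g : FF E) : ℤ :=
  if h : g ≠ 0 then (exists_hasOrder T h).choose else 0

theorem hasOrder_ord (T : E.toAffine.Point) (hg : g ≠ 0) : HasOrder T g (ord T g) := by
  rw [ord, dif_pos hg]
  exact (exists_hasOrder T hg).choose_spec

theorem HasOrder.ord_eq (h : HasOrder T g n) : ord T g = n := (hasOrder_ord T h.ne_zero).unique h

theorem hasOrder_iff_ord : HasOrder T g n ↔ g ≠ 0 ∧ ord T g = n :=
  ⟨fun h => ⟨h.ne_zero, h.ord_eq⟩, fun ⟨h, h'⟩ => h' ▸ hasOrder_ord T h⟩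

theorem ord_mul (T : E.toAffine.Point) (hf : f ≠ 0) (hg : g ≠ 0) : ord T (f * g) = ord T f + ord T g :=
  ((hasOrder_ord T hf).mul (hasOrder_ord T hg)).ord_eq

@[simp] theorem ord_zero_fun : ord T (0 : FF E) = 0 := by rw [ord, dif_neg (by simp)]

@[simp] theorem ord_inv : ord T f⁻¹ = -ord T f := by
  by_cases hf : f = 0
  · simp [hf]
  · exact (hasOrder_ord T hf).inv.ord_eq

theorem ord_div (T : E.toAffine.Point) (hf : f ≠ 0) (hg : g ≠ 0) : ord T (f / g) = ord T f - ord T g :=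
  ((hasOrder_ord T hf).div (hasOrder_ord T hg)).ord_eq

theorem IsUnitAt.ord_eq (h : IsUnitAt T g) : ord T g = 0 := h.hasOrder.ord_eq

@[simp] theorem ord_one : ord T (1 : FF E) = 0 := isUnitAt_one.ord_eq

@[simp] theorem ord_algebraMap (c : K) : ord T (algebraMap K (FF E) c) = 0 := by
  by_cases hc : c = 0
  · simp [hc]
  · exact (isUnitAt_algebraMap hc).ord_eq

@[simp] theorem ord_pow (k : ℕ) : ord T (f ^ k) = k * ord T f := by
  by_cases hf : f = 0
  · subst hf
    by_cases hk : k = 0 <;> simp [hk]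
  induction k with
  | zero => simp
  | succ k ih => rw [pow_succ, ord_mul T (pow_ne_zero k hf) hf, ih]; push_cast; ring

@[simp] theorem ord_zpow (k : ℤ) : ord T (f ^ k) = k * ord T f := by
  obtain ⟨j, rfl | rfl⟩ := k.eq_nat_or_neg <;> simp

theorem ord_prod {ι : Type*} (s : Finset ι) {f : ι → FF E} (h : ∀ i ∈ s, f i ≠ 0) :
    ord T (∏ i ∈ s, f i) = ∑ i ∈ s, ord T (f i) := by
  classical
  induction s using Finset.induction_on with
  | empty => simp
  | insert a s ha ih =>
    rw [Finset.prod_insert ha, Finset.sum_insert ha, ord_mul T (h a (by simp))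
      (Finset.prod_ne_zero_iff.mpr fun i hi => h i (by simp [hi])), ih fun i hi => h i (by simp [hi])]

theorem isRegularAt_iff (hg : g ≠ 0) : IsRegularAt T g ↔ 0 ≤ ord T g :=
  ⟨(hasOrder_ord T hg).nonneg, (hasOrder_ord T hg).isRegularAt⟩

theorem hasValue_zero_iff (hg : g ≠ 0) : HasValue T g 0 ↔ 0 < ord T g := by
  refine ⟨fun h => ?_, (hasOrder_ord T hg).hasValue_zero⟩
  refine lt_of_le_of_ne ((isRegularAt_iff hg).mp h.isRegularAt) fun h0 => ?_
  have := hasOrder_ord T hg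
  rw [← h0] at this
  obtain ⟨v, hv, hv0⟩ := this.isUnitAt
  exact hv0 (hv.unique h)

theorem ord_add_of_lt (hf : f ≠ 0) (hg : g ≠ 0) (h : ord T f < ord T g) :
    f + g ≠ 0 ∧ ord T (f + g) = ord T f := by
  have h1 : HasValue T (1 + g / f) 1 := by
    have := (hasValue_one T).add ((hasValue_zero_iff (T := T) (div_ne_zero hg hf)).mpr
      (by rw [ord_div T hg hf]; omega))
    rwa [add_zero] at this
  have h2 : f + g = f * (1 + g / f) := by field_simp
  have h3 := h1.isUnitAt one_ne_zero
  rw [h2, ord_mul T hf h3.ne_zero, h3.ord_eq, add_zero]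
  exact ⟨mul_ne_zero hf h3.ne_zero, rfl⟩

theorem min_le_ord_add (hf : f ≠ 0) (hg : g ≠ 0) (hfg : f + g ≠ 0) :
    min (ord T f) (ord T g) ≤ ord T (f + g) := by
  wlog h : ord T f ≤ ord T g generalizing f g
  · have := this hg hf (by rwa [add_comm]) (by omega)
    rwa [min_comm, add_comm]
  have h1 : IsRegularAt T (1 + g / f) := isUnitAt_one.isRegularAt.add
    ((isRegularAt_iff (div_ne_zero hg hf)).mpr (by rw [ord_div T hg hf]; omega))
  have h2 : f + g = f * (1 + g / f) := by field_simp
  rw [h2] at hfg ⊢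
  have h3 := right_ne_zero_of_mul hfg
  rw [ord_mul T hf h3, min_eq_left h]
  have := (isRegularAt_iff h3).mp h1
  omega

theorem le_ord_sum {ι : Type*} (s : Finset ι) {f : ι → FF E} {n : ℤ}
    (h : ∀ i ∈ s, f i ≠ 0 → n ≤ ord T (f i)) (h0 : ∑ i ∈ s, f i ≠ 0) :
    n ≤ ord T (∑ i ∈ s, f i) := by
  classical
  induction s using Finset.induction_on with
  | empty => simp at h0
  | insert a s ha ih =>
    rw [Finset.sum_insert ha] at h0 ⊢
    have ih := ih fun i hi => h i (by simp [hi])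
    by_cases h1 : f a = 0
    · rw [h1, zero_add] at h0 ⊢; exact ih h0
    have h1' := h a (by simp) h1
    by_cases h2 : ∑ i ∈ s, f i = 0
    · rwa [h2, add_zero]
    · exact (le_min h1' (ih h2)).trans (min_le_ord_add h1 h2 h0)

theorem HasValue.ord_eq (h : HasValue T g v) (hv : v ≠ 0) : ord T g = 0 := (h.isUnitAt hv).ord_eq

/-! ### Orders of the coordinate functions -/

theorem ord_zero_parameter : ord (0 : E.toAffine.Point) (xFun E / yFun E) = 1 :=
  isUniformizerAt_zero.hasOrder.ord_eq

theorem ord_zero_xFun : ord (0 : E.toAffine.Point) (xFun E) = -2 := by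
  obtain ⟨u, hu, h⟩ := exists_xFun_eq (E := E)
  have hu := hu.isUnitAt one_ne_zero
  rw [h, ord_mul _ hu.ne_zero (zpow_ne_zero _ xFun_div_ne_zero), hu.ord_eq, ord_zpow,
    ord_zero_parameter]
  norm_num

theorem ord_zero_yFun : ord (0 : E.toAffine.Point) (yFun E) = -3 := by
  have h := ord_div (0 : E.toAffine.Point) (xFun_ne_zero (E := E)) yFun_ne_zero
  rw [ord_zero_parameter, ord_zero_xFun] at h
  omega

theorem aeval_xFun_ne_zero {p : K[X]} (hp : p ≠ 0) : Polynomial.aeval (xFun E) p ≠ 0 :=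
  fun h => hp (aeval_xFun_eq_zero E h)

theorem ord_zero_aeval {p : K[X]} (hp : p ≠ 0) :
    ord (0 : E.toAffine.Point) (Polynomial.aeval (xFun E) p) = -2 * p.natDegree := by
  have h := (hasValue_aeval_div_pow (E := E) p).ord_eq (Polynomial.leadingCoeff_ne_zero.mpr hp)
  rw [ord_div _ (aeval_xFun_ne_zero hp) (pow_ne_zero _ xFun_ne_zero), ord_pow, ord_zero_xFun] at h
  linarith

theorem ord_xFun_sub_self (hT : T ≠ 0) [Decidable (psi2 T = 0)] :
    ord T (xFun E - algebraMap K _ (xc T)) = if psi2 T = 0 then 2 else 1 := by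
  split_ifs with h
  · obtain ⟨u, hu, he⟩ := xFun_sub_eq_of_psi2_eq_zero hT h
    rw [he, ord_mul _ hu.ne_zero (pow_ne_zero _ (yFun_sub_ne_zero _)), hu.ord_eq, ord_pow,
      (isUniformizerAt_yFun_sub hT h).hasOrder.ord_eq]
    norm_num
  · exact (isUniformizerAt_xFun_sub hT h).hasOrder.ord_eq

theorem ord_xFun_sub_of_ne (hT : T ≠ 0) {c : K} (hc : xc T ≠ c) :
    ord T (xFun E - algebraMap K _ c) = 0 :=
  ((hasValue_xFun hT).sub (hasValue_algebraMap T c)).ord_eq (sub_ne_zero.mpr hc)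

theorem ord_zero_xFun_sub (c : K) : ord (0 : E.toAffine.Point) (xFun E - algebraMap K _ c) = -2 := by
  have := ord_zero_aeval (E := E) (Polynomial.X_sub_C_ne_zero c)
  simpa using this

/-- The order of a polynomial in `x` at an affine point. -/
theorem ord_aeval (hT : T ≠ 0) {p : K[X]} (hp : p ≠ 0) : ord T (Polynomial.aeval (xFun E) p) =
    p.rootMultiplicity (xc T) * ord T (xFun E - algebraMap K _ (xc T)) := by
  obtain ⟨M, hM, hnd⟩ := Polynomial.exists_eq_pow_rootMultiplicity_mul_and_not_dvd p hp (xc T)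
  have hMu := ((hasValue_xFun hT).aeval M).isUnitAt (fun h => hnd (Polynomial.dvd_iff_isRoot.mpr h))
  conv_lhs => rw [hM]
  rw [map_mul, map_pow, map_sub, Polynomial.aeval_X, Polynomial.aeval_C,
    ord_mul _ (pow_ne_zero _ (xFun_sub_ne_zero _)) hMu.ne_zero, hMu.ord_eq, ord_pow, add_zero]

theorem exists_xc_eq [E.IsElliptic] [IsAlgClosed K] (x : K) : ∃ T : E.toAffine.Point, T ≠ 0 ∧ xc T = x := by
  obtain ⟨y, hy⟩ := IsAlgClosed.exists_root (Polynomial.X ^ 2 +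
    Polynomial.C (E.a₁ * x + E.a₃) * Polynomial.X -
    Polynomial.C (x ^ 3 + E.a₂ * x ^ 2 + E.a₄ * x + E.a₆)) (by
      rw [show Polynomial.degree _ = 2 by compute_degree!]; decide)
  simp only [Polynomial.IsRoot, Polynomial.eval_sub, Polynomial.eval_add, Polynomial.eval_mul,
    Polynomial.eval_pow, Polynomial.eval_X, Polynomial.eval_C] at hy
  refine ⟨.some x y (Affine.equation_iff_nonsingular.mp ?_), Affine.Point.some_ne_zero _, rfl⟩
  rw [Affine.equation_iff]
  linear_combination hy

theorem exists_eq_aeval_add (g : FF E) : ∃ p q N : K[X], N ≠ 0 ∧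
    g * Polynomial.aeval (xFun E) N = Polynomial.aeval (xFun E) p + Polynomial.aeval (xFun E) q * yFun E := by
  obtain ⟨a, b, hb, rfl⟩ := IsFractionRing.div_surjective (A := E.toAffine.CoordinateRing) g
  obtain ⟨r, rfl⟩ := Ideal.Quotient.mk_surjective a
  obtain ⟨s, rfl⟩ := Ideal.Quotient.mk_surjective b
  have hs : polyFun E s ≠ 0 := by
    rw [polyFun_apply, ne_eq, map_eq_zero_iff _ (algebraMap_FF_injective E)]
    exact nonZeroDivisors.ne_zero hb
  obtain ⟨s', N, hN, h⟩ := exists_polyFun_mul hs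
  obtain ⟨p, q, hpq⟩ := Affine.CoordinateRing.exists_smul_basis_eq
    (Affine.CoordinateRing.mk E.toAffine (r * s'))
  refine ⟨p, q, N, hN, ?_⟩
  change polyFun E r / polyFun E s * _ = _
  rw [← h, div_mul_eq_mul_div, mul_left_comm, mul_div_cancel_left₀ _ hs, ← map_mul (polyFun E),
    polyFun_apply, ← hpq, map_add, Affine.CoordinateRing.smul, Affine.CoordinateRing.smul, mul_one,
    map_mul, aeval_xFun, aeval_xFun]
  rfl

theorem point_neg_ne_zero (hT : T ≠ 0) : -T ≠ 0 := by
  obtain ⟨x, y, h, rfl⟩ := exists_some_of_ne_zero hT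
  rw [Affine.Point.neg_some]
  exact Affine.Point.some_ne_zero _

/-- The right side vanishes at both points `T` and `-T` above `x`. If they differ, two linear
conditions with distinct ordinates kill both coefficients. -/
theorem eval_eq_zero_of_mul_eq [E.IsElliptic] [IsAlgClosed K] (h : ∀ T ≠ 0, IsRegularAt T g)
    {p q : K[X]} {x : K} (he : g * (xFun E - algebraMap K _ x) = Polynomial.aeval (xFun E) p +
      Polynomial.aeval (xFun E) q * yFun E) : p.eval x = 0 ∧ q.eval x = 0 := by
  obtain ⟨T, hT, rfl⟩ := exists_xc_eq (E := E) x
  have hval : ∀ S : E.toAffine.Point, S ≠ 0 → xc S = xc T → p.eval (xc T) + q.eval (xc T) * yc S = 0 := by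
    intro S hS hST
    obtain ⟨v, hv⟩ := h S hS
    have h1 := hv.mul (hasValue_xFun_sub hS)
    rw [hST, he, mul_zero] at h1
    have h2 := ((hasValue_xFun hS).aeval p).add (((hasValue_xFun hS).aeval q).mul (hasValue_yFun hS))
    rw [hST] at h2
    exact h2.unique h1
  have h1 := hval T hT rfl
  have h2 := hval (-T) (point_neg_ne_zero hT) (xc_neg T)
  rw [yc_neg hT] at h2
  have hq : q.eval (xc T) = 0 := by
    by_cases hpsi : psi2 T = 0
    -- At a point of order two, `x - x(T)` is divisible by `(y - y(T))²`. After dividing the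
    -- equation by `y - y(T)`, evaluation at `T` leaves `q(x(T)) = 0`.
    · obtain ⟨u, hu, hut⟩ := xFun_sub_eq_of_psi2_eq_zero hT hpsi
      obtain ⟨p', hp'⟩ := Polynomial.X_sub_C_dvd_sub_C_eval (p := p) (a := xc T)
      obtain ⟨q', hq'⟩ := Polynomial.X_sub_C_dvd_sub_C_eval (p := q) (a := xc T)
      rw [sub_eq_iff_eq_add] at hp' hq'
      obtain ⟨v, hv⟩ := h T hT
      have hr := (hv.sub (((hasValue_xFun hT).aeval p').add
        (((hasValue_xFun hT).aeval q').mul (hasValue_yFun hT)))).mul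
        (hu.isRegularAt.choose_spec.mul (hasValue_yFun_sub hT))
      rw [mul_zero, mul_zero] at hr
      refine ((hasValue_algebraMap T _).unique (?_ : HasValue T _ (0 : K)))
      convert hr using 1
      apply mul_right_cancel₀ (yFun_sub_ne_zero (E := E) (yc T))
      rw [hp', hq'] at he
      simp only [map_add, map_mul, map_sub, Polynomial.aeval_X, Polynomial.aeval_C] at he
      have h1' := congrArg (algebraMap K (FF E)) h1
      simp only [map_add, map_mul, map_zero] at h1'
      rw [hut] at he
      linear_combination -he - h1'
    · have : q.eval (xc T) * psi2 T = 0 := by rw [psi2]; linear_combination h1 - h2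
      exact (mul_eq_zero.mp this).resolve_right hpsi
  rw [hq, zero_mul, add_zero] at h1
  exact ⟨h1, hq⟩

/-- A function that is regular on the affine curve is a polynomial in `x` and `y`. -/
theorem exists_eq_of_regular [E.IsElliptic] [IsAlgClosed K] (h : ∀ T ≠ 0, IsRegularAt T g) :
    ∃ p q : K[X], g = Polynomial.aeval (xFun E) p + Polynomial.aeval (xFun E) q * yFun E := by
  obtain ⟨p, q, N, hN, he⟩ := exists_eq_aeval_add g
  induction hd : N.natDegree generalizing p q N with
  | zero =>
    obtain ⟨c, rfl⟩ := Polynomial.natDegree_eq_zero.mp hd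
    have hc : c ≠ 0 := by rintro rfl; exact hN (map_zero _)
    have hc' : algebraMap K (FF E) c ≠ 0 := by simpa using hc
    refine ⟨Polynomial.C c⁻¹ * p, Polynomial.C c⁻¹ * q, ?_⟩
    rw [Polynomial.aeval_C] at he
    rw [map_mul, map_mul, Polynomial.aeval_C, map_inv₀, mul_assoc, ← mul_add, ← he]
    field_simp
  | succ d ih =>
    obtain ⟨x, hx⟩ := IsAlgClosed.exists_root N (fun h0 => by
      have := Polynomial.natDegree_eq_zero_iff_degree_le_zero.mpr h0.le; omega)
    obtain ⟨M, rfl⟩ := Polynomial.dvd_iff_isRoot.mpr hx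
    have hM : M ≠ 0 := right_ne_zero_of_mul hN
    rw [map_mul, map_sub, Polynomial.aeval_X, Polynomial.aeval_C] at he
    obtain ⟨hp, hq⟩ := eval_eq_zero_of_mul_eq (g := g * Polynomial.aeval (xFun E) M)
      (fun T hT => (h T hT).mul ((hasValue_xFun hT).aeval M).isRegularAt) (x := x) (p := p) (q := q)
      (by rw [← he]; ring)
    obtain ⟨p', rfl⟩ := Polynomial.dvd_iff_isRoot.mpr hp
    obtain ⟨q', rfl⟩ := Polynomial.dvd_iff_isRoot.mpr hq
    refine ih p' q' M hM ?_ ?_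
    · apply mul_left_cancel₀ (xFun_sub_ne_zero (E := E) x)
      simp only [map_mul, map_sub, Polynomial.aeval_X, Polynomial.aeval_C] at he
      linear_combination he
    · rw [Polynomial.natDegree_mul (Polynomial.X_sub_C_ne_zero x) hM,
        Polynomial.natDegree_X_sub_C] at hd
      omega

/-- A function that is regular on the affine curve and has at most a simple pole at infinity is
constant. -/
theorem exists_eq_algebraMap_of_regular [E.IsElliptic] [IsAlgClosed K] (h : ∀ T ≠ 0, IsRegularAt T g)
    (h0 : -1 ≤ ord 0 g) : ∃ c, g = algebraMap K _ c := by
  obtain ⟨p, q, rfl⟩ := exists_eq_of_regular h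
  by_cases hq : q = 0
  · subst hq
    by_cases hp : p = 0
    · subst hp; exact ⟨0, by simp⟩
    simp only [map_zero, zero_mul, add_zero] at h0 ⊢
    rw [ord_zero_aeval hp] at h0
    rw [Polynomial.eq_C_of_natDegree_eq_zero (p := p) (by omega), Polynomial.aeval_C]
    exact ⟨_, rfl⟩
  have hq' := mul_ne_zero (aeval_xFun_ne_zero (E := E) hq) yFun_ne_zero
  have hoq := ord_mul (0 : E.toAffine.Point) (aeval_xFun_ne_zero (E := E) hq) yFun_ne_zero
  rw [ord_zero_aeval hq, ord_zero_yFun] at hoq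
  exfalso
  by_cases hp : p = 0
  · subst hp
    rw [map_zero, zero_add, hoq] at h0
    omega
  have hp' := aeval_xFun_ne_zero (E := E) hp
  have hop := ord_zero_aeval (E := E) hp
  -- The two orders at infinity have different parity, so there is no cancellation; a summand
  -- containing `y` gives a pole of order at least three.
  rcases lt_or_gt_of_ne (show ord (0 : E.toAffine.Point) (Polynomial.aeval (xFun E) p) ≠
    ord 0 (Polynomial.aeval (xFun E) q * yFun E) by omega) with hlt | hlt
  · rw [(ord_add_of_lt hp' hq' hlt).2] at h0
    omega
  · rw [add_comm, (ord_add_of_lt hq' hp' hlt).2] at h0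
    omega

end Ord

/-! ## Lines -/

section Chord

variable {K : Type*} [Field K] [DecidableEq K] {E : WeierstrassCurve K} {A B T S : E.toAffine.Point}

theorem psi2_eq_zero_iff (hT : T ≠ 0) : psi2 T = 0 ↔ T = -T := by
  rw [← two_nsmul_eq_zero_iff hT, two_nsmul, add_eq_zero_iff_eq_neg]

theorem ord_xFun_sub (hT : T ≠ 0) (hS : S ≠ 0) : ord T (xFun E - algebraMap K _ (xc S)) =
    (if T = S then 1 else 0) + (if T = -S then 1 else 0) := by
  by_cases h : xc T = xc S
  · rw [← h, ord_xFun_sub_self hT]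
    rcases (xc_eq_iff hT hS).mp h with rfl | rfl
    · simp only [psi2_eq_zero_iff hT, if_true]
      split_ifs <;> rfl
    · simp only [psi2_eq_zero_iff hT, neg_neg, if_true, eq_comm (a := -S)]
      split_ifs <;> rfl
  · rw [ord_xFun_sub_of_ne hT h, if_neg, if_neg, add_zero]
    · rintro rfl; exact h (xc_neg S)
    · rintro rfl; exact h rfl

/-- The slope of the line through `A` and `B`. -/
def chordSlope (A B : E.toAffine.Point) : K := E.toAffine.slope (xc A) (xc B) (yc A) (yc B)

/-- The value at `T` of the equation of the line through `A` and `B`. -/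
def lineVal (A B T : E.toAffine.Point) : K := yc T - (chordSlope A B * (xc T - xc A) + yc A)

/-- The equation of the line through `A` and `B`. -/
def lineFun (A B : E.toAffine.Point) : FF E :=
  yFun E - (algebraMap K _ (chordSlope A B) * (xFun E - algebraMap K _ (xc A)) + algebraMap K _ (yc A))

/-- The equation of the reflection of the line through `A` and `B`. -/
def lineFunNeg (A B : E.toAffine.Point) : FF E :=
  yFun E + (algebraMap K _ (chordSlope A B) * (xFun E - algebraMap K _ (xc A)) + algebraMap K _ (yc A))
    + algebraMap K _ E.a₁ * xFun E + algebraMap K _ E.a₃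

theorem not_neg_of_add_ne_zero (hA : A ≠ 0) (hB : B ≠ 0) (hAB : A + B ≠ 0) :
    ¬(xc A = xc B ∧ yc A = E.toAffine.negY (xc B) (yc B)) := by
  rintro ⟨h1, h2⟩
  apply hAB
  rw [add_eq_zero_iff_eq_neg]
  refine point_ext hA (neg_ne_zero.mpr hB) (by rw [h1, xc_neg]) ?_
  rw [h2, yc_neg hB]; rfl

theorem add_eq_some (hA : A ≠ 0) (hB : B ≠ 0) (hAB : A + B ≠ 0) :
    xc (A + B) = E.toAffine.addX (xc A) (xc B) (chordSlope A B) ∧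
    yc (A + B) = E.toAffine.addY (xc A) (xc B) (yc A) (chordSlope A B) := by
  have h := not_neg_of_add_ne_zero hA hB hAB
  obtain ⟨x, y, hn, rfl⟩ := exists_some_of_ne_zero hA
  obtain ⟨x', y', hn', rfl⟩ := exists_some_of_ne_zero hB
  simp only [xc_some, yc_some] at h
  rw [Affine.Point.add_some h]
  exact ⟨rfl, rfl⟩

/-- The product is the norm of the line, a cubic in `x` whose roots are the abscissae of the three
points of intersection. -/
theorem lineFun_mul (hA : A ≠ 0) (hB : B ≠ 0) (hAB : A + B ≠ 0) : lineFun A B * lineFunNeg A B =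
    (xFun E - algebraMap K _ (xc A)) * (xFun E - algebraMap K _ (xc B)) *
      (xFun E - algebraMap K _ (xc (A + B))) := by
  have h := Affine.CoordinateRing.C_addPolynomial_slope (equation_coords hA) (equation_coords hB)
    (not_neg_of_add_ne_zero hA hB hAB)
  rw [Affine.CoordinateRing.C_addPolynomial] at h
  have h := congrArg (algebraMap E.toAffine.CoordinateRing (FF E)) h
  rw [(add_eq_some hA hB hAB).1]
  simp only [Affine.CoordinateRing.XClass, ← polyFun_apply, map_mul, map_neg] at h
  simp only [Affine.linePolynomial, Affine.negPolynomial, map_sub, map_add, map_mul, map_neg,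
    polyFun_CX, polyFun_X, polyFun_CC] at h
  rw [lineFun, lineFunNeg, chordSlope]
  linear_combination -h

theorem lineVal_left : lineVal A B A = 0 := by simp [lineVal]

theorem lineVal_right (hA : A ≠ 0) (hB : B ≠ 0) (hAB : A + B ≠ 0) : lineVal A B B = 0 := by
  by_cases h : xc A = xc B
  · rcases (xc_eq_iff hA hB).mp h with rfl | rfl
    · exact lineVal_left
    · exact absurd (neg_add_cancel B) hAB
  · rw [lineVal, chordSlope, Affine.slope_of_X_ne h]
    have := sub_ne_zero.mpr h
    field_simp
    ring

theorem lineVal_third (hA : A ≠ 0) (hB : B ≠ 0) (hAB : A + B ≠ 0) : lineVal A B (-(A + B)) = 0 := by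
  rw [lineVal, yc_neg hAB, xc_neg, (add_eq_some hA hB hAB).1, (add_eq_some hA hB hAB).2,
    Affine.addY, Affine.negAddY, Affine.negY]
  ring

theorem hasValue_lineFun (hT : T ≠ 0) : HasValue T (lineFun A B) (lineVal A B T) :=
  (hasValue_yFun hT).sub (((hasValue_algebraMap T _).mul ((hasValue_xFun hT).sub
    (hasValue_algebraMap T _))).add (hasValue_algebraMap T _))

theorem hasValue_lineFunNeg (hT : T ≠ 0) : HasValue T (lineFunNeg A B) (-lineVal A B (-T)) := by
  convert (((hasValue_yFun hT).add (((hasValue_algebraMap T _).mul ((hasValue_xFun hT).sub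
    (hasValue_algebraMap T _))).add (hasValue_algebraMap T _))).add
    ((hasValue_algebraMap T E.a₁).mul (hasValue_xFun hT))).add (hasValue_algebraMap T E.a₃) using 1
  · rfl
  · rw [lineVal, xc_neg, yc_neg hT]; ring

theorem lineVal_eq_zero (hA : A ≠ 0) (hB : B ≠ 0) (hAB : A + B ≠ 0) (hT : T ≠ 0) :
    lineVal A B T = 0 ↔ T = A ∨ T = B ∨ T = -(A + B) := by
  constructor
  · intro h
    have h1 := (hasValue_lineFun (A := A) (B := B) hT).mul (hasValue_lineFunNeg (A := A) (B := B) hT)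
    rw [lineFun_mul hA hB hAB, h, zero_mul] at h1
    have h2 := (((hasValue_xFun hT).sub (hasValue_algebraMap T (xc A))).mul
      ((hasValue_xFun hT).sub (hasValue_algebraMap T (xc B)))).mul
      ((hasValue_xFun hT).sub (hasValue_algebraMap T (xc (A + B))))
    have h3 := h2.unique h1
    have key : ∀ S : E.toAffine.Point, S ≠ 0 → lineVal A B S = 0 → xc T = xc S → T = S := by
      intro S hS h0 hx
      refine point_ext hT hS hx ?_
      rw [lineVal] at h h0
      rw [hx] at h
      linear_combination h - h0
    rcases mul_eq_zero.mp h3 with h3 | h3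
    · rcases mul_eq_zero.mp h3 with h3 | h3
      · exact Or.inl (key A hA lineVal_left (sub_eq_zero.mp h3))
      · exact Or.inr (Or.inl (key B hB (lineVal_right hA hB hAB) (sub_eq_zero.mp h3)))
    · exact Or.inr (Or.inr (key _ (neg_ne_zero.mpr hAB) (lineVal_third hA hB hAB)
        (by rw [sub_eq_zero.mp h3, xc_neg])))
  · rintro (rfl | rfl | rfl)
    · exact lineVal_left
    · exact lineVal_right hA hB hAB
    · exact lineVal_third hA hB hAB

theorem lineFun_ne_zero (hA : A ≠ 0) (hB : B ≠ 0) (hAB : A + B ≠ 0) : lineFun A B ≠ 0 := by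
  intro h
  have := lineFun_mul hA hB hAB
  rw [h, zero_mul] at this
  exact mul_ne_zero (mul_ne_zero (xFun_sub_ne_zero _) (xFun_sub_ne_zero _)) (xFun_sub_ne_zero _) this.symm

theorem lineFunNeg_ne_zero (hA : A ≠ 0) (hB : B ≠ 0) (hAB : A + B ≠ 0) : lineFunNeg A B ≠ 0 := by
  intro h
  have := lineFun_mul hA hB hAB
  rw [h, mul_zero] at this
  exact mul_ne_zero (mul_ne_zero (xFun_sub_ne_zero _) (xFun_sub_ne_zero _)) (xFun_sub_ne_zero _) this.symm

theorem ord_line_of_psi2 (hT : T ≠ 0) (h : psi2 T = 0) (c : K) :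
    ord T (yFun E - algebraMap K _ (yc T) + algebraMap K _ c * (xFun E - algebraMap K _ (xc T))) = 1 := by
  have h1 := (isUniformizerAt_yFun_sub hT h).hasOrder.ord_eq
  by_cases hc : c = 0
  · simpa [hc] using h1
  have hc' : algebraMap K (FF E) c ≠ 0 := by simpa using hc
  rw [(ord_add_of_lt (yFun_sub_ne_zero _) (mul_ne_zero hc' (xFun_sub_ne_zero _)) ?_).2, h1]
  rw [ord_mul _ hc' (xFun_sub_ne_zero _), ord_algebraMap, ord_xFun_sub_self hT, if_pos h, h1]
  norm_num

/-- If `-T` is not on the line, the reflected line is a unit at `T` and the whole order of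
`lineFun_mul` belongs to the line. If both `T` and `-T` are on the line, which is not vertical, then
`T = -T`; here `y - y(T)` is a uniformizer and the line has order one. -/
theorem ord_lineFun (hA : A ≠ 0) (hB : B ≠ 0) (hAB : A + B ≠ 0) (hT : T ≠ 0) : ord T (lineFun A B) =
    (if T = A then 1 else 0) + (if T = B then 1 else 0) + (if T = -(A + B) then 1 else 0) := by
  have h1 := hasValue_lineFun (A := A) (B := B) hT
  have h2 := hasValue_lineFunNeg (A := A) (B := B) hT
  have hz := lineVal_eq_zero hA hB hAB hT
  have hz' := lineVal_eq_zero hA hB hAB (neg_ne_zero.mpr hT)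
  have hsum := congrArg (ord T) (lineFun_mul hA hB hAB)
  rw [ord_mul _ (lineFun_ne_zero hA hB hAB) (lineFunNeg_ne_zero hA hB hAB), ord_mul _
    (mul_ne_zero (xFun_sub_ne_zero _) (xFun_sub_ne_zero _)) (xFun_sub_ne_zero _), ord_mul _
    (xFun_sub_ne_zero _) (xFun_sub_ne_zero _), ord_xFun_sub hT hA, ord_xFun_sub hT hB,
    ord_xFun_sub hT hAB] at hsum
  by_cases h : lineVal A B T = 0
  swap
  · have h' := mt hz.mpr h
    push Not at h'
    rw [h1.ord_eq h, if_neg h'.1, if_neg h'.2.1, if_neg h'.2.2]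
    rfl
  by_cases hn : lineVal A B (-T) = 0
  swap
  · have h' := mt hz'.mpr hn
    push Not at h'
    rw [h2.ord_eq (neg_ne_zero.mpr hn), if_neg (c := T = -A) (fun hh => h'.1 (by rw [hh, neg_neg])),
      if_neg (c := T = -B) (fun hh => h'.2.1 (by rw [hh, neg_neg])),
      if_neg (c := T = A + B) (fun hh => h'.2.2 (by rw [hh]))] at hsum
    linarith
  have hTT : T = -T := by
    refine point_ext hT (neg_ne_zero.mpr hT) (xc_neg T).symm ?_
    rw [lineVal] at h hn
    rw [xc_neg] at hn
    linear_combination h - hn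
  have hp := (psi2_eq_zero_iff hT).mpr hTT
  have o1 : ord T (lineFun A B) = 1 := by
    rw [← ord_line_of_psi2 hT hp (-chordSlope A B), lineFun]
    congr 1
    have := congrArg (algebraMap K (FF E)) h
    simp only [lineVal, map_sub, map_add, map_mul, map_zero] at this
    rw [map_neg]
    linear_combination this
  have o2 : ord T (lineFunNeg A B) = 1 := by
    rw [← ord_line_of_psi2 hT hp (chordSlope A B + E.a₁), lineFunNeg]
    congr 1
    have := congrArg (algebraMap K (FF E)) hn
    simp only [lineVal, yc_neg hT, xc_neg, map_sub, map_add, map_mul, map_neg, map_zero] at this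
    rw [map_add]
    linear_combination -this
  have e1 : ∀ S : E.toAffine.Point, T = -S ↔ T = S := fun S => by
    rw [eq_neg_iff_add_eq_zero, add_comm, ← eq_neg_iff_add_eq_zero, ← hTT, eq_comm]
  simp only [e1] at hsum ⊢
  linarith

/-- The function with divisor `A + B - (A + B) - O`. -/
def chordFun (A B : E.toAffine.Point) : FF E := lineFun A B / (xFun E - algebraMap K _ (xc (A + B)))

theorem hasValue_lineFun_infinity : HasValue 0 (lineFun A B / yFun E) 1 := by
  have hw := hasValue_inv_yFun_zero (E := E)
  have h := (hasValue_one (0 : E.toAffine.Point)).sub (((hasValue_algebraMap 0 (chordSlope A B)).mul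
    ((hasValue_x_div_y_zero (E := E)).sub ((hasValue_algebraMap 0 (xc A)).mul hw))).add
    ((hasValue_algebraMap 0 (yc A)).mul hw))
  simp only [mul_zero, sub_zero, add_zero] at h
  convert h using 1
  have := yFun_ne_zero (E := E)
  rw [lineFun]
  field_simp

theorem hasValue_xFun_sub_infinity (c : K) :
    HasValue (0 : E.toAffine.Point) ((xFun E - algebraMap K _ c) / xFun E) 1 := by
  have h := hasValue_aeval_div_pow (E := E) (Polynomial.X - Polynomial.C c)
  rwa [map_sub, Polynomial.aeval_X, Polynomial.aeval_C, Polynomial.natDegree_X_sub_C, pow_one,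
    (Polynomial.monic_X_sub_C c).leadingCoeff] at h

theorem hasValue_chordFun_infinity : HasValue 0 (chordFun A B * (xFun E / yFun E)) 1 := by
  have h := (hasValue_lineFun_infinity (A := A) (B := B)).mul
    ((hasValue_xFun_sub_infinity (E := E) (xc (A + B))).inv one_ne_zero)
  rw [inv_one, one_mul] at h
  convert h using 1
  rw [chordFun]
  have := xFun_sub_ne_zero (E := E) (xc (A + B))
  field_simp

theorem chordFun_ne_zero (hA : A ≠ 0) (hB : B ≠ 0) (hAB : A + B ≠ 0) : chordFun A B ≠ 0 :=
  div_ne_zero (lineFun_ne_zero hA hB hAB) (xFun_sub_ne_zero _)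

theorem ord_chordFun (hA : A ≠ 0) (hB : B ≠ 0) (hAB : A + B ≠ 0) (T : E.toAffine.Point) :
    ord T (chordFun A B) = (if T = A then 1 else 0) + (if T = B then 1 else 0)
      - (if T = A + B then 1 else 0) - (if T = 0 then 1 else 0) := by
  by_cases hT : T = 0
  · subst hT
    have h := hasValue_chordFun_infinity.ord_eq (one_ne_zero (α := K)) (g := chordFun A B * (xFun E / yFun E))
    rw [ord_mul _ (chordFun_ne_zero hA hB hAB) xFun_div_ne_zero, ord_zero_parameter] at h
    rw [if_neg hA.symm, if_neg hB.symm, if_neg hAB.symm, if_pos rfl]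
    linarith
  · rw [chordFun, ord_div _ (lineFun_ne_zero hA hB hAB) (xFun_sub_ne_zero _), ord_lineFun hA hB hAB hT,
      ord_xFun_sub hT hAB, if_neg hT]
    ring

/-- This form displays the zero at `A`; its denominator has the value `psi2 A` there, so leading
coefficients can be read off. -/
theorem chordFun_eq (hA : A ≠ 0) (hB : B ≠ 0) (hAB : A + B ≠ 0) : chordFun A B =
    (xFun E - algebraMap K _ (xc A)) * (xFun E - algebraMap K _ (xc B)) / lineFunNeg A B := by
  rw [chordFun, div_eq_div_iff (xFun_sub_ne_zero _) (lineFunNeg_ne_zero hA hB hAB), lineFun_mul hA hB hAB]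

theorem hasValue_lineFunNeg_left (hA : A ≠ 0) : HasValue A (lineFunNeg A B) (psi2 A) := by
  convert hasValue_lineFunNeg (A := A) (B := B) hA using 1
  rw [lineVal, xc_neg, yc_neg hA, psi2]; ring

theorem hasValue_chordFun_left (hA : A ≠ 0) (hB : B ≠ 0) (hAB : A + B ≠ 0) (h2 : psi2 A ≠ 0) :
    HasValue A (chordFun A B / (xFun E - algebraMap K _ (xc A))) ((xc A - xc B) / psi2 A) := by
  convert ((hasValue_xFun hA).sub (hasValue_algebraMap A (xc B))).div
    (hasValue_lineFunNeg_left (B := B) hA) h2 using 1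
  rw [chordFun_eq hA hB hAB]
  have h := xFun_sub_ne_zero (E := E) (xc A)
  have h' := lineFunNeg_ne_zero hA hB hAB
  field_simp

theorem hasValue_chordFun_self (hA : A ≠ 0) (hAA : A + A ≠ 0) (h2 : psi2 A ≠ 0) :
    HasValue A (chordFun A A / (xFun E - algebraMap K _ (xc A)) ^ 2) (psi2 A)⁻¹ := by
  convert (hasValue_lineFunNeg_left (B := A) hA).inv h2 using 1
  rw [chordFun_eq hA hA hAA]
  have h := xFun_sub_ne_zero (E := E) (xc A)
  have h' := lineFunNeg_ne_zero hA hA hAA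
  field_simp

end Chord

/-! ## Points over the function field and their reductions -/

section Reduction

open scoped Classical

variable {K : Type*} [Field K] [DecidableEq K] {E : WeierstrassCurve K}

variable (E) in
/-- The group of points over the function field. -/
abbrev FP := (E⁄(FF E)).toAffine.Point

variable (E) in
/-- The inclusion of the constant points. -/
def constPoint : E.toAffine.Point →+ FP E :=
  Affine.Point.map (W' := E) (F := K) (K := FF E) (Algebra.ofId K (FF E))

/-- The action of an endomorphism of the function field on points. -/
def mapPoint (φ : FF E →ₐ[K] FF E) : FP E →+ FP E :=
  Affine.Point.map (W' := E) (F := FF E) (K := FF E) φ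

theorem constPoint_injective : Function.Injective (constPoint E) :=
  Affine.Point.map_injective (W' := E) (F := K) (K := FF E) (f := Algebra.ofId K (FF E))

theorem constPoint_ne_zero {S : E.toAffine.Point} (hS : S ≠ 0) : constPoint E S ≠ 0 := by
  rw [ne_eq, ← map_zero (constPoint E)]
  exact fun h => hS (constPoint_injective h)

theorem xc_constPoint (S : E.toAffine.Point) : xc (constPoint E S) = algebraMap K _ (xc S) := by
  cases S
  · exact (map_zero _).symm
  · rfl

theorem yc_constPoint (S : E.toAffine.Point) : yc (constPoint E S) = algebraMap K _ (yc S) := by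
  cases S
  · exact (map_zero _).symm
  · rfl

theorem xc_mapPoint (φ : FF E →ₐ[K] FF E) (A : FP E) : xc (mapPoint φ A) = φ (xc A) := by
  cases A
  · exact (map_zero φ).symm
  · rfl

theorem yc_mapPoint (φ : FF E →ₐ[K] FF E) (A : FP E) : yc (mapPoint φ A) = φ (yc A) := by
  cases A
  · exact (map_zero φ).symm
  · rfl

theorem mapPoint_ne_zero (φ : FF E →ₐ[K] FF E) {A : FP E} (hA : A ≠ 0) : mapPoint φ A ≠ 0 := by
  rw [ne_eq, ← map_zero (mapPoint φ)]
  exact fun h => hA (Affine.Point.map_injective (W' := E) (F := FF E) (K := FF E) (f := φ) h)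

theorem mapPoint_constPoint (φ : FF E →ₐ[K] FF E) (S : E.toAffine.Point) :
    mapPoint φ (constPoint E S) = constPoint E S := by
  by_cases hS : S = 0
  · rw [hS, map_zero, map_zero]
  refine point_ext (mapPoint_ne_zero φ (constPoint_ne_zero hS)) (constPoint_ne_zero hS) ?_ ?_
  · rw [xc_mapPoint, xc_constPoint, AlgHom.commutes]
  · rw [yc_mapPoint, yc_constPoint, AlgHom.commutes]

theorem fp_equation {A : FP E} (hA : A ≠ 0) : yc A ^ 2 + algebraMap K _ E.a₁ * xc A * yc A +
    algebraMap K _ E.a₃ * yc A = xc A ^ 3 + algebraMap K _ E.a₂ * xc A ^ 2 +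
    algebraMap K _ E.a₄ * xc A + algebraMap K (FF E) E.a₆ := equation_xy hA

theorem eval₂_polynomial {A : FP E} (hA : A ≠ 0) : E.toAffine.polynomial.eval₂
    (Polynomial.aeval (xc A) : K[X] →ₐ[K] FF E).toRingHom (yc A) = 0 := by
  simp only [Affine.polynomial, Polynomial.eval₂_sub, Polynomial.eval₂_add, Polynomial.eval₂_mul,
    Polynomial.eval₂_pow, Polynomial.eval₂_X, Polynomial.eval₂_C, AlgHom.toRingHom_eq_coe,
    RingHom.coe_coe, map_add, map_mul, map_pow, Polynomial.aeval_X, Polynomial.aeval_C]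
  linear_combination fp_equation hA

/-- Evaluation of regular functions at a point over the function field. -/
def pullRing {A : FP E} (hA : A ≠ 0) : E.toAffine.CoordinateRing →ₐ[K] FF E where
  toRingHom := AdjoinRoot.lift (Polynomial.aeval (xc A) : K[X] →ₐ[K] FF E).toRingHom (yc A)
    (eval₂_polynomial hA)
  commutes' _ := (AdjoinRoot.lift_of (eval₂_polynomial hA)).trans (Polynomial.aeval_C _ _)

theorem pullRing_mk {A : FP E} (hA : A ≠ 0) (p : Polynomial K[X]) :
    pullRing hA (Affine.CoordinateRing.mk E.toAffine p) =
      p.eval₂ (Polynomial.aeval (xc A) : K[X] →ₐ[K] FF E).toRingHom (yc A) :=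
  AdjoinRoot.lift_mk (eval₂_polynomial hA) _

/-- The point `A` has nonconstant abscissa. -/
def IsMoving (A : FP E) : Prop := A ≠ 0 ∧ ∀ c, xc A ≠ algebraMap K (FF E) c

variable [IsAlgClosed K]

/-- If a nonzero regular function vanished at `A`, its norm would be a nonzero polynomial with root
`x(A)`, so `x(A)` would be algebraic over `K` and hence constant. -/
theorem pullRing_injective {A : FP E} (hA : IsMoving A) : Function.Injective (pullRing hA.1) := by
  rw [injective_iff_map_eq_zero]
  intro a ha
  obtain ⟨p, rfl⟩ := Ideal.Quotient.mk_surjective a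
  change pullRing hA.1 (Affine.CoordinateRing.mk E.toAffine p) = 0 at ha
  change Affine.CoordinateRing.mk E.toAffine p = 0
  by_contra hp
  have hp' : polyFun E p ≠ 0 := by
    rwa [polyFun_apply, ne_eq, map_eq_zero_iff _ (algebraMap_FF_injective E)]
  obtain ⟨q, N, hN, h⟩ := exists_polyFun_mul hp'
  rw [polyFun_apply, polyFun_apply, ← map_mul, aeval_xFun] at h
  have h := congrArg (pullRing hA.1) (algebraMap_FF_injective E h)
  rw [map_mul, ha, zero_mul, pullRing_mk, Polynomial.eval₂_C] at h
  obtain ⟨c, hc⟩ := mem_range_of_isAlgebraic (K := K) (x := xc A) ⟨N, hN, h.symm⟩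
  exact hA.2 c hc.symm

/-- The endomorphism of the function field that sends the generic point to `A`. -/
def pull {A : FP E} (hA : IsMoving A) : FF E →ₐ[K] FF E :=
  IsFractionRing.liftAlgHom (g := pullRing hA.1) (pullRing_injective hA)

theorem pull_algebraMap {A : FP E} (hA : IsMoving A) (a : E.toAffine.CoordinateRing) :
    pull hA (algebraMap E.toAffine.CoordinateRing (FF E) a) = pullRing hA.1 a :=
  IsFractionRing.lift_algebraMap (g := (pullRing hA.1 : E.toAffine.CoordinateRing →+* FF E))
    (pullRing_injective hA) a

theorem pull_xFun {A : FP E} (hA : IsMoving A) : pull hA (xFun E) = xc A := by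
  rw [xFun, pull_algebraMap, pullRing_mk]; simp

theorem pull_yFun {A : FP E} (hA : IsMoving A) : pull hA (yFun E) = yc A := by
  rw [yFun, pull_algebraMap, pullRing_mk]; simp

theorem pull_dehom {A : FP E} (hA : IsMoving A) (P : MvPolynomial (Fin 3) K) :
    pull hA (dehom E P) = MvPolynomial.aeval ![xc A, yc A, 1] P := by
  have : (pull hA).comp (MvPolynomial.aeval ![xFun E, yFun E, 1]) =
      MvPolynomial.aeval ![xc A, yc A, 1] := by
    refine MvPolynomial.algHom_ext fun i => ?_
    fin_cases i <;> simp [pull_xFun, pull_yFun]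
  exact congrArg (fun f : MvPolynomial (Fin 3) K →ₐ[K] FF E => f P) this

theorem algHom_ext_FF {G : Type*} [Field G] [Algebra K G] {φ ψ : FF E →ₐ[K] G} (hx : φ (xFun E) = ψ (xFun E))
    (hy : φ (yFun E) = ψ (yFun E)) : φ = ψ := by
  refine AlgHom.ext fun g => ?_
  obtain ⟨a, b, hb, rfl⟩ := IsFractionRing.div_surjective (A := E.toAffine.CoordinateRing) g
  obtain ⟨r, rfl⟩ := Ideal.Quotient.mk_surjective a
  obtain ⟨s, rfl⟩ := Ideal.Quotient.mk_surjective b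
  have key : ∀ p, φ (polyFun E p) = ψ (polyFun E p) := by
    intro p
    induction p using Polynomial.induction_on' with
    | add p q hp hq => rw [map_add, map_add, map_add, hp, hq]
    | monomial n a =>
      rw [← Polynomial.C_mul_X_pow_eq_monomial, map_mul, map_pow, polyFun_X, map_mul, map_pow,
        map_mul, map_pow, hy, polyFun_apply, ← aeval_xFun, ← Polynomial.aeval_algHom_apply,
        ← Polynomial.aeval_algHom_apply, hx]
  change φ (polyFun E r / polyFun E s) = ψ (polyFun E r / polyFun E s)
  rw [map_div₀, map_div₀, key, key]

variable [E.IsElliptic]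

theorem mapPoint_pull_genericPoint {A : FP E} (hA : IsMoving A) :
    mapPoint (pull hA) (genericPoint E) = A := by
  refine point_ext (mapPoint_ne_zero _ (genericPoint_ne_zero E)) hA.1 ?_ ?_
  · rw [xc_mapPoint, xc_genericPoint, pull_xFun]
  · rw [yc_mapPoint, yc_genericPoint, pull_yFun]

/-- The point `A` over the function field reduces to `S` at `T`. -/
def RedTo (T S : E.toAffine.Point) (A : FP E) : Prop :=
  (S ≠ 0 → A ≠ 0 ∧ HasValue T (xc A) (xc S) ∧ HasValue T (yc A) (yc S)) ∧
  (S = 0 → A ≠ 0 → yc A ≠ 0 ∧ HasValue T (xc A / yc A) 0 ∧ HasValue T (yc A)⁻¹ 0)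

variable {T S S' : E.toAffine.Point} {A B : FP E}

theorem RedTo.unique (h : RedTo T S A) (h' : RedTo T S' A) : S = S' := by
  have key : ∀ {S S' : E.toAffine.Point}, RedTo T S A → RedTo T S' A → S = 0 → S' ≠ 0 → False := by
    intro S S' h h' h0 h0'
    obtain ⟨hA, -, hy⟩ := h'.1 h0'
    obtain ⟨hy0, -, hy'⟩ := h.2 h0 hA
    exact HasValue.eq_zero_of_mul_eq_one hy.isRegularAt hy' (mul_inv_cancel₀ hy0)
  by_cases h0 : S = 0
  · by_cases h0' : S' = 0
    · rw [h0, h0']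
    · exact (key h h' h0 h0').elim
  · by_cases h0' : S' = 0
    · exact (key h' h h0' h0).elim
    · exact point_ext h0 h0' ((h.1 h0).2.1.unique (h'.1 h0').2.1) ((h.1 h0).2.2.unique (h'.1 h0').2.2)

/-- The valuative criterion of properness: if `x(A)` is regular at `T`, the equation makes `y(A)`
regular; if `x(A)` has a pole, so has `y(A)/x(A)`, and `A` reduces to infinity. -/
theorem exists_redTo (T : E.toAffine.Point) (A : FP E) : ∃ S, RedTo T S A := by
  by_cases hA : A = 0
  · exact ⟨0, fun h => absurd rfl h, fun _ h => absurd hA h⟩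
  have he := fp_equation hA
  set x := xc A
  set y := yc A
  have c := fun r => hasValue_algebraMap (E := E) T r
  by_cases hx : IsRegularAt T x
  · obtain ⟨x₀, hx⟩ := hx
    have hR := (((hx.pow 3).add ((c E.a₂).mul (hx.pow 2))).add ((c E.a₄).mul hx)).add (c E.a₆)
    by_cases hy : IsRegularAt T y
    · obtain ⟨y₀, hy⟩ := hy
      have hL := ((hy.pow 2).add (((c E.a₁).mul hx).mul hy)).add ((c E.a₃).mul hy)
      rw [he] at hL
      have heq : E.toAffine.Equation x₀ y₀ := (Affine.equation_iff ..).mpr (hL.unique hR)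
      refine ⟨.some x₀ y₀ (Affine.equation_iff_nonsingular.mp heq), fun _ => ⟨hA, hx, hy⟩,
        fun h => absurd h (Affine.Point.some_ne_zero _)⟩
    · exfalso
      have hy0 : y ≠ 0 := by
        intro h
        exact hy (h ▸ (hasValue_zero T).isRegularAt)
      have hi : HasValue T y⁻¹ 0 := by
        rw [hasValue_zero_iff (inv_ne_zero hy0), ord_inv]
        have := mt (isRegularAt_iff hy0).mpr hy
        omega
      have h1 := (hR.mul (hi.pow 2)).sub ((((c E.a₁).mul hx).add (c E.a₃)).mul hi)
      have h2 : (x ^ 3 + algebraMap K (FF E) E.a₂ * x ^ 2 + algebraMap K (FF E) E.a₄ * x +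
        algebraMap K (FF E) E.a₆) * y⁻¹ ^ 2 - (algebraMap K (FF E) E.a₁ * x +
        algebraMap K (FF E) E.a₃) * y⁻¹ = 1 := by
        rw [← he]; field_simp; ring
      rw [h2] at h1
      have := h1.unique (hasValue_one T)
      simp at this
  · have hx0 : x ≠ 0 := by
      intro h
      exact hx (h ▸ (hasValue_zero T).isRegularAt)
    have hi : HasValue T x⁻¹ 0 := by
      rw [hasValue_zero_iff (inv_ne_zero hx0), ord_inv]
      have := mt (isRegularAt_iff hx0).mpr hx
      omega
    have hyx : ¬ IsRegularAt T (y / x) := by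
      rintro ⟨v, hv⟩
      have h1 := ((hv.pow 2).add ((c E.a₁).mul hv)).add (((c E.a₃).mul hv).mul hi)
      have h2 := (((hasValue_one T).add ((c E.a₂).mul hi)).add ((c E.a₄).mul (hi.pow 2))).add
        ((c E.a₆).mul (hi.pow 3))
      simp only [mul_zero, add_zero, ne_eq, OfNat.ofNat_ne_zero, not_false_eq_true, zero_pow] at h2
      have h3 := h1.mul (h2.inv one_ne_zero)
      apply hx
      convert h3.isRegularAt using 1
      rw [eq_mul_inv_iff_mul_eq₀ (h2.ne_zero one_ne_zero)]
      field_simp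
      linear_combination -he
    have hyx0 : y / x ≠ 0 := by
      intro h
      exact hyx (h ▸ (hasValue_zero T).isRegularAt)
    have hy0 : y ≠ 0 := (div_ne_zero_iff.mp hyx0).1
    have hxy : HasValue T (x / y) 0 := by
      rw [← inv_div, hasValue_zero_iff (inv_ne_zero hyx0), ord_inv]
      have := mt (isRegularAt_iff hyx0).mpr hyx
      omega
    refine ⟨0, fun h => absurd rfl h, fun _ _ => ⟨hy0, hxy, ?_⟩⟩
    convert hi.mul hxy using 1
    · change y⁻¹ = _
      field_simp
    · simp

theorem HasValue.aeval_mvPolynomial {n : ℕ} {w : Fin n → FF E} {v : Fin n → K} (h : ∀ i, HasValue T (w i) (v i))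
    (P : MvPolynomial (Fin n) K) : HasValue T (MvPolynomial.aeval w P) (MvPolynomial.eval v P) := by
  induction P using MvPolynomial.induction_on with
  | C a => simpa using hasValue_algebraMap T a
  | add p q hp hq => rw [map_add, map_add]; exact hp.add hq
  | mul_X p i hp =>
    rw [map_mul, map_mul, MvPolynomial.aeval_X, MvPolynomial.eval_X]; exact hp.mul (h i)

/-- The point `A` is a map from the curve to itself taking `T` to `S`. If `S` is infinity the
coordinates are first divided by `y(A)`, which quotients of forms of equal degree do not notice. -/
theorem HasValue.pull (hA : IsMoving A) (hr : RedTo T S A) {h : FF E} {v : K} (hv : HasValue S h v) :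
    HasValue T (pull hA h) v := by
  obtain ⟨n, P, Q, hP, hQ, hQ0, rfl, rfl⟩ := hv
  rw [map_div₀, pull_dehom, pull_dehom]
  by_cases hS : S = 0
  · obtain ⟨hy0, hx, hy⟩ := hr.2 hS hA.1
    have hw : (![xc A, yc A, 1] : Fin 3 → FF E) = yc A • ![xc A / yc A, 1, (yc A)⁻¹] := by
      ext i
      fin_cases i <;> simp <;> field_simp
    have hval : ∀ i, HasValue T ((![xc A / yc A, 1, (yc A)⁻¹] : Fin 3 → FF E) i) ((![0, 1, 0] : Fin 3 → K) i) := by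
      intro i
      fin_cases i
      · exact hx
      · exact hasValue_one T
      · exact hy
    rw [hw, hP.aeval_smul, hQ.aeval_smul, mul_div_mul_left _ _ (pow_ne_zero n hy0), hS]
    rw [hS] at hQ0
    exact (HasValue.aeval_mvPolynomial hval P).div (HasValue.aeval_mvPolynomial hval Q) hQ0
  · obtain ⟨-, hx, hy⟩ := hr.1 hS
    have hval : ∀ i, HasValue T ((![xc A, yc A, 1] : Fin 3 → FF E) i) ((![xc S, yc S, 1] : Fin 3 → K) i) := by
      intro i
      fin_cases i
      · exact hx
      · exact hy
      · exact hasValue_one T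
    rw [coords_of_ne_zero hS] at hQ0 ⊢
    exact (HasValue.aeval_mvPolynomial hval P).div (HasValue.aeval_mvPolynomial hval Q) hQ0

theorem RedTo.comp (hA : IsMoving A) (hr : RedTo T S A) (hB : RedTo S S' B) :
    RedTo T S' (mapPoint (pull hA) B) := by
  constructor
  · intro h
    obtain ⟨h0, hx, hy⟩ := hB.1 h
    rw [xc_mapPoint, yc_mapPoint]
    exact ⟨mapPoint_ne_zero _ h0, hx.pull hA hr, hy.pull hA hr⟩
  · intro h hB0
    have hB0 : B ≠ 0 := by rintro rfl; exact hB0 (map_zero _)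
    obtain ⟨h0, hx, hy⟩ := hB.2 h hB0
    rw [xc_mapPoint, yc_mapPoint, ← map_div₀, ← map_inv₀]
    exact ⟨by simpa using h0, hx.pull hA hr, hy.pull hA hr⟩

/-- With a constant abscissa the sum would be a constant point, and so would the generic point. -/
theorem isMoving_generic_add (S : E.toAffine.Point) : IsMoving (genericPoint E + constPoint E S) := by
  have hne : ∀ D : E.toAffine.Point, genericPoint E ≠ constPoint E D := by
    intro D h
    refine xFun_ne_algebraMap E (xc D) ?_
    rw [← xc_genericPoint, h, xc_constPoint]
  have h0 : genericPoint E + constPoint E S ≠ 0 := by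
    rw [ne_eq, add_eq_zero_iff_eq_neg, ← map_neg]
    exact hne _
  refine ⟨h0, fun c hc => ?_⟩
  obtain ⟨D, hD, rfl⟩ := exists_xc_eq (E := E) c
  rw [← xc_constPoint, xc_eq_iff h0 (constPoint_ne_zero hD), ← eq_sub_iff_add_eq,
    ← eq_sub_iff_add_eq, ← map_neg, ← map_sub, ← map_sub] at hc
  exact hc.elim (hne _) (hne _)

theorem redTo_genericPoint (T : E.toAffine.Point) : RedTo T T (genericPoint E) := by
  refine ⟨fun h => ⟨genericPoint_ne_zero E, hasValue_xFun h, hasValue_yFun h⟩, ?_⟩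
  rintro rfl -
  exact ⟨yFun_ne_zero, hasValue_x_div_y_zero, hasValue_inv_yFun_zero⟩

theorem hasValue_y_sq_div_x_cube : HasValue (0 : E.toAffine.Point) (yFun E ^ 2 / xFun E ^ 3) 1 := by
  obtain ⟨u, hu, h⟩ := exists_inv_yFun_eq (E := E)
  convert hu using 1
  have hx := xFun_ne_zero (E := E)
  have hy := yFun_ne_zero (E := E)
  field_simp at h ⊢
  exact h

/-- The only explicit local computation with the addition law. Translations at other points are
obtained from it by composition. -/
theorem redTo_zero_generic_add (S : E.toAffine.Point) :
    RedTo 0 S (genericPoint E + constPoint E S) := by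
  by_cases hS : S = 0
  · subst hS
    rw [map_zero, add_zero]
    exact redTo_genericPoint 0
  have hS' := constPoint_ne_zero hS
  have hη := genericPoint_ne_zero E
  have hne : xc (constPoint E S) ≠ xc (genericPoint E) := by
    rw [xc_constPoint]; exact (xFun_ne_algebraMap E _).symm
  refine ⟨fun _ => ?_, fun h => absurd h hS⟩
  have hadd := add_ne_zero_of_xc_ne hne
  have e1 := slope_add hS' hη hne
  have e2 := slope_add_y hS' hη hne
  rw [add_comm (constPoint E S)] at e1 e2 hadd
  set A := genericPoint E + constPoint E S
  have hxs := xFun_sub_ne_zero (E := E) (xc S)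
  rw [xc_constPoint, yc_constPoint, xc_genericPoint, yc_genericPoint] at e1 e2
  have ha1 : (E⁄(FF E)).a₁ = algebraMap K (FF E) E.a₁ := rfl
  have ha2 : (E⁄(FF E)).a₂ = algebraMap K (FF E) E.a₂ := rfl
  have ha3 : (E⁄(FF E)).a₃ = algebraMap K (FF E) E.a₃ := rfl
  rw [ha1, ha2] at e1
  rw [ha1, ha3] at e2
  have hx := xFun_ne_zero (E := E)
  have hy := yFun_ne_zero (E := E)
  have hge := generic_equation (E := E)
  have c := fun r => hasValue_algebraMap (E := E) 0 r
  have hD := ((hasValue_xFun_sub_infinity (E := E) (xc S)).inv one_ne_zero)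
  -- This is the numerator of `x(A) - x(S)` divided by `y`, with value `-psi2 S` at infinity. It
  -- gives the limits `0` for `x(A) - x(S)` and `-psi2 S` for its product with the slope.
  have hN := ((c (-psi2 S)).add ((c (E.a₄ - E.a₁ * yc S + 3 * xc S ^ 2 + 2 * E.a₂ * xc S)).mul
    hasValue_x_div_y_zero)).add ((c (E.a₆ + yc S ^ 2 + E.a₁ * xc S * yc S - E.a₂ * xc S ^ 2
      - 2 * xc S ^ 3)).mul hasValue_inv_yFun_zero)
  have hY := (hasValue_one (0 : E.toAffine.Point)).sub ((c (yc S)).mul hasValue_inv_yFun_zero)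
  have hv1 := (hN.mul (hD.pow 2)).mul ((hasValue_y_sq_div_x_cube (E := E)).mul hasValue_x_div_y_zero)
  have hv2 := ((hY.mul hN).mul (hD.pow 3)).mul (hasValue_y_sq_div_x_cube (E := E))
  simp only [mul_zero, add_zero, sub_zero, inv_one, one_pow, mul_one, one_mul] at hv1 hv2
  simp only [psi2, map_add, map_sub, map_mul, map_pow, map_neg, map_ofNat] at hv1 hv2
  have cx := c (xc S)
  have cy := c (yc S)
  have c1 := c E.a₁
  have c3 := c E.a₃
  clear c
  generalize algebraMap K (FF E) (xc S) = xs at *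
  generalize algebraMap K (FF E) (yc S) = ys at *
  generalize algebraMap K (FF E) E.a₁ = a1 at *
  generalize algebraMap K (FF E) E.a₂ = a2 at *
  generalize algebraMap K (FF E) E.a₃ = a3 at *
  generalize algebraMap K (FF E) E.a₄ = a4 at *
  generalize algebraMap K (FF E) E.a₆ = a6 at *
  generalize xFun E = x at *
  generalize yFun E = y at *
  have hl : (ys - y) / (xs - x) = (y - ys) / (x - xs) := by
    rw [← neg_sub y, ← neg_sub x, neg_div_neg_eq]
  rw [hl] at e1 e2
  generalize xc A = xA at *
  generalize yc A = yA at *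
  have hN' : xA - xs = (-(2 * ys + a1 * xs + a3) * y + (a4 - a1 * ys + 3 * xs ^ 2 + 2 * a2 * xs) * x +
      (a6 + ys ^ 2 + a1 * xs * ys - a2 * xs ^ 2 - 2 * xs ^ 3)) / (x - xs) ^ 2 := by
    rw [e1]
    field_simp
    linear_combination hge
  have hX : HasValue 0 (xA - xs) 0 := by
    convert hv1 using 1
    rw [hN']
    field_simp
  have hX' := hX.add cx
  rw [sub_add_cancel, zero_add] at hX'
  have hZ : HasValue 0 ((y - ys) / (x - xs) * (xA - xs)) (-(2 * yc S + E.a₁ * xc S + E.a₃)) := by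
    convert hv2 using 1
    rw [hN']
    field_simp
  refine ⟨hadd, hX', ?_⟩
  convert (((hZ.add cy).neg).sub (c1.mul hX')).sub c3 using 1
  ring

/-- Translation by `S`, at the generic point. -/
theorem redTo_generic_add (T S : E.toAffine.Point) : RedTo T (T + S) (genericPoint E + constPoint E S) := by
  obtain ⟨R, hR⟩ := exists_redTo T (genericPoint E + constPoint E S)
  -- The generic point plus `T + S` is reduced at `O` in two ways, directly and through the
  -- translation that takes `O` to `T`; uniqueness gives `R = T + S`.
  have h := (redTo_zero_generic_add T).comp (isMoving_generic_add T) hR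
  rw [map_add, mapPoint_pull_genericPoint, mapPoint_constPoint, add_assoc, ← map_add] at h
  rwa [h.unique (redTo_zero_generic_add (T + S))] at hR

theorem wv_generic_mul {n : ℕ} (hn : 1 ≤ n) :
    wv (genericPoint E) n ≠ 0 ∧ (xFun E - xc (n • genericPoint E)) * wv (genericPoint E) n ^ 2 =
      wv (genericPoint E) (n + 1) * wv (genericPoint E) (n - 1) :=
  nsmul_formula (genericPoint E) n hn fun _ hj _ => nsmul_genericPoint_ne_zero E hj

theorem isMoving_nsmul {n : ℕ} (hn : 1 ≤ n) : IsMoving (n • genericPoint E) :=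
  ⟨nsmul_genericPoint_ne_zero E hn,
    xc_nsmul_generic_ne E hn fun _ hj _ => nsmul_genericPoint_ne_zero E hj⟩

theorem xc_nsmul_generic_mul {n : ℕ} (hn : 1 ≤ n) : xc (n • genericPoint E) *
    Polynomial.aeval (xFun E) (E.ΨSq n) = Polynomial.aeval (xFun E) (E.Φ n) := by
  rw [← phi_generic, ← wv_sq_generic, ← (wv_generic_mul hn).2]
  ring

theorem PsiSq_ne_zero {n : ℕ} (hn : 1 ≤ n) : E.ΨSq n ≠ 0 := by
  intro h
  have := wv_sq_generic E n
  rw [h, map_zero] at this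
  exact (wv_generic_mul hn).1 (pow_eq_zero_iff (by norm_num) |>.mp this)

/-- The abscissa is `Φₙ/ΨSqₙ` at `x`, and the numerator has the larger degree, so there is a pole at
infinity. -/
theorem redTo_zero_nsmul {n : ℕ} (hn : 1 ≤ n) : RedTo 0 0 (n • genericPoint E) := by
  obtain ⟨R, hR⟩ := exists_redTo 0 (n • genericPoint E)
  by_cases hR0 : R = 0
  · rwa [hR0] at hR
  exfalso
  obtain ⟨-, hx, -⟩ := hR.1 hR0
  have hΦ : E.Φ n ≠ 0 := E.Φ_ne_zero n
  have hΨ := PsiSq_ne_zero (E := E) hn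
  have h := congrArg (ord 0) (xc_nsmul_generic_mul (E := E) hn)
  have hx0 : xc (n • genericPoint E) ≠ 0 := by
    simpa using (isMoving_nsmul (E := E) hn).2 0
  rw [ord_mul _ hx0 (aeval_xFun_ne_zero hΨ), ord_zero_aeval hΦ, ord_zero_aeval hΨ, E.natDegree_Φ] at h
  have h1 := (isRegularAt_iff hx0).mp hx.isRegularAt
  have h2 := E.natDegree_ΨSq_le n
  simp only [Int.natAbs_natCast] at h h2
  have : 1 ≤ n ^ 2 := Nat.one_le_pow _ _ hn
  omega

/-- The case of `O` is transported by translations: `[n]` after translation by `T` is translation by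
`nT` after `[n]`, and both are reduced at `O`. -/
theorem redTo_nsmul {n : ℕ} (hn : 1 ≤ n) (T : E.toAffine.Point) : RedTo T (n • T) (n • genericPoint E) := by
  obtain ⟨R, hR⟩ := exists_redTo T (n • genericPoint E)
  have h := (redTo_zero_generic_add T).comp (isMoving_generic_add T) hR
  have h2 := (redTo_zero_nsmul hn).comp (isMoving_nsmul hn) (redTo_zero_generic_add (n • T))
  rw [map_nsmul, mapPoint_pull_genericPoint, nsmul_add, ← map_nsmul (constPoint E)] at h
  rw [map_add, mapPoint_pull_genericPoint, mapPoint_constPoint] at h2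
  rwa [h.unique h2] at hR

/-! ### Translations -/

/-- The automorphism of the function field induced by the translation by `S`. -/
def trans (S : E.toAffine.Point) : FF E →ₐ[K] FF E := pull (isMoving_generic_add S)

theorem HasValue.trans {S T : E.toAffine.Point} {g : FF E} {v : K} (h : HasValue (T + S) g v) :
    HasValue T (trans S g) v := h.pull _ (redTo_generic_add T S)

theorem mapPoint_trans (S : E.toAffine.Point) :
    mapPoint (trans S) (genericPoint E) = genericPoint E + constPoint E S :=
  mapPoint_pull_genericPoint _

theorem algHom_ext_point {φ ψ : FF E →ₐ[K] FF E}
    (h : mapPoint φ (genericPoint E) = mapPoint ψ (genericPoint E)) : φ = ψ := by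
  refine algHom_ext_FF ?_ ?_
  · rw [← xc_genericPoint, ← xc_mapPoint, h, xc_mapPoint]
  · rw [← yc_genericPoint, ← yc_mapPoint, h, yc_mapPoint]

theorem mapPoint_comp (φ ψ : FF E →ₐ[K] FF E) (A : FP E) :
    mapPoint (φ.comp ψ) A = mapPoint φ (mapPoint ψ A) :=
  (Affine.Point.map_map (W' := E) (F := FF E) (K := FF E) (L := FF E) ψ φ A).symm

theorem mapPoint_id (A : FP E) : mapPoint (AlgHom.id K (FF E)) A = A := by
  cases A <;> rfl

theorem trans_trans (S S' : E.toAffine.Point) (g : FF E) : trans S (trans S' g) = trans (S + S') g := by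
  have : (trans S).comp (trans S') = trans (S + S') := by
    apply algHom_ext_point
    rw [mapPoint_comp, mapPoint_trans, map_add, mapPoint_trans, mapPoint_constPoint, mapPoint_trans,
      map_add, add_assoc]
  exact congrArg (fun f : FF E →ₐ[K] FF E => f g) this

@[simp] theorem trans_zero (g : FF E) : trans (0 : E.toAffine.Point) g = g := by
  have : trans (0 : E.toAffine.Point) = AlgHom.id K (FF E) := by
    apply algHom_ext_point
    rw [mapPoint_trans, mapPoint_id, map_zero, add_zero]
  rw [this]; rfl

theorem hasValue_trans_iff {S T : E.toAffine.Point} {g : FF E} {v : K} :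
    HasValue T (trans S g) v ↔ HasValue (T + S) g v := by
  refine ⟨fun h => ?_, HasValue.trans⟩
  have h : HasValue (T + S + -S) (trans S g) v := by rwa [add_neg_cancel_right]
  have := h.trans
  rwa [trans_trans, neg_add_cancel, trans_zero] at this

theorem IsUniformizerAt.trans {S T : E.toAffine.Point} {t : FF E} (h : IsUniformizerAt (T + S) t) :
    IsUniformizerAt T (trans S t) := by
  refine ⟨hasValue_trans_iff.mpr h.1, fun g hg => ?_⟩
  have hg' : g = MarkedGenusOne.trans S (MarkedGenusOne.trans (-S) g) := by
    rw [trans_trans, add_neg_cancel, trans_zero]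
  rw [hg', hasValue_trans_iff] at hg
  obtain ⟨r, w, hr, he⟩ := h.2 _ hg
  exact ⟨_, w, hr.trans, by rw [hg', he, map_mul]⟩

theorem HasOrder.trans {S T : E.toAffine.Point} {g : FF E} {n : ℤ} (h : HasOrder (T + S) g n) :
    HasOrder T (trans S g) n := by
  obtain ⟨t, u, v, ht, hu, hv, rfl⟩ := h
  exact ⟨_, _, v, ht.trans, hu.trans, hv, by rw [map_mul, map_zpow₀]⟩

theorem ord_trans (S T : E.toAffine.Point) (g : FF E) : ord T (trans S g) = ord (T + S) g := by
  by_cases hg : g = 0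
  · simp [hg]
  · exact (hasOrder_ord _ hg).trans.ord_eq

/-- The abscissa of `k • T` in terms of division polynomials. -/
theorem xc_nsmul_mul {T : E.toAffine.Point} (hT : T ≠ 0) {n : ℕ} (hn : n • T ≠ 0) :
    (xc T - xc (n • T)) * wv T n ^ 2 = wv T (n + 1) * wv T (n - 1) := by
  have h1 : 1 ≤ n := Nat.pos_of_ne_zero (by rintro rfl; exact hn (zero_nsmul T))
  -- Specialising the formula at the generic point removes the condition of `nsmul_formula` that no
  -- smaller multiple of `T` vanishes.
  obtain ⟨-, hx, -⟩ := (redTo_nsmul h1 T).1 hn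
  have hw : ∀ m : ℤ, HasValue T (wv (genericPoint E) m) (wv T m) := fun m => by
    rw [wv_genericPoint, ← polyFun_apply]
    exact hasValue_polyFun hT _
  have h := ((hasValue_xFun hT).sub hx).mul ((hw n).pow 2)
  rw [(wv_generic_mul h1).2] at h
  exact h.unique ((hw _).mul (hw _))

theorem xc_zsmul_mul {T : E.toAffine.Point} (hT : T ≠ 0) {n : ℤ} (hn : n • T ≠ 0) :
    (xc T - xc (n • T)) * wv T n ^ 2 = wv T (n + 1) * wv T (n - 1) := by
  obtain ⟨k, rfl | rfl⟩ := n.eq_nat_or_neg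
  · rw [natCast_zsmul] at *
    exact xc_nsmul_mul hT hn
  · rw [neg_smul, natCast_zsmul] at hn ⊢
    have := xc_nsmul_mul hT (neg_ne_zero.mp hn)
    rw [xc_neg, wv_neg, neg_sq, this, show -(k : ℤ) + 1 = -(k - 1) by ring,
      show -(k : ℤ) - 1 = -(k + 1) by ring, wv_neg, wv_neg]
    ring

end Reduction

/-! ## Sections with prescribed vanishing -/

section Sections

variable {K : Type*} [Field K] [DecidableEq K] {E : WeierstrassCurve K} {u : E.toAffine.Point}

/-- `s` has divisor `D`, leading coefficient `1` and order `a` at infinity, and leading coefficient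
`q` and order `b` at `u`. -/
structure HasLeads (u : E.toAffine.Point) (s : FF E) (D : E.toAffine.Point → ℤ) (a b : ℤ) (q : K) :
    Prop where
  ne_zero : s ≠ 0
  ord_eq : ∀ T, ord T s = D T
  lead_zero : HasValue 0 (s * (xFun E / yFun E) ^ (-a)) 1
  lead : HasValue u (s * (xFun E - algebraMap K _ (xc u)) ^ (-b)) q
  lead_ne_zero : q ≠ 0

variable {s s' : FF E} {D D' : E.toAffine.Point → ℤ} {a a' b b' : ℤ} {q q' : K}

theorem HasLeads.mul (h : HasLeads u s D a b q) (h' : HasLeads u s' D' a' b' q') :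
    HasLeads u (s * s') (D + D') (a + a') (b + b') (q * q') where
  ne_zero := mul_ne_zero h.ne_zero h'.ne_zero
  ord_eq T := by rw [ord_mul T h.ne_zero h'.ne_zero, h.ord_eq, h'.ord_eq]; rfl
  lead_zero := by
    have := h.lead_zero.mul h'.lead_zero
    rw [mul_mul_mul_comm, ← zpow_add₀ xFun_div_ne_zero, one_mul] at this
    rwa [neg_add]
  lead := by
    have := h.lead.mul h'.lead
    rw [mul_mul_mul_comm, ← zpow_add₀ (xFun_sub_ne_zero _)] at this
    rwa [neg_add]
  lead_ne_zero := mul_ne_zero h.lead_ne_zero h'.lead_ne_zero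

theorem HasLeads.inv (h : HasLeads u s D a b q) : HasLeads u s⁻¹ (-D) (-a) (-b) q⁻¹ where
  ne_zero := inv_ne_zero h.ne_zero
  ord_eq T := by rw [ord_inv, h.ord_eq]; rfl
  lead_zero := by
    have := h.lead_zero.inv one_ne_zero
    rwa [mul_inv, ← zpow_neg, inv_one] at this
  lead := by
    have := h.lead.inv h.lead_ne_zero
    rwa [mul_inv, ← zpow_neg] at this
  lead_ne_zero := inv_ne_zero h.lead_ne_zero

theorem hasLeads_xFun_sub (hu : u ≠ 0) : HasLeads u (xFun E - algebraMap K _ (xc u))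
    (Pi.single u 1 + Pi.single (-u) 1 - 2 • Pi.single 0 1) (-2) 1 1 where
  ne_zero := xFun_sub_ne_zero _
  ord_eq T := by
    simp only [Pi.sub_apply, Pi.add_apply, Pi.smul_apply, Pi.single_apply]
    by_cases hT : T = 0
    · subst hT
      rw [ord_zero_xFun_sub, if_neg hu.symm, if_neg (neg_ne_zero.mpr hu).symm, if_pos rfl]
      rfl
    · rw [ord_xFun_sub hT hu, if_neg hT]
      simp
  lead_zero := by
    obtain ⟨v, hv, h⟩ := exists_xFun_eq (E := E)
    have h2 := (hasValue_xFun_sub_infinity (E := E) (xc u)).mul hv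
    rw [one_mul] at h2
    convert h2 using 1
    have hz := xFun_div_ne_zero (E := E)
    have hx := xFun_ne_zero (E := E)
    rw [zpow_neg, eq_mul_inv_iff_mul_eq₀ (zpow_ne_zero _ hz)] at h
    rw [neg_neg, div_mul_eq_mul_div, eq_div_iff hx]
    rw [zpow_ofNat] at *
    linear_combination (xFun E - algebraMap K _ (xc u)) * h
  lead := by
    rw [zpow_neg_one, mul_inv_cancel₀ (xFun_sub_ne_zero _)]
    exact hasValue_one u
  lead_ne_zero := one_ne_zero

theorem hasLeads_chordFun {B : E.toAffine.Point} (hu : u ≠ 0) (h2 : psi2 u ≠ 0) (hB : B ≠ 0)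
    (hne : B ≠ u) (huB : u + B ≠ 0) : HasLeads u (chordFun u B)
    (Pi.single u 1 + Pi.single B 1 - Pi.single (u + B) 1 - Pi.single 0 1) (-1) 1
    ((xc u - xc B) / psi2 u) where
  ne_zero := chordFun_ne_zero hu hB huB
  ord_eq T := by
    rw [ord_chordFun hu hB huB]
    simp [Pi.single_apply]
  lead_zero := by
    rw [neg_neg, zpow_one]
    exact hasValue_chordFun_infinity
  lead := by
    rw [zpow_neg_one, ← div_eq_mul_inv]
    exact hasValue_chordFun_left hu hB huB h2
  lead_ne_zero := by
    refine div_ne_zero (sub_ne_zero.mpr fun h => ?_) h2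
    rcases (xc_eq_iff hu hB).mp h with h | h
    · exact hne h.symm
    · exact huB (by rw [h, neg_add_cancel])

theorem hasLeads_chordFun_self (hu : u ≠ 0) (h2 : psi2 u ≠ 0) : HasLeads u (chordFun u u)
    (2 • Pi.single u 1 - Pi.single (u + u) 1 - Pi.single 0 1) (-1) 2 (psi2 u)⁻¹ where
  ne_zero := chordFun_ne_zero hu hu (by rwa [← two_nsmul, ne_eq, two_nsmul_eq_zero_iff hu])
  ord_eq T := by
    rw [ord_chordFun hu hu (by rwa [← two_nsmul, ne_eq, two_nsmul_eq_zero_iff hu])]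
    simp only [Pi.sub_apply, Pi.smul_apply, Pi.single_apply]
    split_ifs <;> norm_num
  lead_zero := by
    rw [neg_neg, zpow_one]
    exact hasValue_chordFun_infinity
  lead := by
    rw [zpow_neg, zpow_ofNat, ← div_eq_mul_inv]
    exact hasValue_chordFun_self hu (by rwa [← two_nsmul, ne_eq, two_nsmul_eq_zero_iff hu]) h2
  lead_ne_zero := inv_ne_zero h2

/-- The divisor `n O - (n + 1) u + (n + 1)u`. -/
def secDiv (u : E.toAffine.Point) (n : ℤ) : E.toAffine.Point → ℤ :=
  n • Pi.single 0 1 - (n + 1) • Pi.single u 1 + Pi.single ((n + 1) • u) 1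

/-- There is a function with divisor `n O - (n + 1) u + (n + 1)u` and the leading coefficients
predicted by the division polynomials. -/
def HasSection (u : E.toAffine.Point) (n : ℤ) : Prop :=
  ∃ s : FF E, HasLeads u s (secDiv u n) n (-(n + 1)) (psi2 u ^ (n + 1) * (wv u n / wv u (n + 1)))

theorem HasSection.mul {n m : ℤ} {g : FF E} (h : HasSection u n) (hg : HasLeads u g D a b q)
    (hD : secDiv u n + D = secDiv u m) (ha : n + a = m) (hb : b = n - m)
    (hq : psi2 u ^ (n + 1) * (wv u n / wv u (n + 1)) * q =
      psi2 u ^ (m + 1) * (wv u m / wv u (m + 1))) : HasSection u m := by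
  obtain ⟨s, hs⟩ := h
  have := hs.mul hg
  rw [hD, ha, hq, hb, show -(n + 1) + (n - m) = -(m + 1) by ring] at this
  exact ⟨_, this⟩

variable [IsAlgClosed K] [E.IsElliptic]

/-- The two sections differ by the function of the chord through `u` and `(n+1)u`. Its leading
coefficient at `u` involves `x(u) - x((n+1)u)`, that is, `ψₙ₊₂ψₙ/ψₙ₊₁²`. -/
theorem hasSection_step (hu : u ≠ 0) (h2 : psi2 u ≠ 0) {n : ℤ} (h0 : n • u ≠ 0) (h1 : (n + 1) • u ≠ 0)
    (h3 : (n + 2) • u ≠ 0) : HasSection u n ↔ HasSection u (n + 1) := by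
  have hB : (n + 1) • u ≠ u := by rwa [add_smul, one_smul, ne_eq, add_eq_right]
  have huB : u + (n + 1) • u = (n + 2) • u := by rw [← one_add_zsmul]; congr 1; ring
  have hg := hasLeads_chordFun hu h2 h1 hB (by rwa [huB])
  have hw := xc_zsmul_mul hu h1
  have w0 := mt (wv_eq_zero_iff hu n).mp h0
  have w1 := mt (wv_eq_zero_iff hu (n + 1)).mp h1
  have w2 := mt (wv_eq_zero_iff hu (n + 2)).mp h3
  rw [show n + 1 + 1 = n + 2 by ring, add_sub_cancel_right] at hw
  have hD : secDiv u (n + 1) = secDiv u n - (Pi.single u 1 + Pi.single ((n + 1) • u) 1 -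
      Pi.single (u + (n + 1) • u) 1 - Pi.single 0 1) := by
    rw [secDiv, secDiv, huB, show n + 1 + 1 = n + 2 by ring]
    module
  have hx : xc u - xc ((n + 1) • u) ≠ 0 := by
    intro h
    rw [h, zero_mul] at hw
    exact mul_ne_zero w2 w0 hw.symm
  constructor
  · refine fun h => h.mul hg.inv (by rw [hD]; abel) (by ring) (by ring) ?_
    rw [zpow_add₀ h2 (n + 1), show n + 1 + 1 = n + 2 by ring, zpow_one]
    field_simp
    linear_combination -hw
  · refine fun h => h.mul hg (by rw [hD]; abel) (by ring) (by ring) ?_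
    rw [zpow_add₀ h2 (n + 1), show n + 1 + 1 = n + 2 by ring, zpow_one]
    field_simp
    linear_combination hw

/-- For `nu = 0` the predicted coefficients degenerate at `n - 1` and `n`, so these indices are
skipped. The factor is `x - x(u)` times the tangent function at `u`, and the coefficients match by
the elliptic relation for `n` and `2`, in which `ψₙ` vanishes. -/
theorem hasSection_jump (hu : u ≠ 0) (h2 : psi2 u ≠ 0) {n : ℤ} (h0 : n • u = 0) :
    HasSection u (n - 2) ↔ HasSection u (n + 1) := by
  have huu : 2 • u ≠ 0 := by rwa [ne_eq, two_nsmul_eq_zero_iff hu]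
  have e1 : ∀ k : ℤ, (n + k) • u = k • u := fun k => by rw [add_smul, h0, zero_add]
  have e2 : (2 : ℤ) • u = u + u := two_zsmul u
  have huu' : u + u ≠ 0 := by rwa [← two_nsmul]
  have w0 := (wv_eq_zero_iff hu n).mpr h0
  have w1 := mt (wv_eq_zero_iff hu (n + 1)).mp (by rw [e1, one_smul]; exact hu)
  have w2 := mt (wv_eq_zero_iff hu (n + 2)).mp (by rwa [e1, e2])
  have w3 := mt (wv_eq_zero_iff hu (n - 1)).mp (by
    rw [sub_eq_add_neg, e1, neg_one_smul]; exact neg_ne_zero.mpr hu)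
  have w4 := mt (wv_eq_zero_iff hu (n - 2)).mp (by
    rw [sub_eq_add_neg, e1, neg_smul, e2]; exact neg_ne_zero.mpr huu')
  have hw := wv_relation hu n 2
  rw [w0, wv_two] at hw
  have hg := (hasLeads_xFun_sub hu).mul (hasLeads_chordFun_self hu h2)
  have hD : secDiv u (n + 1) = secDiv u (n - 2) - (Pi.single u 1 + Pi.single (-u) 1 - 2 • Pi.single 0 1
      + (2 • Pi.single u 1 - Pi.single (u + u) 1 - Pi.single 0 1)) := by
    rw [secDiv, secDiv, show n + 1 + 1 = n + 2 by ring, show n - 2 + 1 = n + -1 by ring, e1, e1, e2,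
      neg_one_smul]
    module
  have hz : psi2 u ^ (n + 2) = psi2 u ^ (n - 1) * psi2 u ^ 3 := by
    rw [← zpow_natCast, ← zpow_add₀ h2]
    congr 1
    push_cast
    ring
  constructor
  · refine fun h => h.mul hg.inv (by rw [hD]; abel) (by ring) (by ring) ?_
    rw [show n + 1 + 1 = n + 2 by ring, show n - 2 + 1 = n - 1 by ring, hz]
    field_simp
    linear_combination hw
  · refine fun h => h.mul hg (by rw [hD]; abel) (by ring) (by ring) ?_
    rw [show n + 1 + 1 = n + 2 by ring, show n - 2 + 1 = n - 1 by ring, hz]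
    field_simp
    linear_combination -hw

theorem hasSection_one (hu : u ≠ 0) (h2 : psi2 u ≠ 0) : HasSection u 1 := by
  refine ⟨(chordFun u u)⁻¹, ?_⟩
  convert (hasLeads_chordFun_self hu h2).inv using 1
  · rw [secDiv, one_add_one_eq_two, two_zsmul u]; module
  · norm_num
  · norm_num
  · rw [wv_one, one_add_one_eq_two, wv_two, inv_inv, zpow_ofNat]; field_simp

theorem hasSection_neg_two (hu : u ≠ 0) (h2 : psi2 u ≠ 0) : HasSection u (-2) := by
  refine ⟨xFun E - algebraMap K _ (xc u), ?_⟩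
  convert hasLeads_xFun_sub hu using 1
  · rw [secDiv, show (-2 : ℤ) + 1 = -1 by norm_num, neg_one_smul ℤ u]; module
  · norm_num
  · rw [show (-2 : ℤ) + 1 = -1 by norm_num, wv_neg, wv_neg, wv_one, wv_two, zpow_neg_one]; field_simp

/-- Induction upwards from `1` and downwards from `-2`; the indices `0` and `-1` are excluded by the
hypotheses. A vanishing multiple of `u` on the way is passed by `hasSection_jump`; the multiples
next to it are nonzero because `u` and `2u` are. -/
theorem hasSection (hu : u ≠ 0) (h2 : psi2 u ≠ 0) {n : ℤ} (h0 : n • u ≠ 0) (h1 : (n + 1) • u ≠ 0) :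
    HasSection u n := by
  have huu : (2 : ℤ) • u ≠ 0 := by
    rw [two_zsmul, ← two_nsmul]; rwa [ne_eq, two_nsmul_eq_zero_iff hu]
  have up : ∀ k : ℕ, ((k : ℤ) + 1) • u ≠ 0 → ((k : ℤ) + 2) • u ≠ 0 → HasSection u (k + 1) := by
    intro k
    induction k using Nat.strong_induction_on with
    | _ k ih =>
      intro h0 h1
      rcases k with _ | k
      · simpa using hasSection_one hu h2
      push_cast at h0 h1 ⊢
      by_cases hk : ((k : ℤ) + 1) • u = 0
      · rcases k with _ | _ | k
        · simp [hu] at hk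
        · exact absurd (by simpa using hk) huu
        · push_cast at hk ⊢
          refine (hasSection_jump hu h2 hk).mp ?_
          have := ih k (by omega) ?_ ?_
          · convert this using 1; ring
          · rw [show (k : ℤ) + 1 = (k + 1 + 1 + 1) + -2 by ring, add_smul, hk, zero_add, neg_smul]
            exact neg_ne_zero.mpr huu
          · rw [show (k : ℤ) + 2 = (k + 1 + 1 + 1) + -1 by ring, add_smul, hk, zero_add, neg_smul, one_smul]
            exact neg_ne_zero.mpr hu
      · rw [show (k : ℤ) + 1 + 2 = k + 1 + 2 by ring] at h1
        exact (hasSection_step hu h2 hk h0 h1).mp (ih k (by omega) hk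
          (by rwa [show (k : ℤ) + 2 = k + 1 + 1 by ring]))
  have down : ∀ k : ℕ, (-(k : ℤ) - 2) • u ≠ 0 → (-(k : ℤ) - 1) • u ≠ 0 → HasSection u (-k - 2) := by
    intro k
    induction k using Nat.strong_induction_on with
    | _ k ih =>
      intro h0 h1
      rcases k with _ | k
      · simpa using hasSection_neg_two hu h2
      push_cast at h0 h1 ⊢
      by_cases hk : (-(k : ℤ) - 1) • u = 0
      · rcases k with _ | _ | k
        · simp [hu] at hk
        · push_cast at hk
          norm_num at hk
          exact absurd hk huu
        · push_cast at hk ⊢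
          have := ih k (by omega) ?_ ?_
          · refine (?_ : HasSection u (-((k : ℤ) + 1 + 1) - 1 - 2) → _) ((hasSection_jump hu h2 hk).mpr ?_)
            · intro h; convert h using 1; ring
            · convert this using 1; ring
          · rw [show -(k : ℤ) - 2 = (-((k : ℤ) + 1 + 1) - 1) + 1 by ring, add_smul, hk, zero_add, one_smul]
            exact hu
          · rw [show -(k : ℤ) - 1 = (-((k : ℤ) + 1 + 1) - 1) + 2 by ring, add_smul, hk, zero_add]
            exact huu
      · have e1 : -((k : ℤ) + 1) - 2 + 1 = -k - 2 := by ring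
        have e2 : -((k : ℤ) + 1) - 2 + 2 = -k - 1 := by ring
        rw [show -((k : ℤ) + 1) - 1 = -k - 2 by ring] at h1
        refine (hasSection_step hu h2 h0 (by rwa [e1]) (by rwa [e2])).mpr ?_
        rw [e1]
        exact ih k (by omega) h1 hk
  rcases lt_trichotomy n 0 with hn | rfl | hn
  · by_cases hn1 : n = -1
    · subst hn1; simp at h1
    obtain ⟨k, hk⟩ := Int.eq_ofNat_of_zero_le (show 0 ≤ -n - 2 by omega)
    obtain rfl : n = -k - 2 := by omega
    exact down k h0 (by rwa [show -(k : ℤ) - 1 = -k - 2 + 1 by ring])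
  · simp at h0
  · obtain ⟨k, hk⟩ := Int.eq_ofNat_of_zero_le (show 0 ≤ n - 1 by omega)
    obtain rfl : n = k + 1 := by omega
    exact up k h0 (by rwa [show (k : ℤ) + 2 = k + 1 + 1 by ring])

end Sections

/-! ### The section point in terms of division polynomials -/

section SectionPoint

variable {K : Type*} [Field K] [DecidableEq K] {E : WeierstrassCurve K} {u : E.toAffine.Point}

theorem prod_zpow_eq_zpow_sum {ι F : Type*} [Field F] {x : F} (hx : x ≠ 0) (s : Finset ι) (f : ι → ℤ) :
    ∏ i ∈ s, x ^ f i = x ^ ∑ i ∈ s, f i := by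
  classical
  induction s using Finset.induction_on with
  | empty => simp
  | insert i s hi ih => rw [Finset.prod_insert hi, Finset.sum_insert hi, zpow_add₀ hx, ih]

theorem HasLeads.prod {ι : Type*} (t : Finset ι) {s : ι → FF E} {D : ι → E.toAffine.Point → ℤ}
    {a b : ι → ℤ} {q : ι → K} (h : ∀ i ∈ t, HasLeads u (s i) (D i) (a i) (b i) (q i)) :
    HasLeads u (∏ i ∈ t, s i) (∑ i ∈ t, D i) (∑ i ∈ t, a i) (∑ i ∈ t, b i) (∏ i ∈ t, q i) := by
  classical
  induction t using Finset.induction_on with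
  | empty =>
    simp only [Finset.prod_empty, Finset.sum_empty]
    exact ⟨one_ne_zero, by simp, by simpa using hasValue_one 0, by simpa using hasValue_one u, one_ne_zero⟩
  | insert i t hi ih =>
    rw [Finset.prod_insert hi, Finset.sum_insert hi, Finset.sum_insert hi, Finset.sum_insert hi,
      Finset.prod_insert hi]
    exact (h i (by simp)).mul (ih fun j hj => h j (by simp [hj]))

variable [IsAlgClosed K] [E.IsElliptic] {P Q : E.toAffine.Point} {c d : ℕ}

theorem secDiv_sub (n : ℤ) (T : E.toAffine.Point) : secDiv (Q - P) n (T - P) =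
    n * (if T = P then 1 else 0) - (n + 1) * (if T = Q then 1 else 0) +
      if T - P = (n + 1) • (Q - P) then 1 else 0 := by
  simp only [secDiv, Pi.add_apply, Pi.sub_apply, Pi.smul_apply, Pi.single_apply, smul_eq_mul,
    sub_eq_zero, sub_left_inj]

theorem isVanishingSection_trans {a b : ℕ} {σ : FF E} {q : K} {p r : ℤ} (hab : (a : ℤ) + b = d - 1)
    (hσ : HasLeads (Q - P) σ (secDiv (Q - P) (a - c)) p r q) :
    IsVanishingSection P Q c d a b (trans (-P) σ) := by
  refine ⟨fun T => secDiv (Q - P) (a - c) (T - P), fun T => ?_, fun T => ?_⟩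
  · rw [hasOrder_iff_ord, ord_trans, ← sub_eq_add_neg, hσ.ord_eq]
    exact ⟨by simpa using hσ.ne_zero, rfl⟩
  · simp only [Pi.add_apply, Pi.smul_apply, ptDiv, Pi.single_apply, secDiv_sub, smul_eq_mul]
    have hb : (b : ℤ) = d - 1 - a := by omega
    rw [hb]
    split_ifs <;> linarith

/-- Uniqueness of the section: the quotient by `σ` has at most one pole, simple and at the free zero
of `σ`, so it is constant. -/
theorem IsVanishingSection.eq_mul {a b : ℕ} {σ s : FF E} {q : K} {p r : ℤ} (hab : (a : ℤ) + b = d - 1)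
    (hσ : HasLeads (Q - P) σ (secDiv (Q - P) (a - c)) p r q) (hs : IsVanishingSection P Q c d a b s) :
    ∃ C : K, C ≠ 0 ∧ s = algebraMap K _ C * trans (-P) σ := by
  obtain ⟨D, hD, hle⟩ := hs
  have hs0 : s ≠ 0 := (hD 0).ne_zero
  have hs1 : trans P s ≠ 0 := by simpa using hs0
  -- Translating by the free zero moves the possible pole to infinity, where
  -- `exists_eq_algebraMap_of_regular` allows a simple pole.
  set R := ((a : ℤ) - c + 1) • (Q - P) with hR
  have key : ∀ T, -(if T = 0 then 1 else 0) ≤ ord T (trans R (trans P s / σ)) := by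
    intro T
    rw [ord_trans, ord_div _ hs1 hσ.ne_zero, ord_trans, hσ.ord_eq, (hD _).ord_eq]
    have h1 := hle (T + R + P)
    have h2 := secDiv_sub (P := P) (Q := Q) ((a : ℤ) - c) (T + R + P)
    rw [add_sub_cancel_right, ← hR] at h2
    simp only [show (T + R = R) = (T = 0) from propext add_eq_right] at h2
    rw [h2]
    simp only [Pi.add_apply, Pi.smul_apply, ptDiv, Pi.single_apply, smul_eq_mul] at h1
    have hb : (b : ℤ) = d - 1 - a := by omega
    rw [hb] at h1
    split_ifs at h1 ⊢ <;> linarith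
  have hne : trans R (trans P s / σ) ≠ 0 := by simpa using ⟨hs0, hσ.ne_zero⟩
  obtain ⟨C, hC⟩ := exists_eq_algebraMap_of_regular (g := trans R (trans P s / σ))
    (fun T hT => (isRegularAt_iff hne).mpr (by simpa [hT] using key T)) (by simpa using key 0)
  have hC' : s = algebraMap K _ C * trans (-P) σ := by
    have h1 := congrArg (trans (-R)) hC
    rw [trans_trans, neg_add_cancel, trans_zero, AlgHom.commutes, div_eq_iff hσ.ne_zero] at h1
    have h2 := congrArg (trans (-P)) h1
    rwa [trans_trans, neg_add_cancel, trans_zero, map_mul, AlgHom.commutes] at h2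
  refine ⟨C, ?_, hC'⟩
  rintro rfl
  rw [map_zero, zero_mul] at hC'
  exact hs0 hC'

/-- The coordinates of the point `f_Q`, in terms of `u = Q - P`. -/
def coordVec {m l : ℕ} (u : E.toAffine.Point) (c : ℕ) (a : Fin m → Fin (l + 1) → ℕ) (j : Fin (l + 1)) : K :=
  ∏ i, wv u ((a i j : ℤ) - c) / wv u ((a i j : ℤ) - c + 1)

theorem natAbs_nsmul_eq_zero (n : ℤ) (T : E.toAffine.Point) : n.natAbs • T = 0 ↔ n • T = 0 := by
  obtain ⟨k, rfl | rfl⟩ := n.eq_nat_or_neg <;> simp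

variable {m l : ℕ} {a b : Fin m → Fin (l + 1) → ℕ}

theorem mem_goodLocus : Q ∈ goodLocus P c a ↔
    ∀ i j, ((a i j : ℤ) - c) • (Q - P) ≠ 0 ∧ ((a i j : ℤ) - c + 1) • (Q - P) ≠ 0 := by
  simp only [goodLocus, Set.mem_ofPred_eq, ne_eq, natAbs_nsmul_eq_zero]
  simp only [sub_add_eq_add_sub]

/-- One of two consecutive integers is even, so `2(Q - P) = 0` would make one of the excluded
multiples vanish. -/
theorem ne_zero_of_goodLocus (hm : 0 < m) (hQ : Q ∈ goodLocus P c a) :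
    Q - P ≠ 0 ∧ psi2 (Q - P) ≠ 0 := by
  obtain ⟨h0, h1⟩ := mem_goodLocus.mp hQ ⟨0, hm⟩ 0
  have hu : Q - P ≠ 0 := fun h => h0 (by rw [h, smul_zero])
  refine ⟨hu, fun h2 => ?_⟩
  rw [← two_nsmul_eq_zero_iff hu, ← natCast_zsmul] at h2
  rcases Int.even_or_odd' ((a ⟨0, hm⟩ 0 : ℤ) - c) with ⟨k, hk | hk⟩
  · rw [hk, mul_comm, mul_smul] at h0
    exact h0 (by rw [show (2 : ℤ) = (2 : ℕ) from rfl, h2, smul_zero])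
  · rw [hk, show 2 * k + 1 + 1 = (k + 1) * 2 by ring, mul_smul] at h1
    exact h1 (by rw [show (2 : ℤ) = (2 : ℕ) from rfl, h2, smul_zero])

theorem coordVec_ne_zero (hm : 0 < m) (hQ : Q ∈ goodLocus P c a) (j : Fin (l + 1)) :
    coordVec (Q - P) c a j ≠ 0 := by
  have hu := (ne_zero_of_goodLocus hm hQ).1
  refine Finset.prod_ne_zero_iff.mpr fun i _ => ?_
  obtain ⟨h0, h1⟩ := mem_goodLocus.mp hQ i j
  exact div_ne_zero (mt (wv_eq_zero_iff hu _).mp h0) (mt (wv_eq_zero_iff hu _).mp h1)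

/-- The sections with leading coefficient `1` at the origin realise the normalisation at `P`. Any
other choice differs by constants, and equality of the values at `P` forces their products over `i`
to agree for all `j`. -/
theorem isSectionPoint_iff (hm : 0 < m) (hab : ∀ i j, (a i j : ℤ) + b i j = d - 1)
    (hsum : ∀ j j', ∑ i, a i j = ∑ i, a i j') (hQ : Q ∈ goodLocus P c a) {v : Fin (l + 1) → K} :
    IsSectionPoint P Q c d a b v ↔ (∀ j, v j ≠ 0) ∧
      ∀ j j', v j / v j' = coordVec (Q - P) c a j / coordVec (Q - P) c a j' := by
  obtain ⟨hu, h2⟩ := ne_zero_of_goodLocus hm hQ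
  have hex := fun i j => hasSection hu h2 (mem_goodLocus.mp hQ i j).1 (mem_goodLocus.mp hQ i j).2
  choose σ hσ using hex
  have hG : ∀ j j', HasValue 0 ((∏ i, σ i j) / ∏ i, σ i j') 1 ∧ HasValue (Q - P)
      ((∏ i, σ i j) / ∏ i, σ i j') (coordVec (Q - P) c a j / coordVec (Q - P) c a j') := by
    intro j j'
    have h := (HasLeads.prod Finset.univ fun i _ => hσ i j).mul
      (HasLeads.prod Finset.univ fun i _ => hσ i j').inv
    have hs : ∑ i, (a i j : ℤ) = ∑ i, (a i j' : ℤ) := by exact_mod_cast hsum j j'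
    have h0 := h.lead_zero
    have h1 := h.lead
    -- The total exponent depends only on the sum of the `a i j`, so these powers cancel in the
    -- quotient.
    have hpow : ∏ i, psi2 (Q - P) ^ ((a i j : ℤ) - c + 1) = ∏ i, psi2 (Q - P) ^ ((a i j' : ℤ) - c + 1) := by
      rw [prod_zpow_eq_zpow_sum h2, prod_zpow_eq_zpow_sum h2]
      simp only [Finset.sum_add_distrib, Finset.sum_sub_distrib, hs]
    have hpow0 : ∏ i, psi2 (Q - P) ^ ((a i j' : ℤ) - c + 1) ≠ 0 :=
      Finset.prod_ne_zero_iff.mpr fun i _ => zpow_ne_zero _ h2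
    simp only [Finset.sum_add_distrib, Finset.sum_sub_distrib, Finset.sum_neg_distrib, hs, add_neg_cancel,
      neg_zero, zpow_zero, mul_one, ← div_eq_mul_inv] at h0 h1
    refine ⟨h0, ?_⟩
    rwa [Finset.prod_mul_distrib, Finset.prod_mul_distrib, hpow, mul_div_mul_left _ _ hpow0] at h1
  have hP : P + -P = 0 := add_neg_cancel P
  have hQP : Q + -P = Q - P := (sub_eq_add_neg Q P).symm
  constructor
  · rintro ⟨s, hs, hsP, hv, hsQ⟩
    refine ⟨hv, fun j j' => ?_⟩
    choose C hC hCs using fun i j => (hs i j).eq_mul (hab i j) (hσ i j)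
    have hfrac : (∏ i, s i j) / ∏ i, s i j' = algebraMap K _ ((∏ i, C i j) / ∏ i, C i j') *
        trans (-P) ((∏ i, σ i j) / ∏ i, σ i j') := by
      simp only [hCs, Finset.prod_mul_distrib, map_div₀, map_prod]
      rw [mul_div_mul_comm]
    have h1 := hsP j j'
    have h3 := hsQ j j'
    rw [hfrac] at h1 h3
    have h1' := (hasValue_algebraMap P ((∏ i, C i j) / ∏ i, C i j')).mul
      (hasValue_trans_iff.mpr (hP.symm ▸ (hG j j').1))
    have h3' := (hasValue_algebraMap Q ((∏ i, C i j) / ∏ i, C i j')).mul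
      (hasValue_trans_iff.mpr (hQP.symm ▸ (hG j j').2))
    have e1 := h1.unique h1'
    have e3 := h3.unique h3'
    rw [mul_one] at e1
    rwa [← e1, one_mul] at e3
  · rintro ⟨hv, hvv⟩
    refine ⟨fun i j => trans (-P) (σ i j), fun i j => isVanishingSection_trans (hab i j) (hσ i j),
      fun j j' => ?_, hv, fun j j' => ?_⟩
    · rw [← map_prod, ← map_prod, ← map_div₀, hasValue_trans_iff, hP]
      exact (hG j j').1
    · rw [← map_prod, ← map_prod, ← map_div₀, hasValue_trans_iff, hQP, hvv]
      exact (hG j j').2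

end SectionPoint

/-! ## Rational functions defined over a subfield -/

section DefinedOver

variable {k K : Type*} [Field k] [Field K] [Algebra k K] {E : WeierstrassCurve K}

theorem isDefinedOver_div {n : ℕ} {A B : MvPolynomial (Fin 3) k} (hA : A.IsHomogeneous n)
    (hB : B.IsHomogeneous n) : IsDefinedOver k
      (dehom E (A.map (algebraMap k K)) / dehom E (B.map (algebraMap k K))) := by
  by_cases h : dehom E (B.map (algebraMap k K)) = 0
  -- Division by zero gives the zero function, which is represented as `0 / 1`.
  · refine ⟨0, 0, 1, MvPolynomial.isHomogeneous_zero .., MvPolynomial.isHomogeneous_one .., ?_, ?_⟩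
    · simp [dehom]
    · rw [h, div_zero]; simp [dehom]
  · exact ⟨n, A, B, hA, hB, h, rfl⟩

theorem IsDefinedOver.mul {f g : FF E} (hf : IsDefinedOver k f) (hg : IsDefinedOver k g) :
    IsDefinedOver k (f * g) := by
  obtain ⟨n, A, B, hA, hB, -, rfl⟩ := hf
  obtain ⟨m, A', B', hA', hB', -, rfl⟩ := hg
  have := isDefinedOver_div (E := E) (K := K) (hA.mul hA') (hB.mul hB')
  rwa [map_mul, map_mul, dehom_mul, dehom_mul, mul_div_mul_comm] at this

theorem IsDefinedOver.add {f g : FF E} (hf : IsDefinedOver k f) (hg : IsDefinedOver k g) :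
    IsDefinedOver k (f + g) := by
  obtain ⟨n, A, B, hA, hB, h, rfl⟩ := hf
  obtain ⟨m, A', B', hA', hB', h', rfl⟩ := hg
  have := isDefinedOver_div (E := E) (K := K) ((hA.mul hB').add (hB.mul hA')) (hB.mul hB')
  rwa [map_add, map_mul, map_mul, map_mul, dehom_add, dehom_mul, dehom_mul, dehom_mul,
    ← div_add_div _ _ h h'] at this

theorem IsDefinedOver.inv {f : FF E} (hf : IsDefinedOver k f) : IsDefinedOver k f⁻¹ := by
  obtain ⟨n, A, B, hA, hB, h, rfl⟩ := hf
  rw [inv_div]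
  exact isDefinedOver_div hB hA

theorem isDefinedOver_algebraMap (c : k) :
    IsDefinedOver k (algebraMap K (FF E) (algebraMap k K c)) := by
  have := isDefinedOver_div (E := E) (K := K) (MvPolynomial.isHomogeneous_C (Fin 3) c)
    (MvPolynomial.isHomogeneous_one (Fin 3) k)
  simpa [dehom] using this

theorem isDefinedOver_xFun : IsDefinedOver k (xFun E) := by
  have := isDefinedOver_div (E := E) (K := K) (MvPolynomial.isHomogeneous_X k (0 : Fin 3))
    (MvPolynomial.isHomogeneous_X k (2 : Fin 3))
  simpa [dehom] using this

theorem isDefinedOver_yFun : IsDefinedOver k (yFun E) := by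
  have := isDefinedOver_div (E := E) (K := K) (MvPolynomial.isHomogeneous_X k (1 : Fin 3))
    (MvPolynomial.isHomogeneous_X k (2 : Fin 3))
  simpa [dehom] using this

variable (k E) in
/-- The field of the rational functions that are defined over `k`. -/
def definedOver : Subfield (FF E) where
  carrier := {g | IsDefinedOver k g}
  mul_mem' := IsDefinedOver.mul
  one_mem' := by simpa using isDefinedOver_algebraMap (E := E) (K := K) (1 : k)
  add_mem' := IsDefinedOver.add
  zero_mem' := by simpa using isDefinedOver_algebraMap (E := E) (K := K) (0 : k)
  neg_mem' {x} hx := by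
    have := (isDefinedOver_algebraMap (E := E) (K := K) (-1 : k)).mul hx
    simpa using this
  inv_mem' _ := IsDefinedOver.inv

theorem mem_definedOver {g : FF E} : g ∈ definedOver k E ↔ IsDefinedOver k g := Iff.rfl

theorem algebraMap_mem_definedOver (c : k) :
    algebraMap K (FF E) (algebraMap k K c) ∈ definedOver k E := isDefinedOver_algebraMap c

theorem evalEval_mem_definedOver (p : Polynomial k[X]) {x y : FF E} (hx : x ∈ definedOver k E)
    (hy : y ∈ definedOver k E) : (p.map (Polynomial.mapRingHom
      ((algebraMap K (FF E)).comp (algebraMap k K)))).evalEval x y ∈ definedOver k E := by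
  induction p using Polynomial.induction_on' with
  | add p q hp hq => rw [Polynomial.map_add, Polynomial.evalEval_add]; exact add_mem hp hq
  | monomial n a =>
    rw [← Polynomial.C_mul_X_pow_eq_monomial, Polynomial.map_mul, Polynomial.map_pow, Polynomial.map_X,
      Polynomial.map_C, Polynomial.evalEval_mul, Polynomial.evalEval_pow, Polynomial.evalEval_X,
      Polynomial.evalEval_C]
    refine mul_mem ?_ (pow_mem hy n)
    induction a using Polynomial.induction_on' with
    | add p q hp hq => rw [map_add, Polynomial.eval_add]; exact add_mem hp hq
    | monomial m c =>
      simp only [Polynomial.coe_mapRingHom, Polynomial.map_monomial, Polynomial.eval_monomial]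
      exact mul_mem (algebraMap_mem_definedOver c) (pow_mem hx m)

end DefinedOver

/-! ### Translation by a rational point preserves the field of definition -/

section TransDefined

open scoped Classical

variable {k K : Type*} [Field k] [Field K] [DecidableEq K] [Algebra k K] {W : WeierstrassCurve k}
  [IsAlgClosed K] [W.IsElliptic]

theorem generic_add_mem (S : (W⁄K).toAffine.Point) {x₀ y₀ : k} (hx : xc S = algebraMap k K x₀)
    (hy : yc S = algebraMap k K y₀) :
    xc (genericPoint (W⁄K) + constPoint (W⁄K) S) ∈ definedOver k (W⁄K) ∧
    yc (genericPoint (W⁄K) + constPoint (W⁄K) S) ∈ definedOver k (W⁄K) := by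
  have hX : xFun (W⁄K) ∈ definedOver k (W⁄K) := isDefinedOver_xFun
  have hY : yFun (W⁄K) ∈ definedOver k (W⁄K) := isDefinedOver_yFun
  by_cases hS : S = 0
  · rw [hS, map_zero, add_zero]
    exact ⟨hX, hY⟩
  have hS' := constPoint_ne_zero hS
  have hη := genericPoint_ne_zero (W⁄K)
  have hne : xc (genericPoint (W⁄K)) ≠ xc (constPoint (W⁄K) S) := by
    rw [xc_constPoint]; exact xFun_ne_algebraMap _ _
  have e1 := slope_add hη hS' hne
  have e2 := slope_add_y hη hS' hne
  have hxS : xc (constPoint (W⁄K) S) ∈ definedOver k (W⁄K) := by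
    rw [xc_constPoint, hx]; exact algebraMap_mem_definedOver x₀
  have hyS : yc (constPoint (W⁄K) S) ∈ definedOver k (W⁄K) := by
    rw [yc_constPoint, hy]; exact algebraMap_mem_definedOver y₀
  have h1 : ((W⁄K)⁄(FF (W⁄K))).a₁ ∈ definedOver k (W⁄K) := algebraMap_mem_definedOver W.a₁
  have h2 : ((W⁄K)⁄(FF (W⁄K))).a₂ ∈ definedOver k (W⁄K) := algebraMap_mem_definedOver W.a₂
  have h3 : ((W⁄K)⁄(FF (W⁄K))).a₃ ∈ definedOver k (W⁄K) := algebraMap_mem_definedOver W.a₃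
  have hl := div_mem (sub_mem hY hyS) (sub_mem hX hxS)
  have hmx : xc (genericPoint (W⁄K) + constPoint (W⁄K) S) ∈ definedOver k (W⁄K) := by
    rw [e1]
    exact sub_mem (sub_mem (sub_mem (add_mem (pow_mem hl 2) (mul_mem h1 hl)) h2) hX) hxS
  refine ⟨hmx, ?_⟩
  rw [e2]
  exact sub_mem (sub_mem (neg_mem (add_mem (mul_mem hl (sub_mem hmx hX)) hY)) (mul_mem h1 hmx)) h3

/-- The division polynomials have coefficients in `K`, which `φ` fixes. -/
theorem wv_mapPoint {E : WeierstrassCurve K} (φ : FF E →ₐ[K] FF E) (A : FP E) (n : ℤ) :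
    wv (mapPoint φ A) n = φ (wv A n) := by
  have h : (E⁄(FF E)).ψ n = ((E⁄(FF E)).ψ n).map (Polynomial.mapRingHom (φ : FF E →+* FF E)) :=
    baseChange_ψ (W := E) (f := φ) n
  rw [wv, wv, xc_mapPoint, yc_mapPoint]
  conv_lhs => rw [h]
  exact Polynomial.map_mapRingHom_evalEval (φ : FF E →+* FF E) _ _ _

theorem trans_wv {E : WeierstrassCurve K} [E.IsElliptic] (S : E.toAffine.Point) (n : ℤ) :
    trans S (wv (genericPoint E) n) = wv (genericPoint E + constPoint E S) n := by
  rw [← wv_mapPoint, mapPoint_trans]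

theorem isDefinedOver_trans_wv (S : (W⁄K).toAffine.Point) {x₀ y₀ : k} (hx : xc S = algebraMap k K x₀)
    (hy : yc S = algebraMap k K y₀) (n : ℤ) : IsDefinedOver k (trans S (wv (genericPoint (W⁄K)) n)) := by
  rw [trans_wv, wv]
  obtain ⟨h1, h2⟩ := generic_add_mem S hx hy
  have h : ((W⁄K)⁄(FF (W⁄K))).ψ n = (W.ψ n).map (Polynomial.mapRingHom
      ((algebraMap K (FF (W⁄K))).comp (algebraMap k K))) := by
    rw [← map_ψ]; rfl
  rw [h]
  exact evalEval_mem_definedOver _ h1 h2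

end TransDefined

/-! ## Extension to a morphism -/

section Descent

variable {k K : Type*} [Field k] [Field K] [Algebra k K] {σ : Type*}

/-- Apply a linear functional to the coefficients of a polynomial. -/
def mapCoeff (φ : K →ₗ[k] k) (A : MvPolynomial σ K) : MvPolynomial σ k :=
  ∑ m ∈ A.support, MvPolynomial.monomial m (φ (A.coeff m))

theorem coeff_mapCoeff (φ : K →ₗ[k] k) (A : MvPolynomial σ K) (m : σ →₀ ℕ) :
    (mapCoeff φ A).coeff m = φ (A.coeff m) := by
  classical
  rw [mapCoeff, MvPolynomial.coeff_sum]
  simp only [MvPolynomial.coeff_monomial, Finset.sum_ite_eq']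
  split_ifs with h
  · rfl
  · rw [MvPolynomial.notMem_support_iff.mp h, map_zero]

theorem mapCoeff_add (φ : K →ₗ[k] k) (A B : MvPolynomial σ K) :
    mapCoeff φ (A + B) = mapCoeff φ A + mapCoeff φ B := by
  ext m; simp [coeff_mapCoeff]

theorem mapCoeff_sub (φ : K →ₗ[k] k) (A B : MvPolynomial σ K) :
    mapCoeff φ (A - B) = mapCoeff φ A - mapCoeff φ B := by
  ext m; simp [coeff_mapCoeff]

theorem mapCoeff_mul (φ : K →ₗ[k] k) (A : MvPolynomial σ K) (B : MvPolynomial σ k) :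
    mapCoeff φ (A * B.map (algebraMap k K)) = mapCoeff φ A * B := by
  classical
  ext m
  rw [coeff_mapCoeff, MvPolynomial.coeff_mul, MvPolynomial.coeff_mul, map_sum]
  refine Finset.sum_congr rfl fun x _ => ?_
  rw [MvPolynomial.coeff_map, coeff_mapCoeff, mul_comm, ← Algebra.smul_def, map_smul, smul_eq_mul,
    mul_comm]

theorem mapCoeff_isHomogeneous (φ : K →ₗ[k] k) {A : MvPolynomial σ K} {n : ℕ} (hA : A.IsHomogeneous n) :
    (mapCoeff φ A).IsHomogeneous n := by
  intro m hm
  refine hA fun h => hm ?_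
  rw [coeff_mapCoeff, h, map_zero]

/-- In a `k`-basis of `K` the polynomial is a combination of polynomials over `k`, its images under
the coordinate functionals. If all of these vanished at `x`, so would `A`. -/
theorem exists_mapCoeff_ne_zero {A : MvPolynomial σ K} {x : σ → K} (h : MvPolynomial.eval x A ≠ 0) :
    ∃ φ : K →ₗ[k] k, MvPolynomial.aeval x (mapCoeff φ A) ≠ 0 := by
  by_contra! hc
  apply h
  let e := Module.Basis.ofVectorSpace k K
  have h1 : ∀ φ : K →ₗ[k] k, ∑ m ∈ A.support, algebraMap k K (φ (A.coeff m)) * m.prod (fun i n => x i ^ n) = 0 := by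
    intro φ
    rw [← hc φ, mapCoeff, map_sum]
    simp only [MvPolynomial.aeval_monomial]
  classical
  let S : Finset _ := A.support.biUnion fun m => (e.repr (A.coeff m)).support
  have h2 : ∀ m ∈ A.support, A.coeff m = ∑ t ∈ S, algebraMap k K (e.coord t (A.coeff m)) * e t := by
    intro m hm
    conv_lhs => rw [← e.linearCombination_repr (A.coeff m)]
    rw [Finsupp.linearCombination_apply, Finsupp.sum]
    simp only [Algebra.smul_def]
    refine Finset.sum_subset (fun t ht => Finset.mem_biUnion.mpr ⟨m, hm, ht⟩) fun t _ ht => ?_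
    rw [Finsupp.notMem_support_iff.mp ht, map_zero, zero_mul]
  rw [MvPolynomial.eval_eq]
  calc _ = ∑ m ∈ A.support, ∑ t ∈ S, e t * (algebraMap k K (e.coord t (A.coeff m)) *
        m.prod (fun i n => x i ^ n)) := by
        refine Finset.sum_congr rfl fun m hm => ?_
        conv_lhs => rw [h2 m hm]
        rw [Finset.sum_mul]
        refine Finset.sum_congr rfl fun t _ => ?_
        rw [Finsupp.prod]
        ring
    _ = 0 := by
        rw [Finset.sum_comm]
        refine Finset.sum_eq_zero fun t _ => ?_
        rw [← Finset.mul_sum, h1, mul_zero]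

end Descent

/-! ### The ideal of the affine curve in three variables -/

section Kernel

variable {R : Type*} [CommRing R]

/-- The Weierstrass polynomial as a polynomial in the first two of three variables. -/
def weierstrassMv (W : WeierstrassCurve R) : MvPolynomial (Fin 3) R :=
  .X 1 ^ 2 + .C W.a₁ * .X 0 * .X 1 + .C W.a₃ * .X 1 -
    (.X 0 ^ 3 + .C W.a₂ * .X 0 ^ 2 + .C W.a₄ * .X 0 + .C W.a₆)

variable {K : Type*} [Field K] {E : WeierstrassCurve K}

/-- Polynomials in `X` and `Y` as polynomials in three variables. -/
def mvOfPoly : Polynomial K[X] →+* MvPolynomial (Fin 3) K :=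
  Polynomial.eval₂RingHom (Polynomial.eval₂RingHom MvPolynomial.C (MvPolynomial.X 0)) (MvPolynomial.X 1)

theorem mvOfPoly_polynomial : mvOfPoly E.toAffine.polynomial = weierstrassMv E := by
  simp [mvOfPoly, Affine.polynomial, weierstrassMv, Polynomial.eval₂_pow]
  ring

theorem exists_mvOfPoly_dehPoly (A : MvPolynomial (Fin 3) K) :
    ∃ B, A = mvOfPoly (dehPoly A) + B * (MvPolynomial.X 2 - 1) := by
  induction A using MvPolynomial.induction_on with
  | C a => exact ⟨0, by simp [mvOfPoly, dehPoly]⟩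
  | add p q hp hq =>
    obtain ⟨B, hB⟩ := hp
    obtain ⟨C, hC⟩ := hq
    exact ⟨B + C, by rw [map_add, map_add]; linear_combination hB + hC⟩
  | mul_X p i hp =>
    obtain ⟨B, hB⟩ := hp
    rw [map_mul, map_mul]
    fin_cases i
    · refine ⟨B * MvPolynomial.X 0, ?_⟩
      have : mvOfPoly (dehPoly (MvPolynomial.X 0 : MvPolynomial (Fin 3) K)) = .X 0 := by
        simp [mvOfPoly, dehPoly]
      simp only [Fin.zero_eta, this]
      linear_combination MvPolynomial.X 0 * hB
    · refine ⟨B * MvPolynomial.X 1, ?_⟩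
      have : mvOfPoly (dehPoly (MvPolynomial.X 1 : MvPolynomial (Fin 3) K)) = .X 1 := by
        simp [mvOfPoly, dehPoly]
      simp only [Fin.mk_one, this]
      linear_combination MvPolynomial.X 1 * hB
    · refine ⟨B + p, ?_⟩
      have : mvOfPoly (dehPoly (MvPolynomial.X 2 : MvPolynomial (Fin 3) K)) = 1 := by
        simp [mvOfPoly, dehPoly]
      simp only [Fin.reduceFinMk, this]
      linear_combination hB

/-- For a curve defined over `k` both generators have coefficients in `k`, so membership in the
ideal survives coefficientwise `k`-linear functionals. -/
theorem dehom_eq_zero_iff (A : MvPolynomial (Fin 3) K) : dehom E A = 0 ↔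
    ∃ B C, A = B * (MvPolynomial.X 2 - 1) + C * weierstrassMv E := by
  constructor
  · intro h
    rw [dehom_eq, polyFun_apply, map_eq_zero_iff _ (algebraMap_FF_injective E)] at h
    obtain ⟨q, hq⟩ := AdjoinRoot.mk_eq_zero.mp h
    obtain ⟨B, hB⟩ := exists_mvOfPoly_dehPoly A
    refine ⟨B, mvOfPoly q, ?_⟩
    rw [hq, map_mul, mvOfPoly_polynomial] at hB
    linear_combination hB
  · rintro ⟨B, C, rfl⟩
    have h2 : dehom E (MvPolynomial.X 2 - 1) = 0 := by simp [dehom]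
    have h3 : dehom E (weierstrassMv E) = 0 := by
      simp [dehom, weierstrassMv]
      linear_combination generic_equation (E := E)
    rw [dehom_add, dehom_mul, dehom_mul, h2, h3, mul_zero, mul_zero, add_zero]

end Kernel

/-! ### Extension of a family of rational functions to a morphism -/

section Extension

variable {K : Type*} [Field K] {E : WeierstrassCurve K} {l : ℕ}

/-- Functions `g j` have a common multiplier after which they are regular at `T`, with values that
do not all vanish. -/
theorem exists_scaling {g : Fin (l + 1) → FF E} (hg : ∀ j, g j ≠ 0) (T : E.toAffine.Point) :
    ∃ (j₀ : Fin (l + 1)) (v : Fin (l + 1) → K), (∀ j, HasValue T (g j / g j₀) (v j)) ∧ v j₀ = 1 := by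
  obtain ⟨j₀, h⟩ := Finite.exists_min fun j => ord T (g j)
  have hreg : ∀ j, IsRegularAt T (g j / g j₀) := fun j => by
    rw [isRegularAt_iff (div_ne_zero (hg j) (hg j₀)), ord_div _ (hg j) (hg j₀)]
    have := h j
    omega
  choose v hv using hreg
  refine ⟨j₀, v, hv, (hv j₀).unique ?_⟩
  rw [div_self (hg j₀)]
  exact hasValue_one T

/-- The ratio of the two multipliers has a value at `T`, computed at an index where `v` is nonzero,
and this value is the proportionality factor. -/
theorem scaling_unique {g : Fin (l + 1) → FF E} {T : E.toAffine.Point} {r s : FF E}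
    {v w : Fin (l + 1) → K} (hv : ∀ j, HasValue T (r * g j) (v j)) (hw : ∀ j, HasValue T (s * g j) (w j))
    (hv0 : v ≠ 0) (hw0 : w ≠ 0) : Projectivization.mk K v hv0 = Projectivization.mk K w hw0 := by
  obtain ⟨j, hj⟩ := Function.ne_iff.mp hv0
  rw [eq_comm, Projectivization.mk_eq_mk_iff']
  refine ⟨w j / v j, ?_⟩
  have h1 := (hw j).div (hv j) hj
  have h0 := (hv j).ne_zero hj
  ext i
  refine (h1.mul (hv i)).unique ?_
  convert hw i using 1
  have hgj := right_ne_zero_of_mul h0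
  have hr := left_ne_zero_of_mul h0
  field_simp

theorem isHomogeneous_mul_prod_erase {R ι : Type*} [CommSemiring R] [Fintype ι] [DecidableEq ι] {σ : Type*}
    {n : ι → ℕ} {A B : ι → MvPolynomial σ R} (hA : ∀ i, (A i).IsHomogeneous (n i))
    (hB : ∀ i, (B i).IsHomogeneous (n i)) (j : ι) :
    (A j * ∏ i ∈ Finset.univ.erase j, B i).IsHomogeneous (∑ i, n i) := by
  rw [← Finset.add_sum_erase _ _ (Finset.mem_univ j)]
  exact (hA j).mul (MvPolynomial.IsHomogeneous.prod _ _ _ fun i _ => hB i)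

theorem dehom_mul_prod_erase {ι : Type*} [Fintype ι] [DecidableEq ι] {A B : ι → MvPolynomial (Fin 3) K}
    {g : ι → FF E} (hB : ∀ i, dehom E (B i) ≠ 0) (hg : ∀ i, g i = dehom E (A i) / dehom E (B i)) (j : ι) :
    dehom E (A j * ∏ i ∈ Finset.univ.erase j, B i) = g j * ∏ i, dehom E (B i) := by
  rw [dehom_mul, ← Finset.mul_prod_erase _ _ (Finset.mem_univ j), hg j, ← mul_assoc,
    div_mul_cancel₀ _ (hB j)]
  congr 1
  exact map_prod _ _ _

theorem exists_form_ne_zero (T : E.toAffine.Point) (n : ℕ) : ∃ B : MvPolynomial (Fin 3) K,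
    B.IsHomogeneous n ∧ MvPolynomial.eval (coords T) B ≠ 0 := by
  by_cases hT : T = 0
  · subst hT
    exact ⟨.X 1 ^ n, MvPolynomial.isHomogeneous_X_pow _ _, by simp [coords_zero]⟩
  · exact ⟨.X 2 ^ n, MvPolynomial.isHomogeneous_X_pow _ _, by simp [coords_of_ne_zero hT]⟩

variable {k : Type*} [Field k] [Algebra k K] {W : WeierstrassCurve k}

theorem weierstrassMv_map : weierstrassMv (W⁄K) = (weierstrassMv W).map (algebraMap k K) := by
  simp only [weierstrassMv, map_sub, map_add, map_mul, map_pow, MvPolynomial.map_X, MvPolynomial.map_C]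
  rfl

/-- A relation with multipliers over `k` is an ideal membership whose generators are over `k`, and
`mapCoeff φ` is linear over polynomials with coefficients in `k`. -/
theorem dehom_map_mapCoeff_eq {A B : MvPolynomial (Fin 3) K} {G H : MvPolynomial (Fin 3) k}
    (h : dehom (W⁄K) A * dehom (W⁄K) (G.map (algebraMap k K)) =
      dehom (W⁄K) B * dehom (W⁄K) (H.map (algebraMap k K))) (φ : K →ₗ[k] k) :
    dehom (W⁄K) ((mapCoeff φ A).map (algebraMap k K)) * dehom (W⁄K) (G.map (algebraMap k K)) =
      dehom (W⁄K) ((mapCoeff φ B).map (algebraMap k K)) * dehom (W⁄K) (H.map (algebraMap k K)) := by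
  have hX : (MvPolynomial.X 2 - 1 : MvPolynomial (Fin 3) K) =
      MvPolynomial.map (algebraMap k K) (MvPolynomial.X 2 - 1 : MvPolynomial (Fin 3) k) := by
    simp
  rw [← dehom_mul, ← dehom_mul, ← sub_eq_zero, ← dehom_sub, dehom_eq_zero_iff, weierstrassMv_map,
    hX] at h ⊢
  obtain ⟨C, D, h⟩ := h
  refine ⟨(mapCoeff φ C).map (algebraMap k K), (mapCoeff φ D).map (algebraMap k K), ?_⟩
  have := congrArg (mapCoeff φ) h
  rw [mapCoeff_sub, mapCoeff_add, mapCoeff_mul, mapCoeff_mul, mapCoeff_mul, mapCoeff_mul] at this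
  rw [← map_mul, ← map_mul, ← map_mul, ← map_mul, ← map_sub, this, map_add]

theorem aeval_eq_eval_map (x : Fin 3 → K) (A : MvPolynomial (Fin 3) k) :
    MvPolynomial.aeval x A = MvPolynomial.eval x (A.map (algebraMap k K)) := by
  rw [MvPolynomial.eval_map, MvPolynomial.aeval_def]

/-- A family of nonzero rational functions over `k` extends to a morphism to projective space. -/
theorem exists_isMorphism {g : Fin (l + 1) → FF (W⁄K)} (hg : ∀ j, g j ≠ 0)
    (hk : ∀ j, IsDefinedOver k (g j)) :
    ∃ f : (W⁄K).toAffine.Point → Projectivization K (Fin (l + 1) → K), IsMorphism k f ∧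
      ∀ (T : (W⁄K).toAffine.Point) (r : FF (W⁄K)) (v : Fin (l + 1) → K),
        (∀ j, HasValue T (r * g j) (v j)) → ∀ hv : v ≠ 0, f T = Projectivization.mk K v hv := by
  have hex : ∀ T : (W⁄K).toAffine.Point, ∃ p : Projectivization K (Fin (l + 1) → K),
      ∀ (r : FF (W⁄K)) (v : Fin (l + 1) → K), (∀ j, HasValue T (r * g j) (v j)) →
        ∀ hv : v ≠ 0, p = Projectivization.mk K v hv := by
    intro T
    obtain ⟨j₀, v, hv, h1⟩ := exists_scaling hg T
    have hv0 : v ≠ 0 := by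
      rintro rfl
      exact zero_ne_one h1
    exact ⟨Projectivization.mk K v hv0, fun r w hw hw0 =>
      scaling_unique (r := (g j₀)⁻¹) (fun j => by rw [inv_mul_eq_div]; exact hv j) hw hv0 hw0⟩
  choose f hf using hex
  refine ⟨f, fun Q => ?_, hf⟩
  choose n' G₀ H₀ hG₀ hH₀ hH0 hgG using hk
  have hG := dehom_mul_prod_erase hH0 hgG
  obtain ⟨j₀, v, hv, hv1⟩ := exists_scaling hg Q
  choose n A B hA hB hB0 hgA hvA using hv
  have hBne := fun i => dehom_ne_zero (hB i) (hB0 i)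
  have hA' := dehom_mul_prod_erase hBne hgA
  have hA'Q : MvPolynomial.eval (coords Q) (A j₀ * ∏ i ∈ Finset.univ.erase j₀, B i) ≠ 0 := by
    rw [map_mul, map_prod]
    refine mul_ne_zero (fun h => ?_) (Finset.prod_ne_zero_iff.mpr fun i _ => hB0 i)
    have := hvA j₀
    rw [hv1, h, zero_div] at this
    exact one_ne_zero this
  -- On common denominators the local forms over `K` are proportional to the global forms over `k`,
  -- because both represent the `g j` up to a common factor.
  have hrel : ∀ i j, dehom (W⁄K) (A j * ∏ i ∈ Finset.univ.erase j, B i) *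
      dehom (W⁄K) ((G₀ i * ∏ j ∈ Finset.univ.erase i, H₀ j).map (algebraMap k K)) =
      dehom (W⁄K) (A i * ∏ j ∈ Finset.univ.erase i, B j) *
      dehom (W⁄K) ((G₀ j * ∏ i ∈ Finset.univ.erase j, H₀ i).map (algebraMap k K)) := by
    intro i j
    rw [map_mul, map_mul, map_prod, map_prod, hA', hA', hG, hG]
    ring
  have hhom := isHomogeneous_mul_prod_erase hA hB
  set A' := fun j => A j * ∏ i ∈ Finset.univ.erase j, B i with hA'd
  -- Applying `φ` to the coefficients gives forms over `k` with the same proportions, and the form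
  -- with index `j₀` still does not vanish at `Q`.
  obtain ⟨φ, hφ⟩ := exists_mapCoeff_ne_zero (k := k) hA'Q
  have hrel' := fun i j => dehom_map_mapCoeff_eq (hrel i j) φ
  have hprop : ∀ j, dehom (W⁄K) ((mapCoeff φ (A' j)).map (algebraMap k K)) =
      dehom (W⁄K) ((mapCoeff φ (A' j₀)).map (algebraMap k K)) / g j₀ * g j := by
    intro j
    have h := hrel' j₀ j
    rw [map_mul, map_mul, map_prod, map_prod, hG, hG, ← mul_assoc, ← mul_assoc] at h
    have h := mul_right_cancel₀ (Finset.prod_ne_zero_iff.mpr fun i _ => hH0 i) h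
    rw [div_mul_eq_mul_div, eq_div_iff (hg j₀)]
    exact h
  refine ⟨∑ i, n i, fun j => mapCoeff φ (A' j), fun j => mapCoeff_isHomogeneous φ (hhom j),
    fun h => hφ (congrFun h j₀), fun T hT => ?_⟩
  -- Dividing by a form of the same degree that does not vanish at `T` turns the values of forms
  -- into values of functions.
  obtain ⟨B', hB', hB'T⟩ := exists_form_ne_zero T (∑ i, n i)
  have hval : ∀ j, HasValue T (dehom (W⁄K) ((mapCoeff φ (A' j₀)).map (algebraMap k K)) / g j₀ / dehom _ B' * g j)
      (MvPolynomial.aeval (coords T) (mapCoeff φ (A' j)) / MvPolynomial.eval (coords T) B') := by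
    intro j
    refine ⟨_, _, B', (mapCoeff_isHomogeneous φ (hhom j)).map (algebraMap k K), hB', hB'T, ?_, ?_⟩
    · rw [hprop j]; ring
    · rw [aeval_eq_eval_map]
  have hne : (fun j => (MvPolynomial.aeval (coords T) (mapCoeff φ (A' j)) : K) /
      MvPolynomial.eval (coords T) B') ≠ 0 := by
    intro h
    apply hT
    ext j
    have := congrFun h j
    simpa [hB'T] using this
  rw [hf T _ _ hval hne, Projectivization.mk_eq_mk_iff']
  refine ⟨(MvPolynomial.eval (coords T) B')⁻¹, ?_⟩
  ext j
  simp [div_eq_inv_mul]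

end Extension

/-! ### Orders of division polynomials at torsion points -/

section Multiplicity

open scoped Classical

variable {K : Type*} [Field K] [DecidableEq K] {E : WeierstrassCurve K} [E.IsElliptic] [IsAlgClosed K]
  {T : E.toAffine.Point} {n : ℕ}

variable (E) in
/-- The multiplicity of multiplication by `n` at torsion points, read off from a division polynomial. -/
def torsionMult (n : ℕ) : ℤ := n ^ 2 + ord 0 (wv (genericPoint E) n)

/-- At an `n`-torsion point `Φₙ` is `-ψₙ₊₁ψₙ₋₁`, and `(n ± 1)T = ±T` is not zero. -/
theorem Phi_eval_ne_zero (hT : T ≠ 0) (hn : n • T = 0) : (E.Φ n).eval (xc T) ≠ 0 := by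
  rw [← phi_eval hT, (wv_eq_zero_iff hT n).mpr (by simpa using hn), zero_pow two_ne_zero, mul_zero, zero_sub,
    neg_ne_zero]
  refine mul_ne_zero ?_ ?_
  · rw [ne_eq, wv_eq_zero_iff hT, add_zsmul, natCast_zsmul, hn]
    simpa using hT
  · rw [ne_eq, wv_eq_zero_iff hT, sub_zsmul, natCast_zsmul, hn]
    simpa using hT

theorem isCoprime_Phi_PsiSq (n : ℕ) : IsCoprime (E.Φ n) (E.ΨSq n) := by
  rw [Polynomial.isCoprime_iff_aeval_ne_zero_of_isAlgClosed K K]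
  intro x
  obtain ⟨T, hT, rfl⟩ := exists_xc_eq (E := E) x
  simp only [Polynomial.coe_aeval_eq_eval]
  by_cases hn : n • T = 0
  · exact Or.inl (Phi_eval_ne_zero hT hn)
  · right
    rw [← wv_sq hT]
    exact pow_ne_zero _ fun h => hn (by simpa using (wv_eq_zero_iff hT n).mp h)

theorem Phi_ne_zero (n : ℕ) : E.Φ n ≠ 0 := by
  intro h
  have := E.leadingCoeff_Φ (n := n)
  rw [h] at this
  simp at this

theorem wv_generic_ne_zero (hn : 1 ≤ n) : wv (genericPoint E) n ≠ 0 := (wv_generic_mul hn).1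

theorem ord_wv_generic_sq (T : E.toAffine.Point) :
    ord T (Polynomial.aeval (xFun E) (E.ΨSq n)) = 2 * ord T (wv (genericPoint E) n) := by
  rw [← wv_sq_generic, ord_pow]
  norm_num

theorem xc_nsmul_generic_ne_zero (hn : 1 ≤ n) : xc (n • genericPoint E) ≠ 0 := by
  rw [← map_zero (algebraMap K (FF E))]
  exact (isMoving_nsmul hn).2 0

theorem ord_xc_nsmul_add (hn : 1 ≤ n) (T : E.toAffine.Point) : ord T (xc (n • genericPoint E)) +
    2 * ord T (wv (genericPoint E) n) = ord T (Polynomial.aeval (xFun E) (E.Φ n)) := by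
  rw [← xc_nsmul_generic_mul hn, ord_mul _ (xc_nsmul_generic_ne_zero hn)
    (aeval_xFun_ne_zero (PsiSq_ne_zero hn)), ord_wv_generic_sq]

/-- As `x` has a double pole at infinity, `torsionMult` is the ramification index of multiplication
by `n` at the origin. -/
theorem ord_zero_xc_nsmul (hn : 1 ≤ n) : ord 0 (xc (n • genericPoint E)) = -2 * torsionMult E n := by
  have h := ord_xc_nsmul_add hn (0 : E.toAffine.Point)
  rw [ord_zero_aeval (Phi_ne_zero n), natDegree_Φ] at h
  rw [torsionMult]
  simp only [Int.natAbs_natCast, Nat.cast_pow] at h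
  linarith

/-- This invariance carries the pole order at the origin to every `n`-torsion point. -/
theorem trans_xc_nsmul (hn : n • T = 0) :
    trans T (xc (n • genericPoint E)) = xc (n • genericPoint E) := by
  rw [← xc_mapPoint, map_nsmul, mapPoint_trans, nsmul_add, ← map_nsmul, hn, map_zero, add_zero]

theorem ord_xc_nsmul (h1 : 1 ≤ n) (hn : n • T = 0) :
    ord T (xc (n • genericPoint E)) = -2 * torsionMult E n := by
  rw [← ord_zero_xc_nsmul h1]
  conv_rhs => rw [← trans_xc_nsmul hn, ord_trans, zero_add]

theorem ord_wv_of_nsmul_eq_zero (h1 : 1 ≤ n) (hT : T ≠ 0) (hn : n • T = 0) :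
    ord T (wv (genericPoint E) n) = torsionMult E n := by
  have h := ord_xc_nsmul_add h1 T
  rw [ord_xc_nsmul h1 hn, ((hasValue_xFun hT).aeval (E.Φ n)).ord_eq (Phi_eval_ne_zero hT hn)] at h
  linarith

theorem hasValue_wv_generic (hT : T ≠ 0) (n : ℤ) : HasValue T (wv (genericPoint E) n) (wv T n) := by
  rw [wv_genericPoint]
  exact hasValue_polyFun hT _

theorem ord_wv_of_nsmul_ne_zero (hn : n • T ≠ 0) : ord T (wv (genericPoint E) n) = 0 := by
  have hT : T ≠ 0 := fun h => hn (by rw [h, nsmul_zero])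
  refine (hasValue_wv_generic hT n).ord_eq ?_
  rw [ne_eq, wv_eq_zero_iff hT, natCast_zsmul]
  exact hn

theorem ord_wv (h1 : 1 ≤ n) (T : E.toAffine.Point) : ord T (wv (genericPoint E) n) =
    (if n • T = 0 then torsionMult E n else 0) - if T = 0 then (n : ℤ) ^ 2 else 0 := by
  by_cases hT : T = 0
  · subst hT
    simp [torsionMult]
  · split_ifs with hn
    · rw [ord_wv_of_nsmul_eq_zero h1 hT hn, sub_zero]
    · rw [ord_wv_of_nsmul_ne_zero hn, sub_zero]

/-- A polynomial in `x` with zero set `S` has total order `2 deg p` on the affine part. -/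
theorem sum_ord_aeval {p : K[X]} (hp : p ≠ 0) {S : Finset E.toAffine.Point}
    (hS : ∀ T, T ∈ S ↔ T ≠ 0 ∧ p.eval (xc T) = 0) :
    ∑ T ∈ S, ord T (Polynomial.aeval (xFun E) p) = 2 * p.natDegree := by
  have h1 : ∀ x ∈ p.roots.toFinset, ∑ T ∈ S with xc T = x, ord T (Polynomial.aeval (xFun E) p) =
      2 * p.rootMultiplicity x := by
    intro x hx
    rw [Multiset.mem_toFinset, Polynomial.mem_roots hp] at hx
    obtain ⟨R, hR, rfl⟩ := exists_xc_eq (E := E) x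
    have hfil : S.filter (fun T => xc T = xc R) = {R, -R} := by
      ext T
      simp only [Finset.mem_filter, hS, Finset.mem_insert, Finset.mem_singleton]
      constructor
      · rintro ⟨⟨hT, -⟩, h⟩
        exact (xc_eq_iff hT hR).mp h
      · intro h
        have hT : T ≠ 0 := by
          rintro rfl
          rcases h with h | h
          · exact hR h.symm
          · exact hR (by rw [eq_comm, neg_eq_zero] at h; exact h)
        have h := (xc_eq_iff hT hR).mpr h
        rw [h]
        exact ⟨⟨hT, hx⟩, rfl⟩
    rw [hfil]
    have hR' : -R ≠ 0 := neg_ne_zero.mpr hR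
    by_cases hRR : R = -R
    · rw [← hRR, Finset.pair_eq_singleton, Finset.sum_singleton, ord_aeval hR hp, ord_xFun_sub hR hR,
        if_pos rfl, if_pos hRR]
      ring
    · rw [Finset.sum_pair hRR, ord_aeval hR hp, ord_aeval hR' hp, xc_neg, ord_xFun_sub hR hR,
        ord_xFun_sub hR' hR, if_pos rfl, if_neg hRR, if_pos rfl, if_neg (Ne.symm hRR)]
      ring
  rw [← Finset.sum_fiberwise_of_maps_to (g := xc) (t := p.roots.toFinset), Finset.sum_congr rfl h1,
    ← Finset.mul_sum]
  · congr 1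
    rw [← IsAlgClosed.card_roots_eq_natDegree, ← Multiset.toFinset_sum_count_eq]
    push_cast
    exact Finset.sum_congr rfl fun x _ => by rw [Polynomial.count_roots]
  · intro T hT
    rw [Multiset.mem_toFinset, Polynomial.mem_roots hp]
    exact ((hS T).mp hT).2

theorem finite_nsmul_eq_zero (h1 : 1 ≤ n) : {T : E.toAffine.Point | n • T = 0}.Finite := by
  have hfin := ((E.ΨSq n).roots.toFinset).finite_toSet
  refine Set.Finite.subset ((Set.Finite.biUnion hfin fun x _ =>
    (?_ : {T : E.toAffine.Point | T ≠ 0 ∧ xc T = x}.Finite)).union (Set.finite_singleton 0)) ?_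
  · obtain ⟨R, hR, rfl⟩ := exists_xc_eq (E := E) x
    refine (Set.toFinite {R, -R}).subset fun T hT => ?_
    exact (xc_eq_iff hT.1 hR).mp hT.2
  · intro T hT
    by_cases h0 : T = 0
    · exact Or.inr h0
    · left
      simp only [Set.mem_iUnion]
      refine ⟨xc T, ?_, h0, rfl⟩
      rw [Finset.mem_coe, Multiset.mem_toFinset, Polynomial.mem_roots (PsiSq_ne_zero h1),
        Polynomial.IsRoot, ← wv_sq h0, (wv_eq_zero_iff h0 n).mpr (by simpa using hT), zero_pow two_ne_zero]

/-- The zeros of `ΨSqₙ` on the affine curve have total order equal to its pole order at infinity.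
Each nonzero torsion point contributes `2 * torsionMult E n`, and the pole order is `2 (n ^ 2 -
torsionMult E n)`. -/
theorem torsionMult_mul_card (h1 : 1 ≤ n) :
    torsionMult E n * Nat.card {T : E.toAffine.Point // n • T = 0} = n ^ 2 := by
  have hfin := finite_nsmul_eq_zero (E := E) h1
  have hmem : ∀ T, T ∈ hfin.toFinset.erase 0 ↔ T ≠ 0 ∧ (E.ΨSq n).eval (xc T) = 0 := by
    intro T
    rw [Finset.mem_erase, Set.Finite.mem_toFinset, Set.mem_ofPred_eq]
    refine and_congr_right fun hT => ?_
    rw [← wv_sq hT, pow_eq_zero_iff two_ne_zero, wv_eq_zero_iff hT, natCast_zsmul]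
  have hs := sum_ord_aeval (PsiSq_ne_zero h1) hmem
  have h0 := ord_zero_aeval (E := E) (PsiSq_ne_zero (E := E) h1)
  have hcard : Nat.card {T : E.toAffine.Point // n • T = 0} = (hfin.toFinset.erase 0).card + 1 := by
    rw [Finset.card_erase_add_one (by simp)]
    exact Nat.card_eq_card_finite_toFinset hfin
  rw [Finset.sum_congr rfl (g := fun _ => 2 * torsionMult E n), Finset.sum_const, nsmul_eq_mul] at hs
  · rw [ord_wv_generic_sq] at h0
    rw [hcard]
    have : torsionMult E n = n ^ 2 + ord 0 (wv (genericPoint E) n) := rfl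
    push_cast
    linarith
  · intro T hT
    rw [Finset.mem_erase, Set.Finite.mem_toFinset, Set.mem_ofPred_eq] at hT
    rw [ord_wv_generic_sq, ord_wv_of_nsmul_eq_zero h1 hT.1 hT.2]

end Multiplicity

section HomDegree

variable {K F G H : Type*} [Field K] [Field F] [Field G] [Field H] [Algebra K F] [Algebra K G] [Algebra K H]

/-- The degree of the field extension given by a homomorphism of fields. -/
def homDegree (σ : F →ₐ[K] G) : ℕ := Module.finrank σ.fieldRange G

theorem homDegree_eq (σ : F →ₐ[K] G) :
    homDegree σ = @Module.finrank F G _ _ σ.toRingHom.toAlgebra.toModule := by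
  let := σ.toRingHom.toAlgebra
  exact (Algebra.finrank_eq_of_equiv_equiv (AlgEquiv.ofInjectiveField σ).toRingEquiv (RingEquiv.refl G)
    (by ext; rfl)).symm

theorem homDegree_comp (τ : G →ₐ[K] H) (σ : F →ₐ[K] G) :
    homDegree (τ.comp σ) = homDegree σ * homDegree τ := by
  rw [homDegree_eq, homDegree_eq σ, homDegree_eq τ]
  let a := σ.toRingHom.toAlgebra
  let b := τ.toRingHom.toAlgebra
  let c := (τ.comp σ).toRingHom.toAlgebra
  have : IsScalarTower F G H := IsScalarTower.of_algebraMap_eq fun _ => rfl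
  exact (Module.finrank_mul_finrank F G H).symm

end HomDegree

/-! ### Multiplication by `n` has degree `n ^ 2` -/

section Degree

open scoped Classical IntermediateField

variable {K : Type*} [Field K]

/-- The endomorphism of the rational function field given by a nonconstant function. -/
def ratFuncHom (f : RatFunc K) (hf : ¬ ∃ c, f = RatFunc.C c) : RatFunc K →ₐ[K] RatFunc K :=
  RatFunc.liftAlgHom (Polynomial.aeval f) (nonZeroDivisors_le_comap_nonZeroDivisors_of_injective _
    (transcendental_iff_injective.mp (f.transcendental_of_ne_C hf)))

theorem ratFuncHom_X (f : RatFunc K) (hf : ¬ ∃ c, f = RatFunc.C c) : ratFuncHom f hf RatFunc.X = f := by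
  have := RatFunc.liftAlgHom_apply_div (Polynomial.aeval f) (nonZeroDivisors_le_comap_nonZeroDivisors_of_injective _
    (transcendental_iff_injective.mp (f.transcendental_of_ne_C hf))) Polynomial.X 1
  simp only [map_one, div_one, Polynomial.aeval_X, RatFunc.algebraMap_X] at this
  exact this

theorem homDegree_ratFuncHom (f : RatFunc K) (hf : ¬ ∃ c, f = RatFunc.C c) :
    homDegree (ratFuncHom f hf) = max f.num.natDegree f.denom.natDegree := by
  have h : (ratFuncHom f hf).fieldRange = K⟮f⟯ := by
    rw [AlgHom.fieldRange_eq_map, ← RatFunc.adjoin_X, IntermediateField.adjoin_map, Set.image_singleton,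
      ratFuncHom_X]
  rw [homDegree, h, RatFunc.finrank_eq_max_natDegree]

theorem algHom_ext_ratFunc {F : Type*} [Field F] [Algebra K F] {φ ψ : RatFunc K →ₐ[K] F}
    (h : φ RatFunc.X = ψ RatFunc.X) : φ = ψ := by
  have : ∀ p : K[X], φ (algebraMap _ _ p) = ψ (algebraMap _ _ p) := by
    intro p
    have hp : algebraMap K[X] (RatFunc K) p = Polynomial.aeval RatFunc.X p := by simp
    rw [hp, ← Polynomial.aeval_algHom_apply, ← Polynomial.aeval_algHom_apply, h]
  ext x
  rw [← RatFunc.num_div_denom x, map_div₀, map_div₀, this, this]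

variable (E : WeierstrassCurve K)

theorem aeval_xFun_injective : Function.Injective (Polynomial.aeval (xFun E) : K[X] →ₐ[K] FF E) :=
  (injective_iff_map_eq_zero _).mpr fun _ => aeval_xFun_eq_zero E

/-- Rational functions of `x`. -/
def ratFuncX : RatFunc K →ₐ[K] FF E :=
  RatFunc.liftAlgHom (Polynomial.aeval (xFun E))
    (nonZeroDivisors_le_comap_nonZeroDivisors_of_injective _ (aeval_xFun_injective E))

theorem ratFuncX_div (p q : K[X]) : ratFuncX E (algebraMap _ _ p / algebraMap _ _ q) =
    Polynomial.aeval (xFun E) p / Polynomial.aeval (xFun E) q :=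
  RatFunc.liftAlgHom_apply_div _ _ _ _

theorem ratFuncX_algebraMap (p : K[X]) : ratFuncX E (algebraMap _ _ p) = Polynomial.aeval (xFun E) p := by
  simpa using ratFuncX_div E p 1

theorem ratFuncX_X : ratFuncX E RatFunc.X = xFun E := by
  simpa using ratFuncX_algebraMap E Polynomial.X

theorem homDegree_ratFuncX : homDegree (ratFuncX E) = 2 := by
  rw [homDegree_eq]
  let := (ratFuncX E).toRingHom.toAlgebra
  have : IsScalarTower K[X] (RatFunc K) (FF E) := IsScalarTower.of_algebraMap_eq fun p =>
    ((ratFuncX_algebraMap E p).trans (aeval_xFun E p)).symm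
  rw [IsFractionRing.finrank_eq K[X] (RatFunc K) E.toAffine.CoordinateRing (FF E),
    Module.finrank_eq_nat_card_basis (Affine.CoordinateRing.basis E.toAffine), Nat.card_fin]

variable {E} [E.IsElliptic] [IsAlgClosed K] {n : ℕ}

theorem max_natDegree_div {p q : K[X]} (hc : IsCoprime p q) (hq : q ≠ 0) (hpq : q.natDegree < p.natDegree) :
    max (algebraMap K[X] (RatFunc K) p / algebraMap K[X] (RatFunc K) q).num.natDegree
      (algebraMap K[X] (RatFunc K) p / algebraMap K[X] (RatFunc K) q).denom.natDegree = p.natDegree := by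
  have hp : p ≠ 0 := by
    rintro rfl
    simp at hpq
  have h := (RatFunc.num_mul_eq_mul_denom_iff (x := algebraMap K[X] (RatFunc K) p / algebraMap K[X] (RatFunc K) q)
    (p := p) hq).mpr rfl
  have h1 := RatFunc.num_div_dvd p hq
  have h2 := hc.dvd_of_dvd_mul_right (h ▸ dvd_mul_right p _)
  have h3 := Polynomial.natDegree_le_of_dvd (RatFunc.denom_div_dvd p q) hq
  have h4 := Polynomial.natDegree_le_of_dvd h1 hp
  have h5 := Polynomial.natDegree_le_of_dvd h2 (ne_zero_of_dvd_ne_zero hp h1)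
  omega

theorem natDegree_PsiSq_lt (hn : 1 ≤ n) : (E.ΨSq n).natDegree < (E.Φ n).natDegree := by
  have h1 := E.natDegree_ΨSq_le n
  have h2 : 1 ≤ n ^ 2 := Nat.one_le_pow _ _ hn
  rw [natDegree_Φ]
  simp only [Int.natAbs_natCast] at *
  omega

theorem div_ne_C {p q : K[X]} (hq : q ≠ 0) (hpq : q.natDegree < p.natDegree) :
    ¬ ∃ c, algebraMap K[X] (RatFunc K) p / algebraMap K[X] (RatFunc K) q = RatFunc.C c := by
  rintro ⟨c, hc⟩
  rw [div_eq_iff (RatFunc.algebraMap_ne_zero hq), ← RatFunc.algebraMap_C, ← map_mul] at hc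
  have := Polynomial.natDegree_C_mul_le c q
  rw [← RatFunc.algebraMap_injective K hc] at this
  omega

variable [DecidableEq K]

/-- The map `x` has degree two and intertwines `[n]` with the map `Φₙ/ΨSqₙ` of the projective line.
That map has degree `n ^ 2` because the fraction is reduced, and degrees are multiplicative around
the square. -/
theorem homDegree_pull_nsmul (hn : 1 ≤ n) : homDegree (pull (isMoving_nsmul (E := E) hn)) = n ^ 2 := by
  have hf := div_ne_C (PsiSq_ne_zero (E := E) hn) (natDegree_PsiSq_lt hn)
  have h : (pull (isMoving_nsmul (E := E) hn)).comp (ratFuncX E) = (ratFuncX E).comp (ratFuncHom _ hf) := by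
    apply algHom_ext_ratFunc
    rw [AlgHom.comp_apply, AlgHom.comp_apply, ratFuncHom_X, ratFuncX_X, pull_xFun, ratFuncX_div,
      eq_div_iff (aeval_xFun_ne_zero (PsiSq_ne_zero hn)), xc_nsmul_generic_mul hn]
  have hd := congrArg homDegree h
  rw [homDegree_comp, homDegree_comp, homDegree_ratFuncX, homDegree_ratFuncHom,
    max_natDegree_div (isCoprime_Phi_PsiSq n) (PsiSq_ne_zero hn) (natDegree_PsiSq_lt hn), natDegree_Φ] at hd
  simp only [Int.natAbs_natCast] at hd
  omega

variable (E) in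
theorem adjoin_xFun_yFun : K⟮xFun E, yFun E⟯ = ⊤ := by
  rw [eq_top_iff]
  intro g _
  have hx : xFun E ∈ K⟮xFun E, yFun E⟯ := IntermediateField.subset_adjoin _ _ (by simp)
  have hy : yFun E ∈ K⟮xFun E, yFun E⟯ := IntermediateField.subset_adjoin _ _ (by simp)
  have key : ∀ p, polyFun E p ∈ K⟮xFun E, yFun E⟯ := by
    intro p
    induction p using Polynomial.induction_on' with
    | add p q hp hq => rw [map_add]; exact add_mem hp hq
    | monomial n a =>
      rw [← Polynomial.C_mul_X_pow_eq_monomial, map_mul, map_pow, polyFun_X, polyFun_apply, ← aeval_xFun]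
      refine mul_mem ?_ (pow_mem hy n)
      have h := IntermediateField.aeval_coe K⟮xFun E, yFun E⟯ ⟨xFun E, hx⟩ a
      exact h ▸ SetLike.coe_mem _
  obtain ⟨a, b, hb, rfl⟩ := IsFractionRing.div_surjective (A := E.toAffine.CoordinateRing) g
  obtain ⟨r, rfl⟩ := Ideal.Quotient.mk_surjective a
  obtain ⟨s, rfl⟩ := Ideal.Quotient.mk_surjective b
  exact div_mem (key r) (key s)

theorem finrank_adjoin_nsmul (hn : 1 ≤ n) :
    Module.finrank K⟮xc (n • genericPoint E), yc (n • genericPoint E)⟯ (FF E) = n ^ 2 := by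
  rw [← homDegree_pull_nsmul (E := E) hn, homDegree, AlgHom.fieldRange_eq_map, ← adjoin_xFun_yFun E,
    IntermediateField.adjoin_map, Set.image_pair, pull_xFun, pull_yFun]

end Degree

/-! ### The separable degree of multiplication by `n` is the number of `n`-torsion points -/

section SeparableDegree

open scoped Classical IntermediateField

variable {K : Type*} [Field K] [DecidableEq K] {E : WeierstrassCurve K}
  {Ω : Type*} [Field Ω] [Algebra K Ω] {n : ℕ}

/-- The action of an embedding of the function field on points. -/
def embPoint (σ : FF E →ₐ[K] Ω) : FP E →+ (E⁄Ω).toAffine.Point :=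
  Affine.Point.map (W' := E) (F := FF E) (K := Ω) σ

variable (E Ω) in
/-- The inclusion of the constant points in the points over an extension field. -/
def extPoint : E.toAffine.Point →+ (E⁄Ω).toAffine.Point :=
  Affine.Point.map (W' := E) (F := K) (K := Ω) (Algebra.ofId K Ω)

theorem xc_embPoint (σ : FF E →ₐ[K] Ω) (A : FP E) : xc (embPoint σ A) = σ (xc A) := by
  cases A
  · exact (map_zero σ).symm
  · rfl

theorem yc_embPoint (σ : FF E →ₐ[K] Ω) (A : FP E) : yc (embPoint σ A) = σ (yc A) := by
  cases A
  · exact (map_zero σ).symm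
  · rfl

theorem embPoint_ne_zero (σ : FF E →ₐ[K] Ω) {A : FP E} (hA : A ≠ 0) : embPoint σ A ≠ 0 := by
  rw [ne_eq, ← map_zero (embPoint σ)]
  exact fun h => hA (Affine.Point.map_injective (W' := E) (F := FF E) (K := Ω) (f := σ) h)

theorem xc_extPoint (S : E.toAffine.Point) : xc (extPoint E Ω S) = algebraMap K Ω (xc S) := by
  cases S
  · exact (map_zero _).symm
  · rfl

theorem yc_extPoint (S : E.toAffine.Point) : yc (extPoint E Ω S) = algebraMap K Ω (yc S) := by
  cases S
  · exact (map_zero _).symm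
  · rfl

theorem extPoint_injective : Function.Injective (extPoint E Ω) :=
  Affine.Point.map_injective (W' := E) (F := K) (K := Ω) (f := Algebra.ofId K Ω)

theorem extPoint_ne_zero {S : E.toAffine.Point} (hS : S ≠ 0) : extPoint E Ω S ≠ 0 := by
  rw [ne_eq, ← map_zero (extPoint E Ω)]
  exact fun h => hS (extPoint_injective h)

theorem embPoint_constPoint (σ : FF E →ₐ[K] Ω) (S : E.toAffine.Point) :
    embPoint σ (constPoint E S) = extPoint E Ω S := by
  by_cases hS : S = 0
  · rw [hS, map_zero, map_zero, map_zero]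
  refine point_ext (embPoint_ne_zero σ (constPoint_ne_zero hS)) (extPoint_ne_zero hS) ?_ ?_
  · rw [xc_embPoint, xc_constPoint, AlgHom.commutes, xc_extPoint]
  · rw [yc_embPoint, yc_constPoint, AlgHom.commutes, yc_extPoint]

theorem embPoint_comp (σ : FF E →ₐ[K] Ω) (φ : FF E →ₐ[K] FF E) (A : FP E) :
    embPoint (σ.comp φ) A = embPoint σ (mapPoint φ A) := by
  cases A <;> rfl

variable [E.IsElliptic] [IsAlgClosed K]

theorem algHom_ext_embPoint {φ ψ : FF E →ₐ[K] Ω}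
    (h : embPoint φ (genericPoint E) = embPoint ψ (genericPoint E)) : φ = ψ := by
  apply algHom_ext_FF
  · simpa only [xc_embPoint, xc_genericPoint] using congrArg xc h
  · simpa only [yc_embPoint, yc_genericPoint] using congrArg yc h

/-- All torsion points are defined over the algebraically closed field `K`. -/
theorem exists_extPoint_eq [IsAlgClosed Ω] (hn : 1 ≤ n) {D : (E⁄Ω).toAffine.Point} (hD : n • D = 0) :
    ∃ T : E.toAffine.Point, n • T = 0 ∧ extPoint E Ω T = D := by
  suffices h : ∃ T : E.toAffine.Point, extPoint E Ω T = D by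
    obtain ⟨T, rfl⟩ := h
    exact ⟨T, extPoint_injective (Ω := Ω) (by rw [map_nsmul, hD, map_zero]), rfl⟩
  by_cases h0 : D = 0
  · exact ⟨0, by rw [map_zero, h0]⟩
  have h := (wv_eq_zero_iff h0 n).mpr (by simpa using hD)
  have h2 := wv_sq h0 n
  rw [h, zero_pow two_ne_zero, show (E⁄Ω).ΨSq n = (E.ΨSq n).map (algebraMap K Ω) from map_ΨSq ..,
    Polynomial.eval_map_algebraMap] at h2
  obtain ⟨c, hc⟩ := mem_range_of_isAlgebraic (K := K) ⟨E.ΨSq n, PsiSq_ne_zero hn, h2.symm⟩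
  obtain ⟨T, hT, rfl⟩ := exists_xc_eq (E := E) c
  rw [← xc_extPoint, eq_comm, xc_eq_iff h0 (extPoint_ne_zero hT)] at hc
  rcases hc with rfl | rfl
  · exact ⟨T, rfl⟩
  · exact ⟨-T, map_neg _ _⟩

variable (E) in
/-- The coordinates of a multiple of the generic point generate a subfield. -/
abbrev mulField (n : ℕ) : IntermediateField K (FF E) :=
  K⟮xc (n • genericPoint E), yc (n • genericPoint E)⟯

theorem algHom_eq_of_mem_mulField {φ ψ : FF E →ₐ[K] Ω}
    (h : embPoint φ (n • genericPoint E) = embPoint ψ (n • genericPoint E)) {g : FF E} (hg : g ∈ mulField E n) :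
    φ g = ψ g := by
  induction hg using IntermediateField.adjoin_induction with
  | mem x hx =>
    rcases hx with rfl | rfl
    · rw [← xc_embPoint, h, xc_embPoint]
    · rw [← yc_embPoint, h, yc_embPoint]
  | algebraMap x => rw [AlgHom.commutes, AlgHom.commutes]
  | add x y _ _ hx hy => rw [map_add, map_add, hx, hy]
  | inv x _ hx => rw [map_inv₀, map_inv₀, hx]
  | mul x y _ _ hx hy => rw [map_mul, map_mul, hx, hy]

theorem trans_eq_of_mem_mulField {T : E.toAffine.Point} (hT : n • T = 0) {g : FF E} (hg : g ∈ mulField E n) :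
    trans T g = g := by
  refine algHom_eq_of_mem_mulField (φ := trans T) (ψ := AlgHom.id K _) (n := n) ?_ hg
  change mapPoint (trans T) _ = mapPoint (AlgHom.id K _) _
  rw [mapPoint_id, map_nsmul, mapPoint_trans, nsmul_add, ← map_nsmul, hT, map_zero, add_zero]

/-- Translation by a torsion point, as an embedding of the function field. -/
def torsionEmb (T : {T : E.toAffine.Point // n • T = 0}) : Field.Emb (mulField E n) (FF E) :=
  (IsScalarTower.toAlgHom (mulField E n) (FF E) (AlgebraicClosure (FF E))).comp
    { (trans T.1).toRingHom with
      commutes' := fun g => trans_eq_of_mem_mulField T.2 g.2 }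

theorem torsionEmb_injective : Function.Injective (torsionEmb (E := E) (n := n)) := by
  intro S T h
  have h1 : trans S.1 = trans T.1 := AlgHom.ext fun g =>
    (algebraMap (FF E) (AlgebraicClosure (FF E))).injective (DFunLike.congr_fun h g)
  have h2 := mapPoint_trans S.1
  rw [h1, mapPoint_trans T.1] at h2
  exact Subtype.ext (constPoint_injective (add_left_cancel h2)).symm

/-- An embedding over `mulField` leaves `n` times the generic point in place, so it moves the
generic point by an `n`-torsion point, and all of these are defined over `K`. -/
theorem torsionEmb_surjective (hn : 1 ≤ n) : Function.Surjective (torsionEmb (E := E) (n := n)) := by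
  intro σ
  let ι : FF E →ₐ[K] AlgebraicClosure (FF E) := IsScalarTower.toAlgHom K (FF E) (AlgebraicClosure (FF E))
  let τ : FF E →ₐ[K] AlgebraicClosure (FF E) := σ.restrictScalars K
  have hτ : ∀ g ∈ mulField E n, τ g = ι g := fun g hg => σ.commutes ⟨g, hg⟩
  have h0 : n • genericPoint E ≠ 0 := nsmul_genericPoint_ne_zero E hn
  have h1 : embPoint τ (n • genericPoint E) = embPoint ι (n • genericPoint E) := by
    refine point_ext (embPoint_ne_zero _ h0) (embPoint_ne_zero _ h0) ?_ ?_
    · rw [xc_embPoint, xc_embPoint]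
      exact hτ _ (IntermediateField.subset_adjoin _ _ (by simp))
    · rw [yc_embPoint, yc_embPoint]
      exact hτ _ (IntermediateField.subset_adjoin _ _ (by simp))
  obtain ⟨T, hT, hD⟩ := exists_extPoint_eq hn (D := embPoint τ (genericPoint E) - embPoint ι (genericPoint E))
    (by rw [nsmul_sub, ← map_nsmul, ← map_nsmul, h1, sub_self])
  have h2 : τ = ι.comp (trans T) := by
    apply algHom_ext_embPoint
    rw [embPoint_comp, mapPoint_trans, map_add, embPoint_constPoint, hD]
    abel
  exact ⟨⟨T, hT⟩, AlgHom.ext fun g => (DFunLike.congr_fun h2 g).symm⟩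

theorem finSepDegree_mulField (hn : 1 ≤ n) : Field.finSepDegree (mulField E n) (FF E) =
    Nat.card {T : E.toAffine.Point // n • T = 0} :=
  (Nat.card_eq_of_bijective _ ⟨torsionEmb_injective, torsionEmb_surjective hn⟩).symm

theorem mulInsepDegree_eq (hn : 1 ≤ n) :
    mulInsepDegree E n = Field.finInsepDegree (mulField E n) (FF E) := by
  have h := nsmul_genericPoint_ne_zero E hn
  rw [mulInsepDegree, mulField]
  generalize n • genericPoint E = A at h
  cases A
  · exact absurd rfl h
  · rfl

/-- Both numbers become `n ^ 2` when multiplied by the number of `n`-torsion points. -/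
theorem mulInsepDegree_eq_torsionMult (hn : 1 ≤ n) : (mulInsepDegree E n : ℤ) = torsionMult E n := by
  have h1 := torsionMult_mul_card (E := E) hn
  have h2 := Field.finSepDegree_mul_finInsepDegree (mulField E n) (FF E)
  rw [finSepDegree_mulField hn, ← mulInsepDegree_eq hn, finrank_adjoin_nsmul hn] at h2
  have h3 : (Nat.card {T : E.toAffine.Point // n • T = 0} : ℤ) * mulInsepDegree E n = n ^ 2 := by
    exact_mod_cast h2
  have h4 : (n : ℤ) ^ 2 ≠ 0 := by positivity
  refine mul_left_cancel₀ (left_ne_zero_of_mul (h3 ▸ h4)) ?_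
  rw [h3, mul_comm, h1]

end SeparableDegree

/-! ## The homogeneous coordinates as rational functions -/

section CoordFun

variable {K : Type*} [Field K] [DecidableEq K] {E : WeierstrassCurve K} [E.IsElliptic] [IsAlgClosed K]
  {P Q T : E.toAffine.Point} {m l c : ℕ} {a : Fin m → Fin (l + 1) → ℕ}

/-- The rational functions whose values at `Q` are homogeneous coordinates of the section point. -/
def coordFun (P : E.toAffine.Point) (c : ℕ) (a : Fin m → Fin (l + 1) → ℕ) (j : Fin (l + 1)) : FF E :=
  trans (-P) (∏ i, wv (genericPoint E) ((a i j : ℤ) - c) / wv (genericPoint E) ((a i j : ℤ) - c + 1))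

theorem wv_generic_int_ne_zero {n : ℤ} (hn : n ≠ 0) : wv (genericPoint E) n ≠ 0 := by
  obtain ⟨k, rfl | rfl⟩ := n.eq_nat_or_neg
  · exact wv_generic_ne_zero (by omega)
  · rw [wv_neg, neg_ne_zero]
    exact wv_generic_ne_zero (by omega)

theorem ord_neg_fun (T : E.toAffine.Point) (g : FF E) : ord T (-g) = ord T g := by
  by_cases hg : g = 0
  · rw [hg, neg_zero]
  rw [show -g = algebraMap K (FF E) (-1) * g by simp, ord_mul _ (by simp) hg, ord_algebraMap, zero_add]

theorem ord_wv_int {n : ℤ} (hn : n ≠ 0) (T : E.toAffine.Point) : ord T (wv (genericPoint E) n) =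
    torsionDiv 0 n.natAbs T - if T = 0 then n ^ 2 else 0 := by
  have key : ∀ k : ℕ, 1 ≤ k → ord T (wv (genericPoint E) k) =
      torsionDiv 0 k T - if T = 0 then (k : ℤ) ^ 2 else 0 := fun k hk => by
    rw [ord_wv hk, torsionDiv, sub_zero, mulInsepDegree_eq_torsionMult hk]
  obtain ⟨k, rfl | rfl⟩ := n.eq_nat_or_neg
  · rw [key k (by omega), Int.natAbs_natCast]
  · rw [wv_neg, ord_neg_fun, key k (by omega), Int.natAbs_neg, Int.natAbs_natCast, neg_sq]

theorem coordFun_ne_zero (hac : ∀ i j, (a i j : ℤ) - c ≠ 0 ∧ (a i j : ℤ) - c ≠ -1) (j : Fin (l + 1)) :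
    coordFun P c a j ≠ 0 := by
  rw [coordFun, map_ne_zero]
  refine Finset.prod_ne_zero_iff.mpr fun i _ => div_ne_zero (wv_generic_int_ne_zero (hac i j).1)
    (wv_generic_int_ne_zero fun h => (hac i j).2 (by omega))

theorem torsionDiv_sub (P T : E.toAffine.Point) (n : ℕ) : torsionDiv 0 n (T - P) = torsionDiv P n T := by
  simp only [torsionDiv, sub_zero]

/-- The last term is `(n + 1)² - n²` for `n = a i j - c`, from the poles of `ψₙ` and `ψₙ₊₁` at the
origin. Its sum does not depend on `j`, so it disappears from quotients of coordinates. -/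
theorem ord_coordFun (hac : ∀ i j, (a i j : ℤ) - c ≠ 0 ∧ (a i j : ℤ) - c ≠ -1) (j : Fin (l + 1)) :
    ord T (coordFun P c a j) = ∑ i, (torsionDiv P ((a i j : ℤ) - c).natAbs T -
      torsionDiv P ((a i j : ℤ) + 1 - c).natAbs T) + if T = P then ∑ i, (2 * ((a i j : ℤ) - c) + 1) else 0 := by
  have h0 := fun i => wv_generic_int_ne_zero (E := E) (hac i j).1
  have h1 := fun i => wv_generic_int_ne_zero (E := E) (n := (a i j : ℤ) - c + 1)
    (fun h => (hac i j).2 (by omega))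
  have h2 : ∀ i, (a i j : ℤ) - c + 1 ≠ 0 := fun i h => (hac i j).2 (by omega)
  rw [coordFun, ord_trans, ← sub_eq_add_neg, ord_prod _ fun i _ => div_ne_zero (h0 i) (h1 i)]
  have h3 : (if T = P then ∑ i, (2 * ((a i j : ℤ) - c) + 1) else 0) =
      ∑ i, if T = P then (2 * ((a i j : ℤ) - c) + 1) else 0 := by
    split_ifs <;> simp
  rw [h3, ← Finset.sum_add_distrib]
  refine Finset.sum_congr rfl fun i _ => ?_
  rw [ord_div _ (h0 i) (h1 i), ord_wv_int (hac i j).1, ord_wv_int (h2 i), torsionDiv_sub, torsionDiv_sub]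
  simp only [sub_eq_zero, sub_add_eq_add_sub]
  split_ifs <;> ring

theorem hasDivisor_coordFun_div (hac : ∀ i j, (a i j : ℤ) - c ≠ 0 ∧ (a i j : ℤ) - c ≠ -1)
    (hsum : ∀ j j', ∑ i, a i j = ∑ i, a i j') (j j' : Fin (l + 1)) :
    HasDivisor (coordFun P c a j / coordFun P c a j') (∑ i,
      (torsionDiv P ((a i j : ℤ) - c).natAbs - torsionDiv P ((a i j' : ℤ) - c).natAbs
        - torsionDiv P ((a i j : ℤ) + 1 - c).natAbs + torsionDiv P ((a i j' : ℤ) + 1 - c).natAbs)) := by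
  intro T
  have h0 := coordFun_ne_zero (P := P) hac j
  have h1 := coordFun_ne_zero (P := P) hac j'
  rw [hasOrder_iff_ord]
  refine ⟨div_ne_zero h0 h1, ?_⟩
  have hs : ∑ i, (2 * ((a i j : ℤ) - c) + 1) = ∑ i, (2 * ((a i j' : ℤ) - c) + 1) := by
    have : ∑ i, (a i j : ℤ) = ∑ i, (a i j' : ℤ) := by exact_mod_cast hsum j j'
    simp only [Finset.sum_add_distrib, ← Finset.mul_sum, Finset.sum_sub_distrib, this]
  rw [ord_div _ h0 h1, ord_coordFun hac, ord_coordFun hac, hs, add_sub_add_right_eq_sub,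
    ← Finset.sum_sub_distrib, Finset.sum_apply]
  refine Finset.sum_congr rfl fun i _ => ?_
  simp only [Pi.add_apply, Pi.sub_apply]
  ring

theorem hasValue_coordFun (hm : 0 < m) (hQ : Q ∈ goodLocus P c a) (j : Fin (l + 1)) :
    HasValue Q (coordFun P c a j) (coordVec (Q - P) c a j) := by
  have hu := (ne_zero_of_goodLocus hm hQ).1
  rw [coordFun, hasValue_trans_iff, ← sub_eq_add_neg]
  refine HasValue.prod _ fun i _ => (hasValue_wv_generic hu _).div (hasValue_wv_generic hu _) ?_
  exact mt (wv_eq_zero_iff hu _).mp (mem_goodLocus.mp hQ i j).2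

end CoordFun

/-! ### The coordinate functions are defined over the base field -/

section Defined

variable {k K : Type*} [Field k] [DecidableEq k] [Field K] [DecidableEq K] [Algebra k K] [IsAlgClosed K]
  {W : WeierstrassCurve k} [W.IsElliptic] {m l c : ℕ} {a : Fin m → Fin (l + 1) → ℕ}

theorem xc_baseChange (S : (W⁄k).toAffine.Point) :
    xc (Affine.Point.baseChange k K S) = algebraMap k K (xc S) := by
  cases S
  · exact (map_zero _).symm
  · rfl

theorem yc_baseChange (S : (W⁄k).toAffine.Point) :
    yc (Affine.Point.baseChange k K S) = algebraMap k K (yc S) := by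
  cases S
  · exact (map_zero _).symm
  · rfl

theorem isDefinedOver_coordFun (S : (W⁄k).toAffine.Point) (j : Fin (l + 1)) :
    IsDefinedOver k (coordFun (Affine.Point.baseChange k K S) c a j) := by
  rw [coordFun, ← map_neg, map_prod, ← mem_definedOver]
  refine prod_mem fun i _ => ?_
  rw [map_div₀]
  exact div_mem (isDefinedOver_trans_wv _ (xc_baseChange _) (yc_baseChange _) _)
    (isDefinedOver_trans_wv _ (xc_baseChange _) (yc_baseChange _) _)

end Defined

theorem rep_eq_smul {K : Type*} [Field K] {l : ℕ} {v : Fin (l + 1) → K} (hv : v ≠ 0) :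
    ∃ t : K, t ≠ 0 ∧ (Projectivization.mk K v hv).rep = t • v := by
  have h := Projectivization.mk_rep (Projectivization.mk K v hv)
  rw [Projectivization.mk_eq_mk_iff'] at h
  obtain ⟨t, ht⟩ := h
  refine ⟨t, ?_, ht.symm⟩
  rintro rfl
  exact Projectivization.rep_nonzero _ (by rw [← ht, zero_smul])

theorem mk_eq_of_div_eq {K : Type*} [Field K] {l : ℕ} {v w : Fin (l + 1) → K} (hv : ∀ j, v j ≠ 0)
    (hw : ∀ j, w j ≠ 0) (h : ∀ j j', v j / v j' = w j / w j') (hv0 : v ≠ 0) (hw0 : w ≠ 0) :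
    Projectivization.mk K w hw0 = Projectivization.mk K v hv0 := by
  rw [Projectivization.mk_eq_mk_iff']
  refine ⟨w 0 / v 0, ?_⟩
  ext j
  have := h j 0
  rw [div_eq_div_iff (hv 0) (hw 0)] at this
  rw [Pi.smul_apply, smul_eq_mul, div_mul_eq_mul_div, div_eq_iff (hv 0)]
  linear_combination this

/-! ## Points of given order -/

section Order

variable {K : Type*} [Field K] [DecidableEq K] {E : WeierstrassCurve K} [E.IsElliptic] [IsAlgClosed K]

/-- Multiplication by `n` is surjective. -/
theorem exists_nsmul_eq {n : ℕ} (hn : 1 ≤ n) (S : E.toAffine.Point) : ∃ T, n • T = S := by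
  by_cases hS : S = 0
  · exact ⟨0, by rw [smul_zero, hS]⟩
  have hlt := natDegree_PsiSq_lt (E := E) hn
  -- A root of this polynomial is the abscissa of a point `T` with `x(nT) = x(S)`, hence `nT = ±S`.
  have hdeg : (E.Φ n - Polynomial.C (xc S) * E.ΨSq n).natDegree = (E.Φ n).natDegree :=
    Polynomial.natDegree_sub_eq_left_of_natDegree_lt
      ((Polynomial.natDegree_C_mul_le _ _).trans_lt hlt)
  obtain ⟨x, hx⟩ := IsAlgClosed.exists_root (E.Φ n - Polynomial.C (xc S) * E.ΨSq n) fun h => by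
    rw [Polynomial.natDegree_eq_zero_iff_degree_le_zero.mpr h.le] at hdeg
    omega
  obtain ⟨T, hT, rfl⟩ := exists_xc_eq (E := E) x
  rw [Polynomial.IsRoot, Polynomial.eval_sub, Polynomial.eval_mul, Polynomial.eval_C] at hx
  have hnT : n • T ≠ 0 := by
    intro h
    refine Phi_eval_ne_zero hT h ?_
    rwa [← wv_sq hT, (wv_eq_zero_iff hT n).mpr (by simpa using h), zero_pow two_ne_zero, mul_zero, sub_zero] at hx
  have hw : wv T n ≠ 0 := by rwa [ne_eq, wv_eq_zero_iff hT, natCast_zsmul]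
  have h1 := xc_nsmul_mul hT hnT
  have h2 := phi_eval hT n
  rw [← wv_sq hT, ← h2] at hx
  have h3 : xc (n • T) = xc S := by
    refine mul_right_cancel₀ (pow_ne_zero 2 hw) ?_
    linear_combination hx - h1
  rcases (xc_eq_iff hnT hS).mp h3 with h | h
  · exact ⟨T, h⟩
  · exact ⟨-T, by rw [smul_neg, h, neg_neg]⟩

/-- For `r` the characteristic this is the hypothesis; for other `r` the polynomial `ΨSq` at `r` has
positive degree `r ^ 2 - 1`, hence a root. -/
theorem exists_prime_torsion (hE : ¬ IsSupersingular E) {r : ℕ} (hr : r.Prime) :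
    ∃ T : E.toAffine.Point, T ≠ 0 ∧ r • T = 0 := by
  by_cases h : (r : K) = 0
  · have : CharP K r := by
      have := CharP.ringChar_of_prime_eq_zero hr h
      exact this ▸ ringChar.charP K
    by_contra! hc
    exact hE ⟨r, hr, this, fun T hT => by_contra fun h0 => hc T h0 hT⟩
  · obtain ⟨x, hx⟩ := IsAlgClosed.exists_root (E.ΨSq r) fun h0 => by
      have h1 := E.natDegree_ΨSq (n := r) (by exact_mod_cast h)
      have h2 : 2 ^ 2 ≤ r ^ 2 := Nat.pow_le_pow_left hr.two_le 2
      rw [Polynomial.natDegree_eq_zero_iff_degree_le_zero.mpr h0.le, Int.natAbs_natCast] at h1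
      omega
    obtain ⟨T, hT, rfl⟩ := exists_xc_eq (E := E) x
    rw [Polynomial.IsRoot, ← wv_sq hT, pow_eq_zero_iff two_ne_zero, wv_eq_zero_iff hT, natCast_zsmul] at hx
    exact ⟨T, hT, hx⟩

/-- For a prime power, a nonzero `r`-torsion point is divided by a power of `r`; points of coprime
orders are added. -/
theorem exists_addOrderOf_eq (hE : ¬ IsSupersingular E) {n : ℕ} (hn : 1 ≤ n) :
    ∃ T : E.toAffine.Point, addOrderOf T = n := by
  induction n using Nat.recOnPosPrimePosCoprime with
  | prime_pow r k hr hk =>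
    obtain ⟨T₀, hT0, hT⟩ := exists_prime_torsion hE hr
    obtain ⟨S, hS⟩ := exists_nsmul_eq (n := r ^ (k - 1)) (Nat.pow_pos hr.pos) T₀
    refine ⟨S, ?_⟩
    obtain ⟨k, rfl⟩ : ∃ k', k = k' + 1 := ⟨k - 1, by omega⟩
    have := Fact.mk hr
    refine addOrderOf_eq_prime_pow ?_ ?_
    · rw [Nat.add_sub_cancel] at hS
      rwa [hS]
    · rw [Nat.add_sub_cancel] at hS
      rw [pow_succ', mul_smul, hS, hT]
  | zero => omega
  | one => exact ⟨0, addOrderOf_zero⟩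
  | coprime a b ha hb hab iha ihb =>
    obtain ⟨S, rfl⟩ := iha (by omega)
    obtain ⟨T, rfl⟩ := ihb (by omega)
    exact ⟨S + T, (AddCommute.all S T).addOrderOf_add_eq_mul_addOrderOf_of_coprime hab⟩

end Order

/-! ## Nondegeneracy -/

section Nondegenerate

variable {K : Type*} [Field K] [DecidableEq K] {E : WeierstrassCurve K}

theorem exists_polynomial_of_polyFun_ne_zero {p : Polynomial K[X]} (hp : polyFun E p ≠ 0) :
    ∃ N : K[X], N ≠ 0 ∧ ∀ T : E.toAffine.Point, T ≠ 0 → N.eval (xc T) ≠ 0 →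
      ∃ v, v ≠ 0 ∧ HasValue T (polyFun E p) v := by
  obtain ⟨q, N, hN, h⟩ := exists_polyFun_mul hp
  refine ⟨N, hN, fun T hT hNT => ⟨_, ?_, hasValue_polyFun hT p⟩⟩
  have h1 := (hasValue_polyFun hT p).mul (hasValue_polyFun hT q)
  rw [h] at h1
  have h2 := ((hasValue_xFun hT).aeval N).unique h1
  exact left_ne_zero_of_mul (h2 ▸ hNT)

/-- A nonzero function is a unit away from the zeros of some polynomial in `x`. -/
theorem exists_polynomial_of_ne_zero {g : FF E} (hg : g ≠ 0) :
    ∃ N : K[X], N ≠ 0 ∧ ∀ T : E.toAffine.Point, T ≠ 0 → N.eval (xc T) ≠ 0 → ∃ v, v ≠ 0 ∧ HasValue T g v := by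
  obtain ⟨a, b, hb, rfl⟩ := IsFractionRing.div_surjective (A := E.toAffine.CoordinateRing) g
  obtain ⟨r, rfl⟩ := Ideal.Quotient.mk_surjective a
  obtain ⟨s, rfl⟩ := Ideal.Quotient.mk_surjective b
  change polyFun E r / polyFun E s ≠ 0 at hg
  obtain ⟨N, hN, h⟩ := exists_polynomial_of_polyFun_ne_zero (div_ne_zero_iff.mp hg).1
  obtain ⟨M, hM, h'⟩ := exists_polynomial_of_polyFun_ne_zero (div_ne_zero_iff.mp hg).2
  refine ⟨N * M, mul_ne_zero hN hM, fun T hT hT' => ?_⟩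
  rw [Polynomial.eval_mul] at hT'
  obtain ⟨v, hv, hvr⟩ := h T hT (left_ne_zero_of_mul hT')
  obtain ⟨w, hw, hws⟩ := h' T hT (right_ne_zero_of_mul hT')
  exact ⟨v / w, div_ne_zero hv hw, hvr.div hws hw⟩

variable [E.IsElliptic] [IsAlgClosed K] {m l c : ℕ} {a : Fin m → Fin (l + 1) → ℕ} {P : E.toAffine.Point}

theorem exists_point_eval_ne_zero {N : K[X]} (hN : N ≠ 0) :
    ∃ T : E.toAffine.Point, T ≠ 0 ∧ N.eval (xc T) ≠ 0 := by
  obtain ⟨x, hx⟩ : ∃ x, N.eval x ≠ 0 := by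
    by_contra! h
    exact hN (Polynomial.funext fun x => by rw [h x, Polynomial.eval_zero])
  obtain ⟨T, hT, rfl⟩ := exists_xc_eq (E := E) x
  exact ⟨T, hT, hx⟩

/-- A family of linearly independent functions gives a nondegenerate map. -/
theorem isNondegenerate_of_linearIndependent {g : Fin (l + 1) → FF E} (hg : LinearIndependent K g)
    {f : E.toAffine.Point → Projectivization K (Fin (l + 1) → K)}
    (hf : ∀ T v, (∀ j, HasValue T (g j) (v j)) → ∀ hv : v ≠ 0, f T = Projectivization.mk K v hv) :
    IsNondegenerate f := by
  intro φ hφ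
  have hg0 : ∀ j, g j ≠ 0 := fun j => hg.ne_zero j
  have hG : ∑ j, φ (Pi.single j 1) • g j ≠ 0 := by
    intro h
    apply hφ
    have := Fintype.linearIndependent_iff.mp hg _ h
    ext j
    simpa using this j
  choose N hN hN' using fun j => exists_polynomial_of_ne_zero (hg0 j)
  obtain ⟨M, hM, hM'⟩ := exists_polynomial_of_ne_zero hG
  -- A point where the linear combination and all the coordinate functions are units; only finitely
  -- many abscissae have to be avoided.
  obtain ⟨T, hT, hT'⟩ := exists_point_eval_ne_zero (E := E)
    (mul_ne_zero hM (Finset.prod_ne_zero_iff.mpr fun j (_ : j ∈ Finset.univ) => hN j))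
  rw [Polynomial.eval_mul, Polynomial.eval_prod] at hT'
  choose v hv hvg using fun j => hN' j T hT
    (Finset.prod_ne_zero_iff.mp (right_ne_zero_of_mul hT') j (Finset.mem_univ j))
  obtain ⟨w, hw, hwG⟩ := hM' T hT (left_ne_zero_of_mul hT')
  have hv0 : v ≠ 0 := fun h => hv 0 (congrFun h 0)
  refine ⟨T, ?_⟩
  rw [hf T v hvg hv0]
  obtain ⟨t, ht, hrep⟩ := rep_eq_smul hv0
  rw [hrep, map_smul, smul_eq_mul]
  refine mul_ne_zero ht ?_
  have h1 : HasValue T (∑ j, φ (Pi.single j 1) • g j) (∑ j, φ (Pi.single j 1) * v j) :=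
    HasValue.sum _ fun j _ => by
      rw [Algebra.smul_def]
      exact (hasValue_algebraMap T _).mul (hvg j)
  have h2 : φ v = ∑ j, φ (Pi.single j 1) * v j := by
    conv_lhs => rw [← Finset.univ_sum_single v]
    rw [map_sum]
    refine Finset.sum_congr rfl fun j _ => ?_
    rw [mul_comm, ← smul_eq_mul, ← map_smul, ← Pi.single_smul, smul_eq_mul, mul_one]
  rw [h2, ← hwG.unique h1]
  exact hw

/-- Functions with poles at distinct levels: the `j`-th function has a pole at a point where the
functions of lower level have none. -/
theorem linearIndependent_of_ord {g : Fin (l + 1) → FF E} (M : Fin (l + 1) → ℕ) (hM : Function.Injective M)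
    (hg : ∀ j, g j ≠ 0) (R : Fin (l + 1) → E.toAffine.Point) (h0 : ∀ j, ord (R j) (g j) < 0)
    (h1 : ∀ i j, M i < M j → 0 ≤ ord (R j) (g i)) : LinearIndependent K g := by
  rw [Fintype.linearIndependent_iff]
  intro w hw
  by_contra! hne
  obtain ⟨j₀, hj₀⟩ := hne
  obtain ⟨j, hj, hmax⟩ := Finset.exists_max_image (Finset.univ.filter fun j => w j ≠ 0) M
    ⟨j₀, by simpa using hj₀⟩
  rw [Finset.mem_filter] at hj
  rw [← Finset.add_sum_erase _ _ (Finset.mem_univ j), add_eq_zero_iff_eq_neg] at hw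
  have hwj : algebraMap K (FF E) (w j) ≠ 0 := by simpa using hj.2
  have h2 : ord (R j) (w j • g j) < 0 := by
    rw [Algebra.smul_def, ord_mul _ hwj (hg j), ord_algebraMap, zero_add]
    exact h0 j
  rw [hw, ord_neg_fun] at h2
  refine absurd h2 (not_lt.mpr (le_ord_sum _ (fun i hi h => ?_) fun h => ?_))
  · rw [Algebra.smul_def] at h ⊢
    rw [ord_mul _ (left_ne_zero_of_mul h) (hg i), ord_algebraMap, zero_add]
    have hwi : w i ≠ 0 := fun h' => left_ne_zero_of_mul h (by rw [h', map_zero])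
    refine h1 i j (lt_of_le_of_ne (hmax i (by simpa using hwi)) fun he => ?_)
    exact Finset.ne_of_mem_erase hi (hM he)
  · rw [h, neg_zero] at hw
    exact smul_ne_zero hj.2 (hg j) hw

/-! ### The poles of the coordinate functions -/

theorem mulInsepDegree_pos {n : ℕ} (hn : 1 ≤ n) : 0 < mulInsepDegree E n := by
  have h := torsionMult_mul_card (E := E) hn
  rw [← mulInsepDegree_eq_torsionMult hn] at h
  refine Nat.pos_of_ne_zero fun h0 => ?_
  rw [h0, Nat.cast_zero, zero_mul] at h
  exact absurd h.symm (by positivity)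

theorem torsionDiv_add (T : E.toAffine.Point) (n : ℕ) : torsionDiv P n (P + T) =
    if addOrderOf T ∣ n then (mulInsepDegree E n : ℤ) else 0 := by
  simp only [torsionDiv, add_sub_cancel_left, addOrderOf_dvd_iff_nsmul_eq_zero]

theorem torsionDiv_add_nonneg (T : E.toAffine.Point) (n : ℕ) : 0 ≤ torsionDiv P n (P + T) := by
  rw [torsionDiv_add]
  split_ifs
  · exact Int.natCast_nonneg _
  · exact le_rfl

theorem torsionDiv_add_eq_zero {T : E.toAffine.Point} {n : ℕ} (h0 : 1 ≤ n) (hn : n < addOrderOf T) :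
    torsionDiv P n (P + T) = 0 := by
  rw [torsionDiv_add, if_neg fun h => absurd (Nat.le_of_dvd h0 h) (not_le.mpr hn)]

theorem torsionDiv_add_pos {T : E.toAffine.Point} (hT : 1 ≤ addOrderOf T) :
    0 < torsionDiv P (addOrderOf T) (P + T) := by
  rw [torsionDiv_add, if_pos dvd_rfl]
  exact_mod_cast mulInsepDegree_pos hT

theorem torsionDiv_add_succ {T : E.toAffine.Point} (hT : 2 ≤ addOrderOf T) :
    torsionDiv P (addOrderOf T + 1) (P + T) = 0 := by
  rw [torsionDiv_add, if_neg fun h => ?_]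
  have := Nat.le_of_dvd one_pos ((Nat.dvd_add_right dvd_rfl).mp h)
  omega

/-- The coefficient at `P + T` of the divisor of a function attached to a positive number `p` and a
negative number `-q`. -/
def poleCoeff (P T : E.toAffine.Point) (p q : ℕ) : ℤ :=
  torsionDiv P p (P + T) - torsionDiv P (p + 1) (P + T) +
    (torsionDiv P q (P + T) - torsionDiv P (q - 1) (P + T))

/-- The order of `T` equals `p + 1` or `q - 1`, which gives a negative term. No positive term
compensates: `p` is too small, and `q` is either below the order of `T` or one more than it, the
case `q = p + 1` being excluded. -/
theorem poleCoeff_neg {T : E.toAffine.Point} {p q : ℕ} (hp : 1 ≤ p) (hq : 2 ≤ q) (hpq : p + 1 ≠ q)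
    (hT : addOrderOf T = max (p + 1) (q - 1)) : poleCoeff P T p q < 0 := by
  have h2 : 2 ≤ addOrderOf T := by omega
  have hpos := torsionDiv_add_pos (P := P) (T := T) (by omega)
  have hp0 : torsionDiv P p (P + T) = 0 := torsionDiv_add_eq_zero hp (by omega)
  have hq0 : torsionDiv P q (P + T) = 0 := by
    by_cases h : q < addOrderOf T
    · exact torsionDiv_add_eq_zero (by omega) h
    · rw [show q = addOrderOf T + 1 by omega, torsionDiv_add_succ h2]
  have h3 := torsionDiv_add_nonneg (P := P) T (p + 1)
  have h4 := torsionDiv_add_nonneg (P := P) T (q - 1)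
  rw [poleCoeff, hp0, hq0]
  rcases max_choice (p + 1) (q - 1) with h | h
  · rw [hT, h] at hpos
    omega
  · rw [hT, h] at hpos
    omega

theorem poleCoeff_nonneg {T : E.toAffine.Point} {p q : ℕ} (hq : 2 ≤ q)
    (hT : max (p + 1) (q - 1) < addOrderOf T) : 0 ≤ poleCoeff P T p q := by
  have h1 := torsionDiv_add_nonneg (P := P) T p
  have h2 := torsionDiv_add_nonneg (P := P) T q
  have h3 : torsionDiv P (p + 1) (P + T) = 0 := torsionDiv_add_eq_zero (by omega) (by omega)
  have h4 : torsionDiv P (q - 1) (P + T) = 0 := torsionDiv_add_eq_zero (by omega) (by omega)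
  rw [poleCoeff, h3, h4]
  omega

/-- The bounds on `p` and `q` express that `a i j - c` is neither `0` nor `-1`. -/
theorem exists_pos_neg {a : Fin 2 → Fin (l + 1) → ℕ} {j : Fin (l + 1)}
    (hac : ∀ i j, (a i j : ℤ) - c ≠ 0 ∧ (a i j : ℤ) - c ≠ -1) (h : ∃! i, a i j < c) :
    ∃ i i' : Fin 2, ∃ p q : ℕ, i ≠ i' ∧ 1 ≤ p ∧ 2 ≤ q ∧ a i j = c + p ∧ a i' j + q = c := by
  obtain ⟨i', hi', huniq⟩ := h
  obtain ⟨i, hi⟩ := exists_ne i'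
  have h1 := hac i' j
  have h2 := hac i j
  have h3 : ¬ a i j < c := fun h => hi (huniq i h)
  exact ⟨i, i', a i j - c, c - a i' j, hi, by omega, by omega, by omega,
    by omega⟩

theorem sum_fin_two {M : Type*} [AddCommMonoid M] (f : Fin 2 → M) {i i' : Fin 2} (h : i ≠ i') :
    ∑ k, f k = f i + f i' := by
  rw [show (Finset.univ : Finset (Fin 2)) = {i, i'} by revert i i'; decide, Finset.sum_pair h]

theorem linearIndependent_coordFun {a : Fin 2 → Fin (l + 1) → ℕ} (hE : ¬ IsSupersingular E)
    (hac : ∀ i j, (a i j : ℤ) - c ≠ 0 ∧ (a i j : ℤ) - c ≠ -1)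
    (hsum : ∀ j j', ∑ i, a i j = ∑ i, a i j')
    (hinj : Function.Injective (fun p : Fin 2 × Fin (l + 1) => a p.1 p.2))
    (hne : ∀ j, ∑ i, (a i j : ℤ) ≠ 2 * c - 1) (hneg : ∀ j, ∃! i, a i j < c) :
    LinearIndependent K (coordFun P c a) := by
  choose i i' p q hii hp hq hip hiq using fun j => exists_pos_neg hac (hneg j)
  have hs : ∀ j, a (i j) j + a (i' j) j = a (i 0) 0 + a (i' 0) 0 := fun j => by
    rw [← sum_fin_two (fun k => a k j) (hii j), ← sum_fin_two (fun k => a k 0) (hii 0), hsum]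
  -- As the sum of the two entries is `2c + p - q`, this is the condition that it is not `2c - 1`.
  have hpq : ∀ j, p j + 1 ≠ q j := fun j h => by
    have h1 := hne j
    rw [sum_fin_two (fun k => (a k j : ℤ)) (hii j)] at h1
    have h2 := hip j
    have h3 := hiq j
    omega
  let M : Fin (l + 1) → ℕ := fun j => max (p j + 1) (q j - 1)
  -- The difference `p j - q j` is independent of `j`, so `M j` is a strictly increasing function of
  -- `p j`; and `p j` determines an entry of the array `a`, hence `j`.
  have hM : Function.Injective M := by
    intro j j' h
    have h1 := hs j
    have h2 := hs j'
    have h3 := hip j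
    have h4 := hip j'
    have h5 := hiq j
    have h6 := hiq j'
    simp only [M] at h
    have h7 := hq j
    have h8 := hq j'
    have h9 : p j = p j' := by omega
    have := @hinj (i j, j) (i j', j') (by simp only; omega)
    exact congrArg Prod.snd this
  -- The point `P + T j` is a pole of the `j`-th function and not of those with smaller `M`. It
  -- differs from `P`, so the extra term of `ord_coordFun` is absent.
  choose T hT using fun j => exists_addOrderOf_eq (E := E) hE (n := M j) (by simp only [M]; omega)
  have hT0 : ∀ j, P + T j ≠ P := fun j h => by
    have h1 := hT j
    rw [add_eq_left.mp h, addOrderOf_zero] at h1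
    have h2 := hp j
    simp only [M] at h1
    omega
  have hord : ∀ j₁ j₂, ord (P + T j₁) (coordFun P c a j₂) = poleCoeff P (T j₁) (p j₂) (q j₂) := by
    intro j₁ j₂
    rw [ord_coordFun hac, if_neg (hT0 j₁), add_zero, sum_fin_two _ (hii j₂), poleCoeff]
    have h1 := hip j₂
    have h2 := hiq j₂
    have h3 := hq j₂
    congr 4 <;> omega
  refine linearIndependent_of_ord M hM (coordFun_ne_zero hac) (fun j => P + T j) (fun j => ?_)
    fun j₁ j₂ h => ?_
  · rw [hord]
    exact poleCoeff_neg (hp j) (hq j) (hpq j) (hT j)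
  · rw [hord]
    exact poleCoeff_nonneg (hq j₁) (by rw [hT]; exact h)

end Nondegenerate

end MarkedGenusOne

end

theorem mainTheorem4 {k K : Type*} [Field k] [Field K] [DecidableEq k] [DecidableEq K]
    [Algebra k K] [IsAlgClosed K] (W : WeierstrassCurve k) [W.IsElliptic]
    (P₀ : (W⁄k).toAffine.Point) (P : (W⁄K).toAffine.Point)
    (hP : P = Affine.Point.baseChange k K P₀)
    (m l c d : ℕ) (hm : 2 ≤ m) (hl : 1 ≤ l) (a b : Fin m → Fin (l + 1) → ℕ)
    (hab : ∀ i j, (a i j : ℤ) + b i j = d - 1)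
    (hac : ∀ i j, (a i j : ℤ) - c ≠ 0 ∧ (a i j : ℤ) - c ≠ -1)
    (hsum : ∀ j j', ∑ i, a i j = ∑ i, a i j') :
    ∃ f : (W⁄K).toAffine.Point → Projectivization K (Fin (l + 1) → K),
      MarkedGenusOne.IsMorphism k f ∧
      (∀ Q ∈ MarkedGenusOne.goodLocus P c a,
        (∃ v, MarkedGenusOne.IsSectionPoint P Q c d a b v) ∧
        ∀ v, MarkedGenusOne.IsSectionPoint P Q c d a b v →
          ∃ hv : v ≠ 0, f Q = Projectivization.mk K v hv) ∧
      (∀ j j', ∃ F : (W⁄K).toAffine.FunctionField, MarkedGenusOne.IsDefinedOver k F ∧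
        (∀ Q ∈ MarkedGenusOne.goodLocus P c a,
          (f Q).rep j' ≠ 0 ∧ MarkedGenusOne.HasValue Q F ((f Q).rep j / (f Q).rep j')) ∧
        MarkedGenusOne.HasDivisor F (∑ i,
          (MarkedGenusOne.torsionDiv P ((a i j : ℤ) - c).natAbs
            - MarkedGenusOne.torsionDiv P ((a i j' : ℤ) - c).natAbs
            - MarkedGenusOne.torsionDiv P ((a i j : ℤ) + 1 - c).natAbs
            + MarkedGenusOne.torsionDiv P ((a i j' : ℤ) + 1 - c).natAbs))) ∧
      (¬ MarkedGenusOne.IsSupersingular (W⁄K) → m = 2 →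
        Function.Injective (fun p : Fin m × Fin (l + 1) => a p.1 p.2) →
        (∀ j, ∑ i, (a i j : ℤ) ≠ 2 * c - 1) →
        (∀ j, ∃! i, a i j < c) →
        MarkedGenusOne.IsNondegenerate f) := by
  subst hP
  have hm0 : 0 < m := by omega
  have hg0 := MarkedGenusOne.coordFun_ne_zero (P := Affine.Point.baseChange k K P₀) hac
  have hgk := MarkedGenusOne.isDefinedOver_coordFun (K := K) (c := c) (a := a) P₀
  -- The morphism is built from `coordFun` on the whole curve and is afterwards identified with the
  -- section point on the good locus.
  obtain ⟨f, hf, hval⟩ := MarkedGenusOne.exists_isMorphism hg0 hgk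
  have hval' : ∀ T v, (∀ j, MarkedGenusOne.HasValue T
      (MarkedGenusOne.coordFun (Affine.Point.baseChange k K P₀) c a j) (v j)) →
      ∀ hv : v ≠ 0, f T = Projectivization.mk K v hv := fun T v hv =>
    hval T 1 v fun j => by rw [one_mul]; exact hv j
  have hQ : ∀ Q ∈ MarkedGenusOne.goodLocus (Affine.Point.baseChange k K P₀) c a, ∃ hv : _ ≠ 0,
      f Q = Projectivization.mk K
        (MarkedGenusOne.coordVec (Q - Affine.Point.baseChange k K P₀) c a) hv := fun Q hQ =>
    ⟨fun h => MarkedGenusOne.coordVec_ne_zero hm0 hQ 0 (congrFun h 0),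
      hval' Q _ (MarkedGenusOne.hasValue_coordFun hm0 hQ) _⟩
  refine ⟨f, hf, fun Q hgood => ⟨⟨_, (MarkedGenusOne.isSectionPoint_iff hm0 hab hsum hgood).mpr
    ⟨MarkedGenusOne.coordVec_ne_zero hm0 hgood, fun _ _ => rfl⟩⟩, fun v hv => ?_⟩, fun j j' => ?_, ?_⟩
  · obtain ⟨hv1, hv2⟩ := (MarkedGenusOne.isSectionPoint_iff hm0 hab hsum hgood).mp hv
    obtain ⟨hw, hfQ⟩ := hQ Q hgood
    have hv0 : v ≠ 0 := fun h => hv1 0 (congrFun h 0)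
    exact ⟨hv0, hfQ.trans (MarkedGenusOne.mk_eq_of_div_eq hv1
      (MarkedGenusOne.coordVec_ne_zero hm0 hgood) hv2 hv0 hw)⟩
  · refine ⟨_, ?_, fun Q hgood => ?_, MarkedGenusOne.hasDivisor_coordFun_div hac hsum j j'⟩
    · rw [div_eq_mul_inv]
      exact (hgk j).mul (hgk j').inv
    · obtain ⟨hw, hfQ⟩ := hQ Q hgood
      obtain ⟨t, ht, hrep⟩ := MarkedGenusOne.rep_eq_smul hw
      have hc := MarkedGenusOne.coordVec_ne_zero hm0 hgood
      rw [hfQ, hrep]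
      simp only [Pi.smul_apply, smul_eq_mul]
      refine ⟨mul_ne_zero ht (hc j'), ?_⟩
      rw [mul_div_mul_left _ _ ht]
      exact (MarkedGenusOne.hasValue_coordFun hm0 hgood j).div
        (MarkedGenusOne.hasValue_coordFun hm0 hgood j') (hc j')
  · rintro hE rfl hinj hne hneg
    exact MarkedGenusOne.isNondegenerate_of_linearIndependent
      (MarkedGenusOne.linearIndependent_coordFun hE hac hsum hinj hne hneg) hval'
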